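/- A partition $\lambda$ of a positive integer is a finite non-empty multiset of positive integers (its parts); its size $|\lambda|$ is the sum of its parts, and $(k)$ denotes the partition with the single part $k$. Let $\Lambda$ be a (possibly infinite) set of partitions of positive integers with $(1)\in\Lambda$. For a prime power $q$, an integer $d\ge 0$, an element $\alpha\in\mathrm{GL}(d,q)$ and a monic irreducible polynomial $f$ over $\mathbb{F}_q$, let $\lambda_f(\alpha)$ be the (possibly empty) partition with parts $a_1,\dots,a_n$, where $f^{a_1},\dots,f^{a_n}$ are the powers of $f$ amongst the elementary divisors of $\alpha$. Say that $\alpha$ is of $\Lambda$-type if, for every $f$, the partition $\lambda_f(\alpha)$ is empty or belongs to $\Lambda$. Let $\Lambda_{\mathrm{GL}(d,q)}$ be the probability that a uniformly random element of $\mathrm{GL}(d,q)$ is of $\Lambda$-type, and let $\Lambda_{\mathrm{GL}(\infty,q)}:=\lim_{d\to\infty}\Lambda_{\mathrm{GL}(d,q)}$. Define $$\sigma:=\begin{cases}1-\frac1k & \text{if $k$ is the size of the smallest one-part partition not in $\Lambda$,}\\ 1 & \text{if $\Lambda$ contains all one-part partitions.}\end{cases}$$ Then the limit $\Lambda_{\mathrm{GL}(\infty,q)}$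 exists for every prime power $q$, and there are unique real sequences $(a_{d,j})_{j\ge 0}$ (for each $d\ge0$) and $(b_j)_{j\ge0}$, not depending on $q$, such that for every prime power $q$ the expansions $$\Lambda_{\mathrm{GL}(d,q)}=\sum_{j\ge0}a_{d,j}\,q^{-j},\qquad \Lambda_{\mathrm{GL}(\infty,q)}=\sum_{j\ge0}b_j\,q^{-j}$$ hold with convergent right-hand sides. Moreover $a_{d,j}=b_j$ for all integers $d,j\ge 0$ with $j<(d+1)\sigma$; that is, the coefficient of $q^{-j}$ in $\Lambda_{\mathrm{GL}(d,q)}$ equals the coefficient of $q^{-j}$ in $\Lambda_{\mathrm{GL}(\infty,q)}$ whenever $j<(d+1)\sigma$. -/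

import Mathlib

open scoped DirectSum Polynomial Matrix

/-- The partitions of all natural numbers, a partition being recorded together with its size.
(The empty partition is among them; whether it lies in a set `Λ` plays no role below.) -/
abbrev AnyPartition : Type := Σ n : ℕ, n.Partition

/-- For `k ≥ 1`, the partition `(k)` of `k` with the single part `k`. -/
abbrev onePart (k : ℕ) : AnyPartition := ⟨k, Nat.Partition.indiscrete k⟩

/-- `E` is the multiset of elementary divisors of the square matrix `A` over the field `F`, the
elementary divisor `f ^ a` (`f` monic irreducible, `a ≥ 1`) being recorded as the pair `(f, a)`:
the `F[X]`-module on `F ^ d` in which `X` acts as `A` is isomorphic to the direct sum of the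
cyclic modules `F[X] / (f ^ a)`, with `(f, a)` running over `E`. -/
def HasElementaryDivisors {F : Type} [Field F] {d : ℕ} (A : Matrix (Fin d) (Fin d) F)
    (E : Multiset (F[X] × ℕ)) : Prop :=
  ∃ (n : ℕ) (f : Fin n → F[X]) (a : Fin n → ℕ),
    (∀ i, (f i).Monic ∧ Irreducible (f i) ∧ 0 < a i) ∧
    E = Finset.univ.val.map (fun i => (f i, a i)) ∧
    Nonempty (Module.AEval' (Matrix.toLin' A) ≃ₗ[F[X]]
      ⨁ i : Fin n, F[X] ⧸ Ideal.span {f i ^ a i})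

open Classical in
/-- The exponents `a` of the powers `f ^ a` of `f` in the multiset `E` of elementary divisors,
i.e. the parts of the partition `λ_f`. -/
noncomputable def partsAt {F : Type} [Field F] (E : Multiset (F[X] × ℕ)) (f : F[X]) :
    Multiset ℕ :=
  (E.filter (fun x => x.1 = f)).map Prod.snd

/-- `A` is of `Λ`-type: for each monic irreducible `f`, the partition `λ_f(A)` is empty or
belongs to `Λ`. -/
def IsOfType (Λ : Set AnyPartition) {F : Type} [Field F] {d : ℕ}
    (A : Matrix (Fin d) (Fin d) F) : Prop :=
  ∃ E : Multiset (F[X] × ℕ), HasElementaryDivisors A E ∧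
    ∀ f : F[X], f.Monic → Irreducible f →
      partsAt E f = 0 ∨ ∃ p ∈ Λ, p.2.parts = partsAt E f

/-- `Λ_{GL(d,q)}`, for a finite field `F` of order `q`: the probability that a uniformly random
element of `GL(d, F)` is of `Λ`-type. -/
noncomputable def glProb (Λ : Set AnyPartition) (d : ℕ) (F : Type) [Field F] [Finite F] : ℝ :=
  (Nat.card {g : GL (Fin d) F // IsOfType Λ (g : Matrix (Fin d) (Fin d) F)} : ℝ) /
    (Nat.card (GL (Fin d) F) : ℝ)

/-- `Λ_{GL(∞,q)}`: the limit of `Λ_{GL(d,q)}` as `d → ∞` with `q` fixed. -/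
noncomputable def glProbLim (Λ : Set AnyPartition) (F : Type) [Field F] [Finite F] : ℝ :=
  Filter.limUnder Filter.atTop (fun d : ℕ => glProb Λ d F)

/-- `a` is a power series expansion in `q⁻¹` of the quantity `P`, which is attached to finite
fields: for every finite field `F`, of order `q`, the series `∑ j, a_j q ^ (-j)` converges
to `P F`. The coefficients do not depend on `q`. -/
def IsExpansion (P : (F : Type) → [Field F] → [Finite F] → ℝ) (a : PowerSeries ℝ) : Prop :=
  ∀ (F : Type) [Field F] [Finite F],
    HasSum (fun j : ℕ => PowerSeries.coeff j a * ((Nat.card F : ℝ)⁻¹) ^ j) (P F)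

open Classical in
/-- `σ = 1 - 1/k` if `k` is the size of the smallest one-part partition not in `Λ`, and `σ = 1`
if `Λ` contains all one-part partitions. -/
noncomputable def stabRate (Λ : Set AnyPartition) : ℝ :=
  if h : ∃ k : ℕ, 0 < k ∧ onePart k ∉ Λ then 1 - 1 / (Nat.find h : ℝ) else 1

/-!
The argument counts matrices by means of cycle indices and studies the resulting Euler products.

*Cycle index.* A `d × d` matrix over the field `F` of order `q` makes `F ^ d` an `F[X]`-module,
and the number of matrices giving a module `M` is `|GL(d, q)| / |Aut M|`. The automorphisms of a
primary module of type `p` are counted in `card_aut_primary`, with the result that `1 / |Aut M|`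
is a product of weights `wt p y`, where `y = q ^ (-deg f)`. Sorting invertible matrices by their
type gives `glProb_eq_coeff`: the proportion `Λ_GL(d, q)` is the coefficient of `u ^ d` in the
product over the monic irreducible `f ≠ X` of the series `∑ u ^ (|p| deg f) wt p y`, the sum being
over the empty partition and the `p ∈ Λ`. For fixed `d` this is a polynomial expression in the
numbers of irreducible polynomials of given degree, which are polynomials in `q`, and in weights,
which are power series in `1 / q`. Hence there is a Laurent expansion in `1 / q`, and it has no
polar part since proportions are bounded.

*Uniform convergence.* When `Λ` contains everything the Euler product equals `1 / (1 - u)`.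
Comparing its values at `u` and `u / q` yields the zeta function of the affine line without the
origin, and this allows one to move a factor `1 - y u ^ deg f` into each local factor
(`glProb_eq_sum`). The proportion in dimension `d` becomes the partial sum up to index `d` of the
series `wser`. In the normalised local factors the contributions of consecutive one-part
partitions cancel to leading order as long as both lie in `Λ`. If the one-part partitions of size
less than `k` are in `Λ`, the product therefore converges for `|u| ≤ q ^ s` with `s < 1 - 1 / k`,
with a bound independent of `q` (`exists_pnorm_wser_le`). So the limit exists, and it differs from
the proportion in dimension `d` by at most a constant times `q ^ (-s (d + 1))`.

*Agreement.* A quantity of order `q ^ (-t)` that has an expansion in `1 / q` has vanishing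
coefficients below `t`, as one sees at large primes `q` (`coeff_eq_zero_of_bound`). This gives the
uniqueness of expansions and their agreement for `j < (d + 1) σ`.

*Expansion of the limit.* At `u = 1` the normalised local factor is `1 + locRem y`, because the
partition `(1)` lies in `Λ`; here `locRem` vanishes to second order at `0` and is smaller than `1`
in absolute value on a disc of radius slightly larger than `1 / 2`. Taking logarithms, the limit
is the value at `x = 1 / q` of a function `limFun` holomorphic in that disc, since `x ^ m` times
the number of irreducible polynomials of degree `m` is a polynomial in `x`. As `q ≥ 2`, its Taylor
series at `0` is the expansion sought.
-/

/-! ### Cyclic torsion modules over `F[X]` -/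

/-- The cyclic module `F[X] / (f ^ a)`. -/
abbrev Cyc {F : Type} [Field F] (f : F[X]) (a : ℕ) : Type := F[X] ⧸ Ideal.span {f ^ a}

section Cyclic

variable {F : Type} [Field F]

lemma Cyc.mk_eq_zero {f : F[X]} {a : ℕ} {x : F[X]} :
    (Ideal.Quotient.mk (Ideal.span {f ^ a}) x = 0) ↔ f ^ a ∣ x := by
  rw [Ideal.Quotient.eq_zero_iff_mem, Ideal.mem_span_singleton]

lemma Cyc.smul_mk {f : F[X]} {a : ℕ} (r x : F[X]) :
    r • (Ideal.Quotient.mk (Ideal.span {f ^ a}) x) = Ideal.Quotient.mk _ (r * x) := rfl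

lemma Cyc.card [Finite F] {f : F[X]} (hf : f.Monic) (a : ℕ) :
    Nat.card (Cyc f a) = (Nat.card F ^ f.natDegree) ^ a := by
  have := Fintype.ofFinite F
  have hm : (f ^ a).Monic := hf.pow a
  have : Module.Finite F (Cyc f a) := hm.finite_quotient
  have := Module.natCard_eq_pow_finrank (K := F) (V := Cyc f a)
  rw [this, finrank_quotient_span_eq_natDegree, hf.natDegree_pow, ← pow_mul, mul_comm]

lemma Cyc.finite [Finite F] {f : F[X]} (hf : f.Monic) (a : ℕ) : Finite (Cyc f a) := by
  have hm : (f ^ a).Monic := hf.pow a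
  have : Module.Finite F (Cyc f a) := hm.finite_quotient
  exact Module.finite_of_finite F

lemma Cyc.card_torsionBy_self [Finite F] {f : F[X]} (hf : f.Monic) (a k : ℕ) :
    Nat.card (Submodule.torsionBy F[X] (Cyc f a) (f ^ k)) =
      (Nat.card F ^ f.natDegree) ^ (min a k) := by
  rcases le_total a k with h | h
  · have : Submodule.torsionBy F[X] (Cyc f a) (f ^ k) = ⊤ := by
      rw [eq_top_iff]
      rintro x -
      obtain ⟨x, rfl⟩ := Ideal.Quotient.mk_surjective x
      rw [Submodule.mem_torsionBy_iff, Cyc.smul_mk, Cyc.mk_eq_zero]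
      exact (pow_dvd_pow f h).mul_right x
    rw [this, min_eq_left h, ← Cyc.card hf a]
    exact Nat.card_congr (Submodule.topEquiv.toEquiv)
  · rw [min_eq_right h, ← Cyc.card hf k]
    -- the torsion is the image of the injection `F[X] / (f ^ k) → F[X] / (f ^ a)` given by
    -- multiplication by `f ^ (a - k)`
    let φ : Cyc f k → Submodule.torsionBy F[X] (Cyc f a) (f ^ k) :=
      Quotient.lift (fun x : F[X] => (⟨Ideal.Quotient.mk _ (f ^ (a - k) * x), by
          rw [Submodule.mem_torsionBy_iff, Cyc.smul_mk, Cyc.mk_eq_zero, ← mul_assoc, ← pow_add,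
            Nat.add_sub_cancel' h]
          exact dvd_mul_right _ _⟩ : Submodule.torsionBy F[X] (Cyc f a) (f ^ k))) (by
        intro x y hxy
        have hxy' : Ideal.Quotient.mk (Ideal.span {f ^ k}) x = Ideal.Quotient.mk _ y :=
          Quotient.sound hxy
        rw [Ideal.Quotient.eq, Ideal.mem_span_singleton] at hxy'
        apply Subtype.ext
        change Ideal.Quotient.mk _ _ = Ideal.Quotient.mk _ _
        rw [Ideal.Quotient.eq, Ideal.mem_span_singleton, ← mul_sub]
        calc f ^ a = f ^ (a - k) * f ^ k := by rw [← pow_add, Nat.sub_add_cancel h]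
          _ ∣ _ := mul_dvd_mul_left _ hxy')
    have hφ : ∀ x : F[X], ((φ (Ideal.Quotient.mk _ x) : Submodule.torsionBy F[X] (Cyc f a) (f ^ k))
        : Cyc f a) = Ideal.Quotient.mk _ (f ^ (a - k) * x) := fun x => rfl
    refine (Nat.card_eq_of_bijective φ ⟨?_, ?_⟩).symm
    · intro x y hxy
      obtain ⟨x, rfl⟩ := Ideal.Quotient.mk_surjective x
      obtain ⟨y, rfl⟩ := Ideal.Quotient.mk_surjective y
      have h1 := congrArg Subtype.val hxy
      rw [hφ, hφ, Ideal.Quotient.eq, Ideal.mem_span_singleton, ← mul_sub] at h1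
      rw [Ideal.Quotient.eq, Ideal.mem_span_singleton]
      have h2 : f ^ a = f ^ (a - k) * f ^ k := by rw [← pow_add, Nat.sub_add_cancel h]
      rw [h2] at h1
      exact (mul_dvd_mul_iff_left (hf.pow _).ne_zero).1 h1
    · rintro ⟨y, hy⟩
      obtain ⟨y, rfl⟩ := Ideal.Quotient.mk_surjective y
      rw [Submodule.mem_torsionBy_iff, Cyc.smul_mk, Cyc.mk_eq_zero] at hy
      have h2 : f ^ a = f ^ k * f ^ (a - k) := by rw [← pow_add, Nat.add_sub_cancel' h]
      rw [h2] at hy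
      obtain ⟨z, rfl⟩ := (mul_dvd_mul_iff_left (hf.pow _).ne_zero).1 hy
      exact ⟨Ideal.Quotient.mk _ z, Subtype.ext (hφ z)⟩

/-- Multiplication by `f ^ k` is injective on a module that is primary for another prime. -/
lemma Cyc.torsionBy_eq_bot_of_ne {f g : F[X]} (hf : f.Monic) (hg : g.Monic)
    (hfi : Irreducible f) (hgi : Irreducible g) (hne : g ≠ f) (a k : ℕ) :
    Submodule.torsionBy F[X] (Cyc g a) (f ^ k) = ⊥ := by
  have hcop : IsCoprime (f ^ k) (g ^ a) := by
    apply IsCoprime.pow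
    rw [hfi.coprime_iff_not_dvd]
    intro h
    exact hne (Polynomial.eq_of_monic_of_associated hg hf (hfi.associated_of_dvd hgi h).symm)
  rw [eq_bot_iff]
  intro x hx
  obtain ⟨x, rfl⟩ := Ideal.Quotient.mk_surjective x
  rw [Submodule.mem_torsionBy_iff, Cyc.smul_mk, Cyc.mk_eq_zero] at hx
  rw [Submodule.mem_bot, Cyc.mk_eq_zero]
  exact hcop.symm.dvd_of_dvd_mul_left hx

open Classical in
lemma Cyc.card_torsionBy [Finite F] {f g : F[X]} (hf : f.Monic) (hg : g.Monic)
    (hfi : Irreducible f) (hgi : Irreducible g) (a k : ℕ) :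
    Nat.card (Submodule.torsionBy F[X] (Cyc g a) (f ^ k)) =
      (Nat.card F ^ f.natDegree) ^ (if g = f then min a k else 0) := by
  split_ifs with h
  · subst h; exact Cyc.card_torsionBy_self hf a k
  · rw [Cyc.torsionBy_eq_bot_of_ne hf hg hfi hgi h]
    simp

/-- Torsion commutes with products. -/
def torsionByPiEquiv {R ι : Type*} [CommRing R] (M : ι → Type*) [∀ i, AddCommGroup (M i)]
    [∀ i, Module R (M i)] (r : R) :
    Submodule.torsionBy R (∀ i, M i) r ≃ ∀ i, Submodule.torsionBy R (M i) r where
  toFun x i := ⟨x.1 i, by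
    have := congrFun ((Submodule.mem_torsionBy_iff _ _).1 x.2) i
    exact (Submodule.mem_torsionBy_iff _ _).2 this⟩
  invFun x := ⟨fun i => x i, (Submodule.mem_torsionBy_iff _ _).2
    (funext fun i => (Submodule.mem_torsionBy_iff _ _).1 (x i).2)⟩
  left_inv _ := rfl
  right_inv _ := rfl

open Classical in
/-- The order of the `f ^ k`-torsion of a module gives the sum of the truncated parts `min a k` at
`f`; for varying `k` these sums determine the parts. -/
lemma card_torsionBy_pi [Finite F] {ι : Type*} [Fintype ι] (g : ι → F[X]) (a : ι → ℕ)
    (hg : ∀ i, (g i).Monic) (hgi : ∀ i, Irreducible (g i))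
    {f : F[X]} (hf : f.Monic) (hfi : Irreducible f) (k : ℕ) :
    Nat.card (Submodule.torsionBy F[X] (∀ i, Cyc (g i) (a i)) (f ^ k)) =
      (Nat.card F ^ f.natDegree) ^ (∑ i, if g i = f then min (a i) k else 0) := by
  rw [Nat.card_congr (torsionByPiEquiv _ _), Nat.card_pi, ← Finset.prod_pow_eq_pow_sum]
  exact Finset.prod_congr rfl fun i _ => Cyc.card_torsionBy hf (hg i) hfi (hgi i) _ _

end Cyclic

/-! ### Linearly independent tuples adapted to a chain of subspaces -/

section Flags

lemma natCard_subtype_compl_submodule {K V : Type*} [DivisionRing K] [AddCommGroup V] [Module K V]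
    [Finite V] (U S : Submodule K V) (h : S ≤ U) :
    Nat.card {w : V // w ∈ U ∧ w ∉ S} = Nat.card U - Nat.card S := by
  have h1 : (U : Set V) \ (S : Set V) = {w : V | w ∈ U ∧ w ∉ S} := rfl
  have h2 := Set.ncard_sdiff (s := (S : Set V)) (t := (U : Set V)) h
  rw [h1] at h2
  rw [← Set.coe_ofPred, Nat.card_coe_set_eq, h2]
  rfl

/-- The number of linearly independent tuples adapted to an increasing chain of subspaces: the
span of the vectors chosen so far lies in the subspace from which the next one is taken. -/
lemma natCard_linearIndependent_chain {K V : Type*} [DivisionRing K] [Finite K] [AddCommGroup V]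
    [Module K V] [Finite V] (n : ℕ) (U : Fin n → Submodule K V) (hU : Monotone U) :
    Nat.card {w : Fin n → V // (∀ j, w j ∈ U j) ∧ LinearIndependent K w} =
      ∏ j, (Nat.card (U j) - Nat.card K ^ (j : ℕ)) := by
  induction n with
  | zero =>
    have : Unique {w : Fin 0 → V // (∀ j, w j ∈ U j) ∧ LinearIndependent K w} :=
      { default := ⟨Fin.elim0, fun j => j.elim0, linearIndependent_empty_type⟩
        uniq := fun w => Subtype.ext (Subsingleton.elim _ _) }
    simp
  | succ n ih =>
    rw [Fin.prod_univ_castSucc]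
    have ih' := ih (fun j => U j.castSucc) (fun i j hij => hU (Fin.castSucc_le_castSucc_iff.2 hij))
    let T := {w : Fin n → V // (∀ j, w j ∈ U j.castSucc) ∧ LinearIndependent K w}
    let e : {w : Fin (n + 1) → V // (∀ j, w j ∈ U j) ∧ LinearIndependent K w} ≃
        Σ w : T, {v : V // v ∈ U (Fin.last n) ∧ v ∉ Submodule.span K (Set.range w.1)} :=
      { toFun := fun w => ⟨⟨Fin.init w.1, fun j => w.2.1 _, by
            have := w.2.2
            rw [← Fin.snoc_init_self w.1, linearIndependent_finSnoc] at this
            exact this.1⟩, ⟨w.1 (Fin.last n), w.2.1 _, by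
            have := w.2.2
            rw [← Fin.snoc_init_self w.1, linearIndependent_finSnoc] at this
            exact this.2⟩⟩
        invFun := fun p => ⟨Fin.snoc p.1.1 p.2.1, by
            intro j
            refine Fin.lastCases ?_ (fun j => ?_) j
            · simpa using p.2.2.1
            · simpa using p.1.2.1 j,
            linearIndependent_finSnoc.2 ⟨p.1.2.2, p.2.2.2⟩⟩
        left_inv := fun w => Subtype.ext (Fin.snoc_init_self w.1)
        right_inv := fun p => by
          obtain ⟨⟨w, hw⟩, ⟨v, hv⟩⟩ := p
          refine Sigma.subtype_ext (Subtype.ext ?_) ?_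
          · exact Fin.init_snoc (α := fun _ => V) _ _
          · exact Fin.snoc_last (α := fun _ => V) _ _ }
    have hc : ∀ w : T, Nat.card {v : V // v ∈ U (Fin.last n) ∧
        v ∉ Submodule.span K (Set.range w.1)} =
        Nat.card (U (Fin.last n)) - Nat.card K ^ n := by
      intro w
      rw [natCard_subtype_compl_submodule]
      · congr 1
        have := Module.Finite.of_finite (R := K) (M := V)
        have := Fintype.ofFinite K
        rw [Module.natCard_eq_pow_finrank (K := K), finrank_span_eq_card w.2.2, Fintype.card_fin]
      · rw [Submodule.span_le]
        rintro _ ⟨j, rfl⟩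
        exact hU (Fin.le_last _) (w.2.1 j)
    have := Fintype.ofFinite T
    rw [Nat.card_congr e, Nat.card_sigma, Finset.sum_congr rfl (fun w _ => hc w), Finset.sum_const,
      Finset.card_univ, ← Nat.card_eq_fintype_card, ih', smul_eq_mul]
    simp

/-- The version for a commutative ring known to be a field, for use with `F[X] / (f)`, which carries
a ring structure only. -/
lemma natCard_linearIndependent_chain_of_isField {K V : Type*} [CommRing K] (hK : IsField K)
    [Finite K] [AddCommGroup V] [Module K V] [Finite V] (n : ℕ) (U : Fin n → Submodule K V)
    (hU : Monotone U) :
    Nat.card {w : Fin n → V // (∀ j, w j ∈ U j) ∧ LinearIndependent K w} =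
      ∏ j, (Nat.card (U j) - Nat.card K ^ (j : ℕ)) := by
  let _ : Field K := hK.toField
  exact natCard_linearIndependent_chain n U hU

end Flags

/-! ### Automorphisms of primary modules -/

section AutPrimary

variable {F : Type} [Field F]

/-- The linear map out of a product of cyclic modules that takes prescribed values, killed by the
appropriate powers of `f`, at the generators. -/
noncomputable def homOfTorsion {n : ℕ} (f : F[X]) (a : Fin n → ℕ) {N : Type*} [AddCommGroup N]
    [Module F[X] N] (v : ∀ i, Submodule.torsionBy F[X] N (f ^ a i)) :
    (∀ i, Cyc f (a i)) →ₗ[F[X]] N :=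
  ∑ i, (Submodule.liftQ (Ideal.span {f ^ a i})
    (LinearMap.toSpanSingleton F[X] N (v i : N)) (by
      rw [Ideal.span, Submodule.span_singleton_le_iff_mem, LinearMap.mem_ker,
        LinearMap.toSpanSingleton_apply]
      exact (Submodule.mem_torsionBy_iff _ _).1 (v i).2)) ∘ₗ LinearMap.proj i

lemma homOfTorsion_mk {n : ℕ} (f : F[X]) (a : Fin n → ℕ) {N : Type*} [AddCommGroup N]
    [Module F[X] N] (v : ∀ i, Submodule.torsionBy F[X] N (f ^ a i)) (c : Fin n → F[X]) :
    homOfTorsion f a v (fun i => Ideal.Quotient.mk _ (c i)) = ∑ i, c i • (v i : N) := by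
  simp only [homOfTorsion, LinearMap.sum_apply, LinearMap.comp_apply, LinearMap.proj_apply]
  rfl

lemma pi_cyc_exists_rep {n : ℕ} (f : F[X]) (a : Fin n → ℕ) (x : ∀ i, Cyc f (a i)) :
    ∃ c : Fin n → F[X], x = fun i => Ideal.Quotient.mk _ (c i) := by
  choose c hc using fun i => Ideal.Quotient.mk_surjective (x i)
  exact ⟨c, funext fun i => (hc i).symm⟩

/-- Homomorphisms out of a product of cyclic modules are tuples of torsion elements. -/
noncomputable def homEquivTorsion {n : ℕ} (f : F[X]) (a : Fin n → ℕ) (N : Type*) [AddCommGroup N]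
    [Module F[X] N] :
    (∀ i, Submodule.torsionBy F[X] N (f ^ a i)) ≃ ((∀ i, Cyc f (a i)) →ₗ[F[X]] N) where
  toFun v := homOfTorsion f a v
  invFun φ i := ⟨φ (Pi.single i (Ideal.Quotient.mk _ 1)), by
    rw [Submodule.mem_torsionBy_iff, ← map_smul, ← Pi.single_smul, Cyc.smul_mk]
    rw [Cyc.mk_eq_zero.2 (by simp), Pi.single_zero, map_zero]⟩
  left_inv v := by
    funext i
    apply Subtype.ext
    have : (Pi.single i (Ideal.Quotient.mk _ 1) : ∀ i, Cyc f (a i)) =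
        fun j => Ideal.Quotient.mk _ ((Pi.single i 1 : Fin n → F[X]) j) := by
      funext j
      by_cases h : j = i
      · subst h; simp
      · simp [h]
    simp only [this]
    rw [homOfTorsion_mk]
    simp [Pi.single_apply]
  right_inv φ := by
    apply LinearMap.ext
    intro x
    obtain ⟨c, rfl⟩ := pi_cyc_exists_rep f a x
    rw [homOfTorsion_mk]
    simp only [← map_smul, ← map_sum]
    congr 1
    funext j
    rw [Finset.sum_apply, Finset.sum_eq_single j]
    · rw [← Pi.single_smul, Pi.single_eq_same, Cyc.smul_mk, mul_one]
    · intro i _ hij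
      simp [Ne.symm hij]
    · simp

/-- Linear independence over the residue field, expressed by coefficients in `F[X]`. -/
lemma linearIndependent_torsionBy_iff {n : ℕ} {f : F[X]} {N : Type*} [AddCommGroup N]
    [Module F[X] N] (w : Fin n → Submodule.torsionBy F[X] N f) :
    LinearIndependent (F[X] ⧸ Ideal.span {f}) w ↔
      ∀ c : Fin n → F[X], ∑ j, c j • (w j : N) = 0 → ∀ j, f ∣ c j := by
  rw [Fintype.linearIndependent_iff]
  have key : ∀ c : Fin n → F[X], (∑ j, Ideal.Quotient.mk (Ideal.span {f}) (c j) • w j = 0 ↔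
      ∑ j, c j • (w j : N) = 0) := by
    intro c
    rw [← Submodule.coe_eq_zero, Submodule.coe_sum]
    rfl
  constructor
  · intro h c hc j
    have := h (fun j => Ideal.Quotient.mk _ (c j)) ((key c).2 hc) j
    rwa [Ideal.Quotient.eq_zero_iff_mem, Ideal.mem_span_singleton] at this
  · intro h g hg j
    choose c hc using fun i => Ideal.Quotient.mk_surjective (g i)
    have hg' : ∑ j, Ideal.Quotient.mk (Ideal.span {f}) (c j) • w j = 0 := by
      rw [← hg]; exact Finset.sum_congr rfl fun i _ => by rw [hc]
    rw [← hc, Ideal.Quotient.eq_zero_iff_mem, Ideal.mem_span_singleton]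
    exact h c ((key c).1 hg') j

/-- Multiplication by `f ^ (b - 1)`, from the `f ^ b`-torsion to the `f`-torsion. -/
noncomputable def toSocle (f : F[X]) (N : Type*) [AddCommGroup N] [Module F[X] N] {b : ℕ}
    (hb : 0 < b) :
    Submodule.torsionBy F[X] N (f ^ b) →ₗ[F[X]] Submodule.torsionBy F[X] N f where
  toFun x := ⟨f ^ (b - 1) • (x : N), by
    rw [Submodule.mem_torsionBy_iff, smul_smul, ← pow_succ', Nat.sub_add_cancel hb]
    exact (Submodule.mem_torsionBy_iff _ _).1 x.2⟩
  map_add' x y := Subtype.ext (by simp)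
  map_smul' c x := Subtype.ext (by simp [smul_smul, mul_comm])

lemma coe_toSocle (f : F[X]) (N : Type*) [AddCommGroup N] [Module F[X] N] {b : ℕ} (hb : 0 < b)
    (x : Submodule.torsionBy F[X] N (f ^ b)) : (toSocle f N hb x : N) = f ^ (b - 1) • (x : N) := rfl

/-- An element `x ≠ 0` has a nonzero multiple in the socle, so injectivity can be tested there;
and the socle of a product of cyclic modules is spanned by the `f ^ (a i - 1)`. -/
lemma homOfTorsion_injective_iff {n : ℕ} {f : F[X]} (hf : f.Monic)
    (a : Fin n → ℕ) (ha : ∀ i, 0 < a i) {N : Type*} [AddCommGroup N]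
    [Module F[X] N] (v : ∀ i, Submodule.torsionBy F[X] N (f ^ a i)) :
    Function.Injective (homOfTorsion f a v) ↔
      LinearIndependent (F[X] ⧸ Ideal.span {f}) (fun i => toSocle f N (ha i) (v i)) := by
  have hsplit : ∀ i, f ^ a i = f ^ (a i - 1) * f := fun i => by
    rw [← pow_succ, Nat.sub_add_cancel (ha i)]
  rw [linearIndependent_torsionBy_iff]
  constructor
  · intro h c hc j
    have h1 : homOfTorsion f a v (fun i => Ideal.Quotient.mk _ (f ^ (a i - 1) * c i)) = 0 := by
      rw [homOfTorsion_mk, ← hc]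
      exact Finset.sum_congr rfl fun i _ => by rw [coe_toSocle, smul_smul, mul_comm]
    have h2 := congrFun (h (h1.trans (map_zero _).symm)) j
    simp only [Pi.zero_apply] at h2
    rw [Cyc.mk_eq_zero, hsplit] at h2
    exact (mul_dvd_mul_iff_left (hf.pow _).ne_zero).1 h2
  · intro h
    have hsoc : ∀ x : ∀ i, Cyc f (a i), f • x = 0 → homOfTorsion f a v x = 0 → x = 0 := by
      intro x hx hx0
      obtain ⟨c, rfl⟩ := pi_cyc_exists_rep f a x
      have h1 : ∀ i, f ^ (a i - 1) ∣ c i := by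
        intro i
        have := congrFun hx i
        simp only [Pi.smul_apply, Pi.zero_apply] at this
        rw [Cyc.smul_mk, Cyc.mk_eq_zero, hsplit, mul_comm] at this
        exact (mul_dvd_mul_iff_left hf.ne_zero).1 this
      choose e he using h1
      rw [homOfTorsion_mk] at hx0
      have h2 := h e (by
        rw [← hx0]
        exact Finset.sum_congr rfl fun i _ => by rw [coe_toSocle, smul_smul, mul_comm, ← he])
      funext i
      simp only [Pi.zero_apply]
      rw [Cyc.mk_eq_zero, hsplit, he]
      exact mul_dvd_mul_left _ (h2 i)
    have hpow : ∀ k, ∀ x : ∀ i, Cyc f (a i), f ^ k • x = 0 → homOfTorsion f a v x = 0 → x = 0 := by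
      intro k
      induction k with
      | zero => intro x hx _; simpa using hx
      | succ k ih =>
        intro x hx hx0
        refine hsoc x (ih _ ?_ ?_) hx0
        · rw [smul_smul, ← pow_succ, hx]
        · rw [map_smul, hx0, smul_zero]
    rw [injective_iff_map_eq_zero]
    intro x hx
    refine hpow (∑ i, a i) x ?_ hx
    obtain ⟨c, rfl⟩ := pi_cyc_exists_rep f a x
    funext i
    simp only [Pi.smul_apply, Pi.zero_apply]
    rw [Cyc.smul_mk, Cyc.mk_eq_zero]
    exact (pow_dvd_pow f (Finset.single_le_sum (fun i _ => Nat.zero_le (a i))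
      (Finset.mem_univ i))).mul_right _

/-- The image of `toSocle` as a subspace over the residue field. -/
noncomputable def socleFlag (f : F[X]) (N : Type*) [AddCommGroup N] [Module F[X] N] {b : ℕ}
    (hb : 0 < b) :
    Submodule (F[X] ⧸ Ideal.span {f}) (Submodule.torsionBy F[X] N f) where
  carrier := Set.range (toSocle f N hb)
  add_mem' := by
    rintro _ _ ⟨x, rfl⟩ ⟨y, rfl⟩
    exact ⟨x + y, map_add _ _ _⟩
  zero_mem' := ⟨0, map_zero _⟩
  smul_mem' := by
    rintro c _ ⟨x, rfl⟩
    obtain ⟨c, rfl⟩ := Ideal.Quotient.mk_surjective c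
    exact ⟨c • x, map_smul _ _ _⟩

lemma socleFlag_mono (f : F[X]) (N : Type*) [AddCommGroup N] [Module F[X] N] {b c : ℕ} (hb : 0 < b)
    (hc : 0 < c) (h : b ≤ c) : socleFlag f N hc ≤ socleFlag f N hb := by
  rintro w ⟨x, rfl⟩
  refine ⟨⟨f ^ (c - b) • (x : N), ?_⟩, Subtype.ext ?_⟩
  · rw [Submodule.mem_torsionBy_iff, smul_smul, ← pow_add, Nat.add_sub_cancel' h]
    exact (Submodule.mem_torsionBy_iff _ _).1 x.2
  · rw [coe_toSocle, coe_toSocle, smul_smul, ← pow_add]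
    congr 2
    omega

lemma card_fiber_eq_card_ker {A B : Type*} [AddCommGroup A] [AddCommGroup B] [Module F[X] A]
    [Module F[X] B] (ψ : A →ₗ[F[X]] B) {w : B} (hw : ∃ x, ψ x = w) :
    Nat.card {x // ψ x = w} = Nat.card (LinearMap.ker ψ) := by
  obtain ⟨x0, hx0⟩ := hw
  refine Nat.card_congr ⟨fun x => ⟨x.1 - x0, by simp [x.2, hx0]⟩,
    fun k => ⟨k.1 + x0, by rw [map_add, LinearMap.mem_ker.1 k.2, zero_add, hx0]⟩, ?_, ?_⟩
  · intro x; simp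
  · intro x; simp

lemma card_ker_toSocle (f : F[X]) (N : Type*) [AddCommGroup N] [Module F[X] N] {b : ℕ}
    (hb : 0 < b) : Nat.card (LinearMap.ker (toSocle f N hb)) =
      Nat.card (Submodule.torsionBy F[X] N (f ^ (b - 1))) := by
  have hker : ∀ x, x ∈ LinearMap.ker (toSocle f N hb) ↔ f ^ (b - 1) • (x : N) = 0 := fun x => by
    rw [LinearMap.mem_ker, ← Submodule.coe_eq_zero, coe_toSocle]
  refine Nat.card_congr ⟨fun x => ⟨x.1.1, (Submodule.mem_torsionBy_iff _ _).2 ((hker _).1 x.2)⟩,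
    fun x => ⟨⟨x.1, ?_⟩, ?_⟩, fun x => rfl, fun x => rfl⟩
  · exact Submodule.torsionBy_le_torsionBy_of_dvd _ _ (pow_dvd_pow f (Nat.sub_le b 1)) x.2
  · rw [hker]
    exact (Submodule.mem_torsionBy_iff _ _).1 x.2

lemma card_fiber_toSocle (f : F[X]) (N : Type*) [AddCommGroup N] [Module F[X] N] {b : ℕ}
    (hb : 0 < b) {w : Submodule.torsionBy F[X] N f} (hw : ∃ x, toSocle f N hb x = w) :
    Nat.card {x // toSocle f N hb x = w} =
      Nat.card (Submodule.torsionBy F[X] N (f ^ (b - 1))) := by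
  rw [card_fiber_eq_card_ker _ hw, card_ker_toSocle]

lemma card_socleFlag_mul (f : F[X]) (N : Type*) [AddCommGroup N] [Module F[X] N] {b : ℕ}
    (hb : 0 < b) : Nat.card (Submodule.torsionBy F[X] N (f ^ (b - 1))) *
      Nat.card (socleFlag f N hb) = Nat.card (Submodule.torsionBy F[X] N (f ^ b)) := by
  rw [← card_ker_toSocle f N hb, Submodule.card_eq_card_quotient_mul_card
    (LinearMap.ker (toSocle f N hb)),
    Nat.card_congr (LinearMap.quotKerEquivRange (toSocle f N hb)).toEquiv]
  rfl

/-- For a finite module, automorphisms are the injective endomorphisms. -/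
lemma card_aut_eq_card_injective (M : Type*) [AddCommGroup M] [Module F[X] M] [Finite M] :
    Nat.card (M ≃ₗ[F[X]] M) = Nat.card {φ : M →ₗ[F[X]] M // Function.Injective φ} := by
  refine Nat.card_congr ⟨fun e => ⟨e.toLinearMap, e.injective⟩,
    fun φ => LinearEquiv.ofBijective φ.1 ⟨φ.2, Finite.surjective_of_injective φ.2⟩, ?_, ?_⟩
  · intro e; ext; rfl
  · intro φ; rfl

/-- Tuples sorted by the tuple of their images. -/
def tupleFiberEquiv {ι B : Type*} {A : ι → Type*} (ψ : ∀ i, A i → B) (P : (ι → B) → Prop) :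
    {v : ∀ i, A i // P fun i => ψ i (v i)} ≃
      Σ w : {w : ι → B // (∀ i, ∃ x, ψ i x = w i) ∧ P w}, ∀ i, {x // ψ i x = w.1 i} where
  toFun v := ⟨⟨fun i => ψ i (v.1 i), fun _ => ⟨_, rfl⟩, v.2⟩, fun i => ⟨v.1 i, rfl⟩⟩
  invFun p := ⟨fun i => (p.2 i).1, by
    have : (fun i => ψ i (p.2 i).1) = p.1.1 := funext fun i => (p.2 i).2
    rw [this]; exact p.1.2.2⟩
  left_inv v := rfl
  right_inv p := by
    obtain ⟨⟨w, hw⟩, g⟩ := p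
    refine Sigma.ext (Subtype.ext (funext fun i => (g i).2)) ?_
    refine Function.hfunext rfl ?_
    rintro i _ ⟨⟩
    exact (Subtype.heq_iff_coe_eq fun x => iff_of_eq (congrArg (ψ i x = ·) (g i).2)).2 rfl

/-- The number of linearly independent tuples in the socle whose entries lift along `toSocle`. -/
lemma natCard_socle_tuples {f : F[X]} (hfi : Irreducible f) (N : Type*) [AddCommGroup N]
    [Module F[X] N] [Finite N] [Finite (F[X] ⧸ Ideal.span {f})] {n : ℕ} (b : Fin n → ℕ)
    (hb : ∀ i, 0 < b i) (hanti : Antitone b) :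
    Nat.card {w : Fin n → Submodule.torsionBy F[X] N f // (∀ j, ∃ x, toSocle f N (hb j) x = w j) ∧
      LinearIndependent (F[X] ⧸ Ideal.span {f}) w} =
      ∏ j, (Nat.card (socleFlag f N (hb j)) - Nat.card (F[X] ⧸ Ideal.span {f}) ^ (j : ℕ)) :=
  @natCard_linearIndependent_chain_of_isField (F[X] ⧸ Ideal.span {f})
    (Submodule.torsionBy F[X] N f) _ ((Ideal.Quotient.maximal_ideal_iff_isField_quotient _).1
      (PrincipalIdealRing.isMaximal_of_irreducible hfi)) _ _ _ _ n (fun j => socleFlag f N (hb j))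
    (fun _ _ hij => socleFlag_mono f N _ _ (hanti hij))

/-- The number of automorphisms of a finite module of type `a` over `F[X]` at the prime `f`.
Automorphisms are tuples `v` of images of the generators with the `f ^ (a i - 1) • v i` linearly
independent in the socle; with `a` antitone, these run through an increasing chain of
subspaces. -/
lemma card_aut_primary [Finite F] {n : ℕ} {f : F[X]} (hf : f.Monic) (hfi : Irreducible f)
    (a : Fin n → ℕ) (ha : ∀ i, 0 < a i) (hanti : Antitone a) :
    Nat.card ((∀ i, Cyc f (a i)) ≃ₗ[F[X]] (∀ i, Cyc f (a i))) =
      ∏ j : Fin n, ((Nat.card F ^ f.natDegree) ^ (∑ i, min (a i) (a j - 1)) *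
        ((Nat.card F ^ f.natDegree) ^ (Finset.univ.filter fun i => a j ≤ a i).card -
          (Nat.card F ^ f.natDegree) ^ (j : ℕ))) := by
  classical
  have hfin : ∀ b, Finite (Cyc f b) := Cyc.finite hf
  set Q := Nat.card F ^ f.natDegree with hQ
  set M := ∀ i, Cyc f (a i) with hM
  have : Finite M := Pi.finite
  have hQpos : 0 < Q := pow_pos Nat.card_pos _
  have hKfin : Finite (F[X] ⧸ Ideal.span {f}) := by
    have := hfin 1; simpa [Cyc, pow_one] using this
  have hK : Nat.card (F[X] ⧸ Ideal.span {f}) = Q := by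
    have := Cyc.card hf 1; simpa [Cyc, pow_one] using this
  have htor : ∀ k, Nat.card (Submodule.torsionBy F[X] M (f ^ k)) = Q ^ ∑ i, min (a i) k := by
    intro k
    have := card_torsionBy_pi (fun _ => f) a (fun _ => hf) (fun _ => hfi) hf hfi k
    simp only [if_true] at this
    exact this
  have hU : ∀ j, Nat.card (socleFlag f M (ha j)) =
      Q ^ (Finset.univ.filter fun i => a j ≤ a i).card := by
    intro j
    have h1 := card_socleFlag_mul f M (ha j)
    rw [htor, htor] at h1
    have h2 : ∑ i, min (a i) (a j) = ∑ i, min (a i) (a j - 1) +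
        (Finset.univ.filter fun i => a j ≤ a i).card := by
      rw [Finset.card_filter, ← Finset.sum_add_distrib]
      refine Finset.sum_congr rfl fun i _ => ?_
      have := ha j
      split_ifs <;> omega
    rw [h2, pow_add] at h1
    exact Nat.eq_of_mul_eq_mul_left (pow_pos hQpos _) h1
  rw [card_aut_eq_card_injective]
  have e1 : {φ : M →ₗ[F[X]] M // Function.Injective φ} ≃
      {v : ∀ i, Submodule.torsionBy F[X] M (f ^ a i) //
        LinearIndependent (F[X] ⧸ Ideal.span {f}) (fun i => toSocle f M (ha i) (v i))} :=
    ((homEquivTorsion f a M).subtypeEquiv fun v =>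
      (homOfTorsion_injective_iff hf a ha v).symm).symm
  let W := {w : Fin n → Submodule.torsionBy F[X] M f //
    (∀ j, ∃ x, toSocle f M (ha j) x = w j) ∧
      LinearIndependent (F[X] ⧸ Ideal.span {f}) w}
  have e2 : {v : ∀ i, Submodule.torsionBy F[X] M (f ^ a i) //
        LinearIndependent (F[X] ⧸ Ideal.span {f}) (fun i => toSocle f M (ha i) (v i))} ≃
      Σ w : W, ∀ i, {x : Submodule.torsionBy F[X] M (f ^ a i) // toSocle f M (ha i) x = w.1 i} :=
    tupleFiberEquiv (fun i => toSocle f M (ha i))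
      (fun w => LinearIndependent (F[X] ⧸ Ideal.span {f}) w)
  have hWfin := Fintype.ofFinite W
  have hW := natCard_socle_tuples hfi M a ha hanti
  rw [Nat.card_congr (e1.trans e2), Nat.card_sigma,
    Finset.sum_congr rfl (g := fun _ => ∏ j, Q ^ ∑ i, min (a i) (a j - 1)), Finset.sum_const,
    Finset.card_univ, ← Nat.card_eq_fintype_card, hW, smul_eq_mul, mul_comm,
    ← Finset.prod_mul_distrib]
  · exact Finset.prod_congr rfl fun j _ => by rw [hU, hK]
  · intro w _
    rw [Nat.card_pi]
    refine Finset.prod_congr rfl fun j _ => ?_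
    rw [card_fiber_toSocle f M (ha j) (w.2.1 j), htor]

end AutPrimary

/-! ### Parts of partitions and weights -/

section Rows

/-- The number of parts of a partition. -/
noncomputable def numParts (p : AnyPartition) : ℕ := (p.2.parts.sort (· ≥ ·)).length

/-- The parts of a partition, in decreasing order. -/
noncomputable def row (p : AnyPartition) (i : Fin (numParts p)) : ℕ :=
  (p.2.parts.sort (· ≥ ·)).get i

lemma row_pos (p : AnyPartition) (i : Fin (numParts p)) : 0 < row p i := by
  apply p.2.parts_pos
  rw [← Multiset.mem_sort (r := (· ≥ ·))]
  exact List.get_mem _ _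

lemma row_antitone (p : AnyPartition) : Antitone (row p) := by
  have h := Multiset.pairwise_sort p.2.parts (· ≥ ·)
  intro i j hij
  rcases hij.eq_or_lt with h1 | h1
  · rw [h1]
  · exact List.pairwise_iff_get.1 h i j h1

lemma map_row (p : AnyPartition) : Finset.univ.val.map (row p) = p.2.parts := by
  have h1 : (Finset.univ : Finset (Fin (numParts p))).val.map (row p) =
      ((p.2.parts.sort (· ≥ ·) : List ℕ) : Multiset ℕ) := by
    rw [Fin.univ_val_map]
    congr 1
    exact List.ofFn_get _
  rw [h1, Multiset.sort_eq]

lemma sum_row (p : AnyPartition) : ∑ i, row p i = p.1 := by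
  rw [← p.2.parts_sum, ← map_row p]
  rfl

/-- The exponent of `q` in the order of the automorphism group of a module of type `p`, i.e. the
dimension of its endomorphism algebra. -/
noncomputable def expo (p : AnyPartition) : ℕ := ∑ j, ∑ i, min (row p i) (row p j)

/-- The exponents `r` of the factors `1 - q ^ (-r)` in the order of the automorphism group of a
module of type `p`. -/
noncomputable def resid (p : AnyPartition) (j : Fin (numParts p)) : ℕ :=
  (Finset.univ.filter fun i => row p j ≤ row p i).card - j

lemma lt_card_filter_row (p : AnyPartition) (j : Fin (numParts p)) :
    (j : ℕ) < (Finset.univ.filter fun i => row p j ≤ row p i).card := by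
  have h : Finset.Iic j ⊆ Finset.univ.filter fun i => row p j ≤ row p i := by
    intro i hi
    simpa using row_antitone p (Finset.mem_Iic.1 hi)
  have := Finset.card_le_card h
  rw [Fin.card_Iic] at this
  omega

lemma resid_pos (p : AnyPartition) (j : Fin (numParts p)) : 0 < resid p j :=
  Nat.sub_pos_of_lt (lt_card_filter_row p j)

lemma size_le_expo (p : AnyPartition) : p.1 ≤ expo p := by
  rw [← sum_row, expo]
  refine Finset.sum_le_sum fun j _ => ?_
  calc row p j = min (row p j) (row p j) := (min_self _).symm
    _ ≤ _ := Finset.single_le_sum (f := fun i => min (row p i) (row p j))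
      (fun _ _ => Nat.zero_le _) (Finset.mem_univ j)

lemma numParts_eq_zero {p : AnyPartition} (hp : p.1 = 0) : numParts p = 0 := by
  by_contra h
  have := row_pos p ⟨0, Nat.pos_of_ne_zero h⟩
  have h2 := Finset.single_le_sum (f := row p) (fun _ _ => Nat.zero_le _)
    (Finset.mem_univ ⟨0, Nat.pos_of_ne_zero h⟩)
  rw [sum_row] at h2
  omega

/-- The last part in decreasing order contributes a factor `1 - q ^ (-1)`, so that the
denominator of every weight other than that of the empty partition contains `1 - y`. -/
lemma exists_resid_eq_one {p : AnyPartition} (hp : p.1 ≠ 0) : ∃ j, resid p j = 1 := by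
  have hn : numParts p ≠ 0 := by
    intro h
    apply hp
    rw [← sum_row, Finset.sum_eq_zero]
    intro i
    exact absurd i.2 (by omega)
  refine ⟨⟨numParts p - 1, by omega⟩, ?_⟩
  rw [resid, Finset.filter_true_of_mem]
  · simp; omega
  · intro i _
    apply row_antitone
    rw [Fin.le_def]
    have := i.2
    simp only
    omega

/-- The weight of a partition: with `y = 1 / Q`, the reciprocal of the order of the automorphism
group of a module of type `p` over a discrete valuation ring with residue field of order `Q`. -/
noncomputable def wt {𝕜 : Type*} [Field 𝕜] (p : AnyPartition) (y : 𝕜) : 𝕜 :=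
  y ^ expo p / ∏ j, (1 - y ^ resid p j)

lemma wt_of_size_eq_zero {𝕜 : Type*} [Field 𝕜] {p : AnyPartition} (hp : p.1 = 0) (y : 𝕜) :
    wt p y = 1 := by
  have h := numParts_eq_zero hp
  have : IsEmpty (Fin (numParts p)) := by rw [h]; infer_instance
  simp [wt, expo]

lemma numParts_onePart {k : ℕ} (hk : 0 < k) : numParts (onePart k) = 1 := by
  have h := congrArg Multiset.card (map_row (onePart k))
  simpa [hk.ne'] using h

lemma wt_onePart {𝕜 : Type*} [Field 𝕜] {k : ℕ} (hk : 0 < k) (y : 𝕜) :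
    wt (onePart k) y = y ^ k / (1 - y) := by
  have h1 := numParts_onePart hk
  have : Unique (Fin (numParts (onePart k))) := by rw [h1]; infer_instance
  have hr : row (onePart k) default = k := by
    have := sum_row (onePart k)
    simpa using this
  have hr2 : resid (onePart k) default = 1 := by
    obtain ⟨j, hj⟩ := exists_resid_eq_one (p := onePart k) (by simpa using hk.ne')
    rwa [Subsingleton.elim default j]
  rw [wt, expo, Fintype.prod_unique, Fintype.sum_unique, Fintype.sum_unique, hr, hr2]
  simp

end Rows

/-! ### Modules of given type -/

section TypeModule

variable {F : Type} [Field F]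

/-- The `f`-primary module of type `p`: the product of the cyclic modules `F[X] / (f ^ a)`, with
`a` running over the parts of `p`. -/
abbrev PrimMod (f : F[X]) (p : AnyPartition) : Type := ∀ i : Fin (numParts p), Cyc f (row p i)

lemma PrimMod.card [Finite F] {f : F[X]} (hf : f.Monic) (p : AnyPartition) :
    Nat.card (PrimMod f p) = (Nat.card F ^ f.natDegree) ^ p.1 := by
  rw [Nat.card_pi, ← sum_row, ← Finset.prod_pow_eq_pow_sum]
  exact Finset.prod_congr rfl fun i _ => Cyc.card hf _

lemma PrimMod.finite [Finite F] {f : F[X]} (hf : f.Monic) (p : AnyPartition) :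
    Finite (PrimMod f p) := by
  have := Cyc.finite hf
  exact Pi.finite

/-- The weight of a partition is the reciprocal of the order of an automorphism group. -/
lemma PrimMod.inv_card_aut [Finite F] {f : F[X]} (hf : f.Monic) (hfi : Irreducible f)
    (p : AnyPartition) :
    ((Nat.card (PrimMod f p ≃ₗ[F[X]] PrimMod f p) : ℝ))⁻¹ =
      wt p (((Nat.card F : ℝ)⁻¹) ^ f.natDegree) := by
  rw [card_aut_primary hf hfi (row p) (row_pos p) (row_antitone p)]
  set Q := Nat.card F ^ f.natDegree with hQ
  have hQ0 : 0 < Q := pow_pos Nat.card_pos _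
  have hQ' : ((Nat.card F : ℝ)⁻¹) ^ f.natDegree = (Q : ℝ)⁻¹ := by rw [hQ]; push_cast; simp
  rw [hQ', wt, expo, ← Finset.prod_pow_eq_pow_sum, ← Finset.prod_div_distrib, Nat.cast_prod,
    ← Finset.prod_inv_distrib]
  refine Finset.prod_congr rfl fun j _ => ?_
  have h1 := lt_card_filter_row p j
  set m := (Finset.univ.filter fun i => row p j ≤ row p i).card with hm
  have h2 : ∑ i, min (row p i) (row p j) = ∑ i, min (row p i) (row p j - 1) + m := by
    rw [hm, Finset.card_filter, ← Finset.sum_add_distrib]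
    refine Finset.sum_congr rfl fun i _ => ?_
    have := row_pos p j
    split_ifs <;> omega
  have hQr : (Q : ℝ) ≠ 0 := by positivity
  have hres : resid p j = m - j := rfl
  rw [h2, hres]
  have h3 : (Q : ℝ) ^ m - (Q : ℝ) ^ (j : ℕ) = (Q : ℝ) ^ m * (1 - (Q : ℝ)⁻¹ ^ (m - j)) := by
    rw [mul_sub, mul_one, inv_pow, ← div_eq_mul_inv, eq_comm, sub_right_inj, div_eq_iff
      (by positivity), ← pow_add]
    congr 1; omega
  rw [Nat.cast_mul, Nat.cast_sub (Nat.pow_le_pow_right hQ0 h1.le)]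
  push_cast
  rw [h3, pow_add, div_eq_mul_inv]
  simp only [mul_inv, inv_pow]
  ring

lemma PrimMod.torsionBy_eq_bot {f g : F[X]} (hf : f.Monic) (hg : g.Monic)
    (hfi : Irreducible f) (hgi : Irreducible g) (hne : g ≠ f) (p : AnyPartition) (k : ℕ)
    (x : PrimMod g p) (hx : f ^ k • x = 0) : x = 0 := by
  funext i
  have h1 : x i ∈ Submodule.torsionBy F[X] (Cyc g (row p i)) (f ^ k) :=
    (Submodule.mem_torsionBy_iff _ _).2 (congrFun hx i)
  rwa [Cyc.torsionBy_eq_bot_of_ne hf hg hfi hgi hne, Submodule.mem_bot] at h1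

lemma PrimMod.pow_size_smul (f : F[X]) (p : AnyPartition) (x : PrimMod f p) :
    f ^ p.1 • x = 0 := by
  funext i
  obtain ⟨y, hy⟩ := Ideal.Quotient.mk_surjective (x i)
  rw [Pi.smul_apply, ← hy, Cyc.smul_mk, Pi.zero_apply, Cyc.mk_eq_zero]
  refine (pow_dvd_pow f ?_).mul_right _
  rw [← sum_row]
  exact Finset.single_le_sum (f := row p) (fun _ _ => Nat.zero_le _) (Finset.mem_univ i)

lemma PrimMod.hom_eq_zero {f g : F[X]} (hf : f.Monic) (hg : g.Monic)
    (hfi : Irreducible f) (hgi : Irreducible g) (hne : g ≠ f) (p p' : AnyPartition)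
    (φ : PrimMod f p →ₗ[F[X]] PrimMod g p') : φ = 0 := by
  refine LinearMap.ext fun x => ?_
  refine PrimMod.torsionBy_eq_bot hf hg hfi hgi hne p' p.1 _ ?_
  rw [← map_smul, PrimMod.pow_size_smul, map_zero]

/-- Automorphisms of a product of modules without nonzero homomorphisms between different
factors. -/
noncomputable def autPiEquiv {R ι : Type*} [Ring R] [Fintype ι] [DecidableEq ι] (M : ι → Type*)
    [∀ i, AddCommGroup (M i)] [∀ i, Module R (M i)]
    (h : ∀ i j, i ≠ j → ∀ φ : M i →ₗ[R] M j, φ = 0) :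
    ((∀ i, M i) ≃ₗ[R] (∀ i, M i)) ≃ ∀ i, (M i ≃ₗ[R] M i) := by
  have key : ∀ (φ : (∀ i, M i) →ₗ[R] (∀ i, M i)) (x : ∀ i, M i) (j : ι),
      φ x j = φ (Pi.single j (x j)) j := by
    intro φ x j
    conv_lhs => rw [← Finset.univ_sum_single x]
    rw [map_sum, Finset.sum_apply, Finset.sum_eq_single j]
    · intro i _ hij
      exact LinearMap.congr_fun (h i j hij (LinearMap.proj j ∘ₗ φ ∘ₗ LinearMap.single R M i)) (x i)
    · simp
  exact
  { toFun := fun e i => LinearEquiv.ofLinearMap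
      (LinearMap.proj i ∘ₗ e.toLinearMap ∘ₗ LinearMap.single R M i)
      (LinearMap.proj i ∘ₗ e.symm.toLinearMap ∘ₗ LinearMap.single R M i)
      (by
        ext x
        have := key e.toLinearMap (e.symm (Pi.single i x)) i
        simpa using this.symm)
      (by
        ext x
        have := key e.symm.toLinearMap (e (Pi.single i x)) i
        simpa using this.symm)
    invFun := fun e => LinearEquiv.piCongrRight e
    left_inv := fun e => by
      ext x j
      exact (key e.toLinearMap x j).symm
    right_inv := fun e => by
      funext i
      ext x
      simp }

/-- The module of type `τ`: the product of the `f`-primary modules of type `τ f`. -/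
abbrev TypeMod {P : Finset F[X]} (τ : P → AnyPartition) : Type :=
  ∀ f : P, PrimMod (f : F[X]) (τ f)

/-- The size of a type: the dimension of the corresponding modules. -/
def typeDeg {P : Finset F[X]} (τ : P → AnyPartition) : ℕ :=
  ∑ f : P, (τ f).1 * (f : F[X]).natDegree

lemma TypeMod.card [Finite F] {P : Finset F[X]}
    (hP : ∀ f ∈ P, f.Monic ∧ Irreducible f) (τ : P → AnyPartition) :
    Nat.card (TypeMod τ) = Nat.card F ^ typeDeg τ := by
  rw [Nat.card_pi, typeDeg, ← Finset.prod_pow_eq_pow_sum]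
  refine Finset.prod_congr rfl fun f _ => ?_
  rw [PrimMod.card (hP f f.2).1, ← pow_mul, mul_comm]

lemma TypeMod.finite [Finite F] {P : Finset F[X]}
    (hP : ∀ f ∈ P, f.Monic ∧ Irreducible f) (τ : P → AnyPartition) : Finite (TypeMod τ) := by
  have := fun f : P => PrimMod.finite (hP f f.2).1 (τ f)
  exact Pi.finite

lemma TypeMod.inv_card_aut [Finite F] {P : Finset F[X]}
    (hP : ∀ f ∈ P, f.Monic ∧ Irreducible f) (τ : P → AnyPartition) :
    ((Nat.card (TypeMod τ ≃ₗ[F[X]] TypeMod τ) : ℝ))⁻¹ =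
      ∏ f : P, wt (τ f) (((Nat.card F : ℝ)⁻¹) ^ (f : F[X]).natDegree) := by
  classical
  have e := autPiEquiv (R := F[X]) (fun f : P => PrimMod (f : F[X]) (τ f)) (fun f g hfg φ =>
    PrimMod.hom_eq_zero (hP f f.2).1 (hP g g.2).1 (hP f f.2).2 (hP g g.2).2
      (fun h => hfg (Subtype.ext h.symm)) _ _ φ)
  rw [Nat.card_congr e, Nat.card_pi, Nat.cast_prod, ← Finset.prod_inv_distrib]
  exact Finset.prod_congr rfl fun f _ => PrimMod.inv_card_aut (hP f f.2).1 (hP f f.2).2 _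

end TypeModule

/-! ### Matrices inducing a given module -/

section Conjugacy

variable {F : Type} [Field F]

lemma card_linearEquiv_pi (M : Type*) [AddCommGroup M] [Module F M] (d : ℕ)
    (e0 : (Fin d → F) ≃ₗ[F] M) :
    Nat.card ((Fin d → F) ≃ₗ[F] M) = Nat.card (GL (Fin d) F) := by
  have e1 : ((Fin d → F) ≃ₗ[F] M) ≃ ((Fin d → F) ≃ₗ[F] (Fin d → F)) :=
    ⟨fun e => e.trans e0.symm, fun e => e.trans e0, fun e => by ext; simp, fun e => by ext; simp⟩
  rw [Nat.card_congr e1]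
  exact Nat.card_congr ((LinearMap.GeneralLinearGroup.generalLinearEquiv F (Fin d → F)).symm.trans
    (Matrix.GeneralLinearGroup.toLin).symm).toEquiv

/-- Isomorphisms of `F[X]`-modules are the `F`-linear ones commuting with `X`. -/
noncomputable def fiberEquivIso (M : Type*) [AddCommGroup M] [Module F[X] M] [Module F M]
    [IsScalarTower F F[X] M] {d : ℕ} (A : Matrix (Fin d) (Fin d) F) :
    {e : (Fin d → F) ≃ₗ[F] M // ∀ v, e (Matrix.toLin' A v) = (Polynomial.X : F[X]) • e v} ≃
      (Module.AEval' (Matrix.toLin' A) ≃ₗ[F[X]] M) where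
  toFun e := LinearEquiv.ofAEval (Matrix.toLin' A) e.1 e.2
  invFun g := ⟨(Module.AEval'.of (Matrix.toLin' A)).trans (g.restrictScalars F), fun v => by
    change g (Module.AEval'.of (Matrix.toLin' A) (Matrix.toLin' A v)) = _
    rw [← Module.AEval'.X_smul_of, map_smul]
    rfl⟩
  left_inv e := rfl
  right_inv g := rfl

/-- Counting the `F`-linear isomorphisms `F ^ d ≃ M` by the matrix of `X` that they induce. -/
lemma card_matrices_mul_card_aut [Finite F] (M : Type*) [AddCommGroup M] [Module F[X] M]
    [Module F M] [IsScalarTower F F[X] M] [Finite M] (d : ℕ) (hM : Nat.card M = Nat.card F ^ d) :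
    Nat.card {A : Matrix (Fin d) (Fin d) F //
      Nonempty (Module.AEval' (Matrix.toLin' A) ≃ₗ[F[X]] M)} * Nat.card (M ≃ₗ[F[X]] M) =
      Nat.card (GL (Fin d) F) := by
  classical
  have := Fintype.ofFinite F
  have : Module.Finite F M := Module.Finite.of_finite
  have hd : Module.finrank F M = d := by
    have h1 := Module.natCard_eq_pow_finrank (K := F) (V := M)
    rw [hM] at h1
    exact (Nat.pow_right_injective Finite.one_lt_card h1).symm
  have e0 : (Fin d → F) ≃ₗ[F] M := LinearEquiv.ofFinrankEq _ _ (by simp [hd])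
  let mat : ((Fin d → F) ≃ₗ[F] M) → Matrix (Fin d) (Fin d) F := fun e =>
    LinearMap.toMatrix' (e.symm.toLinearMap ∘ₗ
      ((LinearMap.lsmul F[X] M Polynomial.X).restrictScalars F) ∘ₗ e.toLinearMap)
  have hmat : ∀ e A, mat e = A ↔ ∀ v, e (Matrix.toLin' A v) = (Polynomial.X : F[X]) • e v := by
    intro e A
    constructor
    · rintro rfl v
      simp [mat]
    · intro h
      apply Matrix.toLin'.injective
      refine LinearMap.ext fun v => ?_
      simp only [mat, Matrix.toLin'_toMatrix']
      apply e.injective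
      simpa using (h v).symm
  have hcard : ∀ A, Nat.card {e // mat e = A} = if Nonempty
      (Module.AEval' (Matrix.toLin' A) ≃ₗ[F[X]] M) then Nat.card (M ≃ₗ[F[X]] M) else 0 := by
    intro A
    rw [Nat.card_congr ((Equiv.subtypeEquivRight fun e => hmat e A).trans (fiberEquivIso M A))]
    split_ifs with h
    · obtain ⟨g⟩ := h
      exact Nat.card_congr ⟨fun e => g.symm.trans e, fun e => g.trans e,
        fun e => by ext; simp, fun e => by ext; simp⟩
    · rw [not_nonempty_iff] at h
      exact Nat.card_of_isEmpty
  have : Finite ((Fin d → F) ≃ₗ[F] M) :=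
    Finite.of_injective (fun e => (e : (Fin d → F) → M)) DFunLike.coe_injective
  rw [← card_linearEquiv_pi M d e0, ← Nat.card_congr (Equiv.sigmaFiberEquiv mat), Nat.card_sigma,
    Finset.sum_congr rfl fun A _ => hcard A, ← Finset.sum_filter, Finset.sum_const, smul_eq_mul,
    Nat.card_eq_fintype_card, Fintype.card_subtype]

end Conjugacy

/-! ### Multisets of parts -/

section Multisets

lemma Multiset.sum_map_min_succ (s : Multiset ℕ) (k : ℕ) :
    (s.map (min · (k + 1))).sum = (s.map (min · k)).sum + s.countP (k < ·) := by
  induction s using Multiset.induction with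
  | empty => simp
  | cons a s ih =>
    simp only [Multiset.map_cons, Multiset.sum_cons, Multiset.countP_cons, ih]
    split_ifs <;> omega

lemma Multiset.countP_pred_lt (s : Multiset ℕ) (k : ℕ) :
    s.countP (k < ·) = s.countP (k + 1 < ·) + s.count (k + 1) := by
  induction s using Multiset.induction with
  | empty => simp
  | cons a s ih =>
    simp only [Multiset.countP_cons, Multiset.count_cons, ih]
    split_ifs <;> omega

/-- A multiset of positive integers is determined by the sums of its truncations: the second
differences of these sums are the multiplicities. -/
lemma Multiset.eq_of_sum_map_min {s t : Multiset ℕ} (hs : ∀ a ∈ s, 0 < a) (ht : ∀ a ∈ t, 0 < a)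
    (h : ∀ k, (s.map (min · k)).sum = (t.map (min · k)).sum) : s = t := by
  have h1 : ∀ k, s.countP (k < ·) = t.countP (k < ·) := by
    intro k
    have := h (k + 1)
    rw [Multiset.sum_map_min_succ, Multiset.sum_map_min_succ, h k] at this
    exact Nat.add_left_cancel this
  ext a
  rcases Nat.eq_zero_or_pos a with rfl | ha
  · rw [Multiset.count_eq_zero_of_notMem fun h => (hs 0 h).ne rfl,
      Multiset.count_eq_zero_of_notMem fun h => (ht 0 h).ne rfl]
  · obtain ⟨k, rfl⟩ : ∃ k, a = k + 1 := ⟨a - 1, by omega⟩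
    have h2 := Multiset.countP_pred_lt s k
    rw [h1 k, h1 (k + 1), Multiset.countP_pred_lt t k] at h2
    omega

lemma Multiset.eq_zero_of_sum_map_min_one {s : Multiset ℕ} (hs : ∀ a ∈ s, 0 < a)
    (h : (s.map (min · 1)).sum = 0) : s = 0 := by
  by_contra hne
  obtain ⟨a, ha⟩ := Multiset.exists_mem_of_ne_zero hne
  have := Multiset.le_sum_of_mem (Multiset.mem_map_of_mem (min · 1) ha)
  have := hs a ha
  omega

/-- Two finite families with the same multiset of values differ by a reindexing. -/
lemma exists_equiv_of_map_univ_eq {α β γ : Type*} [Fintype α] [Fintype β] (u : α → γ) (v : β → γ)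
    (h : Finset.univ.val.map u = Finset.univ.val.map v) : ∃ e : α ≃ β, ∀ x, v (e x) = u x := by
  classical
  have hc : ∀ c, Nonempty ({x // u x = c} ≃ {y // v y = c}) := by
    intro c
    have h1 := congrArg (Multiset.count c) h
    rw [Multiset.count_map, Multiset.count_map] at h1
    refine ⟨Fintype.equivOfCardEq ?_⟩
    rw [Fintype.card_subtype, Fintype.card_subtype]
    simpa [Finset.card_def, Finset.filter_val, eq_comm] using h1
  refine ⟨(Equiv.sigmaFiberEquiv u).symm.trans
    ((Equiv.sigmaCongrRight fun c => (hc c).some).trans (Equiv.sigmaFiberEquiv v)), fun x => ?_⟩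
  exact ((hc (u x)).some ⟨x, rfl⟩).2

lemma anyPartition_ext {p p' : AnyPartition} (h : p.2.parts = p'.2.parts) : p = p' := by
  obtain ⟨n, p⟩ := p
  obtain ⟨n', p'⟩ := p'
  have hn : n = n' := by rw [← p.parts_sum, ← p'.parts_sum, h]
  subst hn
  congr
  exact Nat.Partition.ext h

lemma parts_eq_zero_iff {p : AnyPartition} : p.2.parts = 0 ↔ p.1 = 0 := by
  constructor
  · intro h
    rw [← p.2.parts_sum, h, Multiset.sum_zero]
  · intro h
    rw [Multiset.eq_zero_iff_forall_notMem]
    intro a ha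
    have h1 := Multiset.le_sum_of_mem ha
    rw [p.2.parts_sum] at h1
    have := p.2.parts_pos ha
    omega

end Multisets

/-! ### The type of a matrix -/

section Types

variable {F : Type} [Field F]

/-- The monic irreducible polynomials of degree at most `D`. -/
noncomputable def irredLE (F : Type) [Field F] [Finite F] (D : ℕ) : Finset F[X] :=
  Set.Finite.toFinset (s := {f : F[X] | (f.Monic ∧ Irreducible f) ∧ f.natDegree ≤ D}) (by
    have h : Set.Finite {f : F[X] | f.natDegree ≤ D} := by
      refine Set.Finite.of_finite_image (f := fun f : F[X] => fun i : Fin (D + 1) => f.coeff i)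
        (Set.toFinite _) ?_
      intro f hf g hg hfg
      ext n
      rcases lt_or_ge n (D + 1) with h | h
      · exact congrFun hfg ⟨n, h⟩
      · rw [Polynomial.coeff_eq_zero_of_natDegree_lt (lt_of_le_of_lt hf h),
          Polynomial.coeff_eq_zero_of_natDegree_lt (lt_of_le_of_lt hg h)]
    exact h.subset fun f hf => hf.2)

lemma mem_irredLE [Finite F] {D : ℕ} {f : F[X]} :
    f ∈ irredLE F D ↔ (f.Monic ∧ Irreducible f) ∧ f.natDegree ≤ D := by
  simp [irredLE]

lemma irredLE_spec [Finite F] {D : ℕ} : ∀ f ∈ irredLE F D, f.Monic ∧ Irreducible f :=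
  fun _ hf => (mem_irredLE.1 hf).1

/-- The matrix `A` has type `τ`: as an `F[X]`-module, `F ^ d` with `X` acting as `A` is the module
of type `τ`. Here `τ` assigns a partition, possibly empty, to each polynomial of the finite set
`P`. -/
def HasType {d : ℕ} (A : Matrix (Fin d) (Fin d) F) {P : Finset F[X]} (τ : P → AnyPartition) :
    Prop :=
  Nonempty (Module.AEval' (Matrix.toLin' A) ≃ₗ[F[X]] TypeMod τ)

lemma card_torsionBy_congr {M N : Type*} [AddCommGroup M] [AddCommGroup N] [Module F[X] M]
    [Module F[X] N] (e : M ≃ₗ[F[X]] N) (r : F[X]) :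
    Nat.card (Submodule.torsionBy F[X] M r) = Nat.card (Submodule.torsionBy F[X] N r) := by
  refine Nat.card_congr (e.toEquiv.subtypeEquiv fun x => ?_)
  rw [Submodule.mem_torsionBy_iff, Submodule.mem_torsionBy_iff]
  change _ ↔ r • e x = 0
  rw [← map_smul, LinearEquiv.map_eq_zero_iff]

lemma partsAt_pos {d : ℕ} {A : Matrix (Fin d) (Fin d) F} {E : Multiset (F[X] × ℕ)}
    (hE : HasElementaryDivisors A E) (f : F[X]) : ∀ a ∈ partsAt E f, 0 < a := by
  classical
  obtain ⟨n, g, a, h1, rfl, -⟩ := hE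
  intro b hb
  simp only [partsAt, Multiset.mem_map, Multiset.mem_filter] at hb
  obtain ⟨_, ⟨⟨i, -, rfl⟩, -⟩, rfl⟩ := hb
  exact (h1 i).2.2

lemma HasElementaryDivisors.card_torsionBy [Finite F] {d : ℕ} {A : Matrix (Fin d) (Fin d) F}
    {E : Multiset (F[X] × ℕ)} (hE : HasElementaryDivisors A E) {f : F[X]} (hf : f.Monic)
    (hfi : Irreducible f) (k : ℕ) :
    Nat.card (Submodule.torsionBy F[X] (Module.AEval' (Matrix.toLin' A)) (f ^ k)) =
      (Nat.card F ^ f.natDegree) ^ (((partsAt E f).map (min · k)).sum) := by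
  classical
  obtain ⟨n, g, a, h1, rfl, ⟨e⟩⟩ := hE
  rw [card_torsionBy_congr (e.trans (DirectSum.linearEquivFunOnFintype F[X] (Fin n)
      (fun i => F[X] ⧸ Ideal.span {g i ^ a i}))) (f ^ k),
    card_torsionBy_pi g a (fun i => (h1 i).1) (fun i => (h1 i).2.1) hf hfi k]
  congr 1
  rw [partsAt, Multiset.filter_map, Multiset.map_map, Multiset.map_map, ← Finset.sum_filter]
  simp only [Finset.sum, Finset.filter_val]
  congr!

lemma HasType.card_torsionBy [Finite F] {D d : ℕ} {A : Matrix (Fin d) (Fin d) F}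
    {τ : irredLE F D → AnyPartition} (hτ : HasType A τ) (f : irredLE F D) (k : ℕ) :
    Nat.card (Submodule.torsionBy F[X] (Module.AEval' (Matrix.toLin' A)) ((f : F[X]) ^ k)) =
      (Nat.card F ^ (f : F[X]).natDegree) ^ (((τ f).2.parts.map (min · k)).sum) := by
  classical
  obtain ⟨e⟩ := hτ
  have hf := irredLE_spec f.1 f.2
  have h2 : ∀ g : irredLE F D, Nat.card (Submodule.torsionBy F[X] (PrimMod (g : F[X]) (τ g))
      ((f : F[X]) ^ k)) = if g = f then
        (Nat.card F ^ (f : F[X]).natDegree) ^ (((τ f).2.parts.map (min · k)).sum) else 1 := by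
    intro g
    have hg := irredLE_spec g.1 g.2
    rw [card_torsionBy_pi (fun _ => (g : F[X])) (row (τ g)) (fun _ => hg.1) (fun _ => hg.2)
      hf.1 hf.2 k]
    by_cases h : g = f
    · subst h
      rw [if_pos rfl, ← map_row, Multiset.map_map]
      simp [Finset.sum]
    · have h' : (g : F[X]) ≠ f := fun h' => h (Subtype.ext h')
      simp [h, h']
  rw [card_torsionBy_congr e, Nat.card_congr (torsionByPiEquiv _ _), Nat.card_pi,
    Finset.prod_congr rfl fun g _ => h2 g, Finset.prod_ite_eq' Finset.univ]
  simp

lemma HasType.torsionBy_of_notMem [Finite F] {D d : ℕ} {A : Matrix (Fin d) (Fin d) F}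
    {τ : irredLE F D → AnyPartition} (hτ : HasType A τ) {f : F[X]} (hf : f.Monic)
    (hfi : Irreducible f) (hfD : f ∉ irredLE F D) (k : ℕ) :
    Nat.card (Submodule.torsionBy F[X] (Module.AEval' (Matrix.toLin' A)) (f ^ k)) = 1 := by
  classical
  obtain ⟨e⟩ := hτ
  rw [card_torsionBy_congr e, Nat.card_congr (torsionByPiEquiv _ _), Nat.card_pi]
  refine Finset.prod_eq_one fun g _ => ?_
  have hg := irredLE_spec g.1 g.2
  have hne : (g : F[X]) ≠ f := fun h => hfD (h ▸ g.2)
  rw [card_torsionBy_pi (fun _ => (g : F[X])) (row (τ g)) (fun _ => hg.1) (fun _ => hg.2) hf hfi k]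
  simp [hne]

lemma one_lt_card_pow [Finite F] {f : F[X]} (hfi : Irreducible f) :
    1 < Nat.card F ^ f.natDegree :=
  Nat.one_lt_pow hfi.natDegree_pos.ne' Finite.one_lt_card

/-- The type of a matrix determines its elementary divisors, through the sizes of the kernels of
`f(A) ^ k`. -/
lemma HasType.partsAt_eq [Finite F] {D d : ℕ} {A : Matrix (Fin d) (Fin d) F}
    {τ : irredLE F D → AnyPartition} (hτ : HasType A τ) {E : Multiset (F[X] × ℕ)}
    (hE : HasElementaryDivisors A E) (f : irredLE F D) : partsAt E f = (τ f).2.parts := by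
  have hf := irredLE_spec f.1 f.2
  refine Multiset.eq_of_sum_map_min (partsAt_pos hE _) (fun _ h => (τ f).2.parts_pos h) fun k => ?_
  have h1 := hE.card_torsionBy hf.1 hf.2 k
  rw [hτ.card_torsionBy f k] at h1
  exact (Nat.pow_right_injective (one_lt_card_pow hf.2) h1).symm

lemma HasType.partsAt_of_notMem [Finite F] {D d : ℕ} {A : Matrix (Fin d) (Fin d) F}
    {τ : irredLE F D → AnyPartition} (hτ : HasType A τ) {E : Multiset (F[X] × ℕ)}
    (hE : HasElementaryDivisors A E) {f : F[X]} (hf : f.Monic)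
    (hfi : Irreducible f) (hfD : f ∉ irredLE F D) : partsAt E f = 0 := by
  refine Multiset.eq_zero_of_sum_map_min_one (partsAt_pos hE _) ?_
  have h1 := hE.card_torsionBy hf hfi 1
  rw [hτ.torsionBy_of_notMem hf hfi hfD 1] at h1
  exact Nat.pow_right_injective (one_lt_card_pow hfi) (h1.symm.trans (pow_zero _).symm)

lemma HasType.unique [Finite F] {D d : ℕ} {A : Matrix (Fin d) (Fin d) F}
    {τ τ' : irredLE F D → AnyPartition} (hτ : HasType A τ) (hτ' : HasType A τ') : τ = τ' := by
  funext f
  have hf := irredLE_spec f.1 f.2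
  refine anyPartition_ext (Multiset.eq_of_sum_map_min (fun _ h => (τ f).2.parts_pos h)
    (fun _ h => (τ' f).2.parts_pos h) fun k => ?_)
  have h1 := hτ'.card_torsionBy f k
  rw [hτ.card_torsionBy f k] at h1
  exact Nat.pow_right_injective (one_lt_card_pow hf.2) h1

lemma natCard_AEval [Finite F] {d : ℕ} (A : Matrix (Fin d) (Fin d) F) :
    Nat.card (Module.AEval' (Matrix.toLin' A)) = Nat.card F ^ d := by
  rw [Nat.card_congr (Module.AEval'.of (Matrix.toLin' A)).symm.toEquiv, Nat.card_pi]
  simp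

lemma HasType.typeDeg_eq [Finite F] {D d : ℕ} {A : Matrix (Fin d) (Fin d) F}
    {τ : irredLE F D → AnyPartition} (hτ : HasType A τ) : typeDeg τ = d := by
  have h1 := natCard_AEval A
  obtain ⟨e⟩ := hτ
  rw [Nat.card_congr e.toEquiv, TypeMod.card irredLE_spec τ] at h1
  exact Nat.pow_right_injective Finite.one_lt_card h1

lemma exists_hasElementaryDivisors [Finite F] {d : ℕ} (A : Matrix (Fin d) (Fin d) F) :
    ∃ E, HasElementaryDivisors A E := by
  classical
  obtain ⟨ι, _, p, hp, e, ⟨g⟩⟩ := Module.equiv_directSum_of_isTorsion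
    (Module.AEval.isTorsion_of_finiteDimensional F (Fin d → F) (Matrix.toLin' A))
  let ι' := {i : ι // 0 < e i}
  let σ := Fintype.equivFin ι'
  let f : Fin (Fintype.card ι') → F[X] := fun j => normalize (p (σ.symm j))
  let a : Fin (Fintype.card ι') → ℕ := fun j => e (σ.symm j)
  have hspan : ∀ i : ι', Submodule.span F[X] {p i ^ e i} =
      Ideal.span {normalize (p i) ^ e i} := by
    intro i
    rw [← Ideal.span, Ideal.span_singleton_eq_span_singleton]
    exact (normalize_associated (p i)).symm.pow_pow
  refine ⟨_, Fintype.card ι', f, a, fun j => ⟨?_, ?_, (σ.symm j).2⟩, rfl, ⟨?_⟩⟩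
  · exact Polynomial.monic_normalize (hp _).ne_zero
  · exact (normalize_associated _).symm.irreducible (hp _)
  · -- drop the trivial summands, then reindex
    have hsub : ∀ i : ι, ¬ 0 < e i → Subsingleton (F[X] ⧸ Submodule.span F[X] {p i ^ e i}) := by
      intro i hi
      have h0 : e i = 0 := by omega
      rw [Submodule.Quotient.subsingleton_iff, h0, pow_zero]
      exact Ideal.span_singleton_one
    let drop : (∀ i : ι, F[X] ⧸ Submodule.span F[X] {p i ^ e i}) ≃ₗ[F[X]]
        (∀ i : ι', F[X] ⧸ Submodule.span F[X] {p i ^ e i}) :=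
      { toFun := fun x i => x i
        map_add' := fun _ _ => rfl
        map_smul' := fun _ _ => rfl
        invFun := fun x i => if h : 0 < e i then x ⟨i, h⟩ else 0
        left_inv := fun x => by
          funext i
          by_cases h : 0 < e i
          · simp [h]
          · exact (hsub i h).elim _ _
        right_inv := fun x => by
          funext i
          exact dif_pos i.2 }
    exact g.trans ((DirectSum.linearEquivFunOnFintype F[X] ι _).trans (drop.trans
      ((LinearEquiv.piCongrRight fun i : ι' => Submodule.quotEquivOfEq _ _ (hspan i)).trans
      ((LinearEquiv.piCongrLeft F[X] (fun i : ι' => F[X] ⧸ Ideal.span {normalize (p i) ^ e i})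
        σ.symm).symm.trans
      (DirectSum.linearEquivFunOnFintype F[X] (Fin (Fintype.card ι')) _).symm))))

/-- Reindexing a product of cyclic modules. -/
noncomputable def cycReindex {ι κ : Type*} (σ : ι ≃ κ) {f : ι → F[X]} {a : ι → ℕ} {g : κ → F[X]}
    {b : κ → ℕ} (hf : ∀ i, g (σ i) = f i) (ha : ∀ i, b (σ i) = a i) :
    (∀ i, Cyc (f i) (a i)) ≃ₗ[F[X]] (∀ k, Cyc (g k) (b k)) :=
  (LinearEquiv.piCongrRight fun i => Submodule.quotEquivOfEq (Ideal.span {f i ^ a i})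
    (Ideal.span {g (σ i) ^ b (σ i)}) (by rw [hf, ha])).trans
    (LinearEquiv.piCongrLeft F[X] (fun k => Cyc (g k) (b k)) σ)

/-- Every matrix has a type, since the degrees of its elementary divisors are at most its size. -/
lemma exists_hasType [Finite F] {D d : ℕ} (hd : d ≤ D) (A : Matrix (Fin d) (Fin d) F) :
    ∃ τ : irredLE F D → AnyPartition, HasType A τ := by
  classical
  obtain ⟨_, n, f, a, h1, -, ⟨e⟩⟩ := exists_hasElementaryDivisors A
  have e' := e.trans (DirectSum.linearEquivFunOnFintype F[X] (Fin n)
      (fun i => F[X] ⧸ Ideal.span {f i ^ a i}))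
  have hmem : ∀ i, f i ∈ irredLE F D := by
    intro i
    refine mem_irredLE.2 ⟨⟨(h1 i).1, (h1 i).2.1⟩, le_trans ?_ hd⟩
    have hc := natCard_AEval A
    rw [Nat.card_congr e'.toEquiv, Nat.card_pi] at hc
    have h2 : Nat.card F ^ (f i).natDegree ∣ Nat.card F ^ d := by
      rw [← hc]
      refine dvd_trans ?_ (Finset.dvd_prod_of_mem _ (Finset.mem_univ i))
      rw [Cyc.card (h1 i).1]
      exact dvd_pow_self _ (h1 i).2.2.ne'
    exact (Nat.pow_dvd_pow_iff_le_right (Finite.one_lt_card (α := F))).1 h2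
  let s : irredLE F D → Multiset ℕ := fun g =>
    Multiset.map (fun i : {i // f i = (g : F[X])} => a i.1) Finset.univ.val
  let τ : irredLE F D → AnyPartition := fun g => ⟨(s g).sum, ⟨s g, by
    intro b hb
    obtain ⟨i, -, rfl⟩ := Multiset.mem_map.1 hb
    exact (h1 i).2.2, rfl⟩⟩
  have hσ : ∀ g : irredLE F D, ∃ σ : {i // f i = g} ≃ Fin (numParts (τ g)),
      ∀ i, row (τ g) (σ i) = a i := fun g =>
    exists_equiv_of_map_univ_eq (fun i : {i // f i = g} => a i) (row (τ g)) (map_row (τ g)).symm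
  choose σ hσ using hσ
  let reg : Fin n ≃ Σ g : irredLE F D, {i // f i = g} :=
    { toFun := fun i => ⟨⟨f i, hmem i⟩, ⟨i, rfl⟩⟩
      invFun := fun x => x.2.1
      left_inv := fun i => rfl
      right_inv := fun x => by
        obtain ⟨⟨g, hg⟩, ⟨i, hi⟩⟩ := x
        simp only at hi
        subst hi
        rfl }
  let reg' : Fin n ≃ Σ g : irredLE F D, Fin (numParts (τ g)) :=
    reg.trans (Equiv.sigmaCongrRight σ)
  exact ⟨τ, ⟨e'.trans ((cycReindex (g := fun x : Σ g : irredLE F D, Fin (numParts (τ g)) =>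
    (x.1 : F[X])) (b := fun x => row (τ x.1) x.2) reg' (fun i => rfl) (fun i => hσ _ _)).trans
    (LinearEquiv.piCurry F[X]
      (fun (g : irredLE F D) (i : Fin (numParts (τ g))) => Cyc (g : F[X]) (row (τ g) i))))⟩⟩

lemma HasType.isOfType_iff [Finite F] {D d : ℕ} {A : Matrix (Fin d) (Fin d) F}
    {τ : irredLE F D → AnyPartition} (hτ : HasType A τ) (Λ : Set AnyPartition) :
    IsOfType Λ A ↔ ∀ f, (τ f).1 = 0 ∨ τ f ∈ Λ := by
  constructor
  · rintro ⟨E, hE, h⟩ f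
    have hf := irredLE_spec f.1 f.2
    rcases h f hf.1 hf.2 with h | ⟨p, hp, h⟩
    · left
      rwa [hτ.partsAt_eq hE, parts_eq_zero_iff] at h
    · right
      rw [hτ.partsAt_eq hE] at h
      rwa [← anyPartition_ext h]
  · intro h
    obtain ⟨E, hE⟩ := exists_hasElementaryDivisors A
    refine ⟨E, hE, fun f hf hfi => ?_⟩
    by_cases hfD : f ∈ irredLE F D
    · rcases h ⟨f, hfD⟩ with h | h
      · left
        rwa [hτ.partsAt_eq hE ⟨f, hfD⟩, parts_eq_zero_iff]
      · right
        exact ⟨_, h, (hτ.partsAt_eq hE ⟨f, hfD⟩).symm⟩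
    · exact Or.inl (hτ.partsAt_of_notMem hE hf hfi hfD)

/-- A matrix is invertible iff the `X`-torsion of its module is trivial. -/
lemma isUnit_iff_card_torsionBy [Finite F] {d : ℕ} (A : Matrix (Fin d) (Fin d) F) :
    IsUnit A ↔ Nat.card (Submodule.torsionBy F[X] (Module.AEval' (Matrix.toLin' A))
      ((Polynomial.X : F[X]) ^ 1)) = 1 := by
  rw [pow_one, ← Matrix.isUnit_toLin'_iff, Module.End.isUnit_iff, Nat.card_eq_one_iff_unique]
  have h1 : Function.Bijective (Matrix.toLin' A) ↔ Function.Injective (Matrix.toLin' A) :=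
    ⟨fun h => h.1, fun h => ⟨h, LinearMap.injective_iff_surjective.1 h⟩⟩
  rw [h1]
  constructor
  · intro h
    refine ⟨⟨fun x y => Subtype.ext ?_⟩, ⟨0⟩⟩
    have h2 : ∀ x : Submodule.torsionBy F[X] (Module.AEval' (Matrix.toLin' A))
        (Polynomial.X : F[X]),
        (x : Module.AEval' (Matrix.toLin' A)) = 0 := by
      intro x
      have h3 := (Submodule.mem_torsionBy_iff _ _).1 x.2
      obtain ⟨v, hv⟩ := (Module.AEval'.of (Matrix.toLin' A)).surjective x.1
      rw [← hv, Module.AEval'.X_smul_of, LinearEquiv.map_eq_zero_iff] at h3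
      rw [← hv, h (h3.trans (map_zero _).symm), map_zero]
    rw [h2 x, h2 y]
  · rintro ⟨h, -⟩
    rw [injective_iff_map_eq_zero]
    intro v hv
    have h3 : Module.AEval'.of (Matrix.toLin' A) v ∈ Submodule.torsionBy F[X]
        (Module.AEval' (Matrix.toLin' A)) (Polynomial.X : F[X]) := by
      rw [Submodule.mem_torsionBy_iff, Module.AEval'.X_smul_of, hv, map_zero]
    have h4 := congrArg Subtype.val (h.elim ⟨_, h3⟩ 0)
    exact (LinearEquiv.map_eq_zero_iff _).1 h4

lemma HasType.isUnit_iff [Finite F] {D d : ℕ} (hD : 1 ≤ D) {A : Matrix (Fin d) (Fin d) F}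
    {τ : irredLE F D → AnyPartition} (hτ : HasType A τ) :
    IsUnit A ↔ ∀ f : irredLE F D, (f : F[X]) = Polynomial.X → (τ f).1 = 0 := by
  have hX : (Polynomial.X : F[X]) ∈ irredLE F D :=
    mem_irredLE.2 ⟨⟨Polynomial.monic_X, Polynomial.irreducible_X⟩, by simpa using hD⟩
  have h1 : (∀ f : irredLE F D, (f : F[X]) = Polynomial.X → (τ f).1 = 0) ↔
      (τ ⟨_, hX⟩).1 = 0 :=
    ⟨fun h => h _ rfl, fun h f hf => by rwa [show f = ⟨_, hX⟩ from Subtype.ext hf]⟩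
  rw [h1, isUnit_iff_card_torsionBy, hτ.card_torsionBy ⟨_, hX⟩ 1, ← parts_eq_zero_iff]
  constructor
  · intro h
    exact Multiset.eq_zero_of_sum_map_min_one (fun _ h => Nat.Partition.parts_pos _ h)
      (Nat.pow_right_injective (one_lt_card_pow Polynomial.irreducible_X)
        (h.trans (pow_zero _).symm))
  · intro h
    rw [h]
    simp

end Types

/-! ### The cycle index of the matrix algebra -/

section CycleIndex

open Classical in
/-- The sum of the weights of the partitions of `j` in `S`. -/
noncomputable def ecoef {𝕜 : Type*} [Field 𝕜] (S : Set AnyPartition) (y : 𝕜) (j : ℕ) : 𝕜 :=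
  ∑ p : j.Partition, if (⟨j, p⟩ : AnyPartition) ∈ S then wt ⟨j, p⟩ y else 0

/-- The generating function of the weights of the partitions in `S`, by size. -/
noncomputable def eser (S : Set AnyPartition) (y : ℝ) : PowerSeries ℝ :=
  PowerSeries.mk (ecoef S y)

/-- The power series `φ (u ^ m)`. -/
noncomputable def spread (m : ℕ) (φ : PowerSeries ℝ) : PowerSeries ℝ :=
  PowerSeries.mk fun n => if m ∣ n then PowerSeries.coeff (n / m) φ else 0

lemma coeff_spread (m n : ℕ) (φ : PowerSeries ℝ) : PowerSeries.coeff n (spread m φ) =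
    if m ∣ n then PowerSeries.coeff (n / m) φ else 0 := PowerSeries.coeff_mk _ _

lemma spread_eq_expand {m : ℕ} (hm : m ≠ 0) (φ : PowerSeries ℝ) :
    spread m φ = PowerSeries.expand m hm φ := by
  ext n
  rw [coeff_spread, PowerSeries.coeff_expand]

lemma spread_mul {m : ℕ} (hm : m ≠ 0) (φ ψ : PowerSeries ℝ) :
    spread m (φ * ψ) = spread m φ * spread m ψ := by
  simp only [spread_eq_expand hm, map_mul]

/-- Coefficients up to degree `D` of a product only depend on those of the factors. -/
lemma coeff_prod_congr {ι : Type*} (s : Finset ι) (D : ℕ) (φ ψ : ι → PowerSeries ℝ)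
    (h : ∀ i ∈ s, ∀ n ≤ D, PowerSeries.coeff n (φ i) = PowerSeries.coeff n (ψ i)) :
    ∀ n ≤ D, PowerSeries.coeff n (∏ i ∈ s, φ i) = PowerSeries.coeff n (∏ i ∈ s, ψ i) := by
  classical
  induction s using Finset.induction_on with
  | empty => intro n _; simp
  | insert i s hi ih =>
    intro n hn
    rw [Finset.prod_insert hi, Finset.prod_insert hi, PowerSeries.coeff_mul, PowerSeries.coeff_mul]
    refine Finset.sum_congr rfl fun ab hab => ?_
    have := Finset.HasAntidiagonal.mem_antidiagonal.1 hab
    rw [h i (Finset.mem_insert_self _ _) _ (by omega),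
      ih (fun j hj => h j (Finset.mem_insert_of_mem hj)) _ (by omega)]

/-- The partitions of size at most `D`. -/
def partitionsLE (D : ℕ) : Finset AnyPartition := (Finset.range (D + 1)).sigma fun _ => Finset.univ

lemma mem_partitionsLE {D : ℕ} {p : AnyPartition} : p ∈ partitionsLE D ↔ p.1 ≤ D := by
  simp [partitionsLE]

open Classical in
/-- The local factor, as a finite sum of monomials modulo `u ^ (D + 1)`. -/
lemma coeff_truncated_eser (S : Set AnyPartition) (y : ℝ) {m n D : ℕ} (hm : m ≠ 0) (hn : n ≤ D) :
    PowerSeries.coeff n (∑ p ∈ partitionsLE D, (PowerSeries.monomial (p.1 * m))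
      (if p ∈ S then wt p y else 0)) = PowerSeries.coeff n (spread m (eser S y)) := by
  rw [coeff_spread, map_sum, partitionsLE, Finset.sum_sigma]
  simp only [PowerSeries.coeff_monomial]
  split_ifs with h
  · obtain ⟨k, rfl⟩ := h
    rw [Nat.mul_div_cancel_left _ (Nat.pos_of_ne_zero hm), eser, PowerSeries.coeff_mk, ecoef,
      Finset.sum_eq_single k]
    · simp [mul_comm]
    · intro j _ hj
      refine Finset.sum_eq_zero fun p _ => if_neg ?_
      rw [mul_comm m]
      exact fun h => hj (Nat.eq_of_mul_eq_mul_right (Nat.pos_of_ne_zero hm) h).symm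
    · intro hk
      exfalso
      apply hk
      rw [Finset.mem_range]
      have := Nat.le_mul_of_pos_left k (Nat.pos_of_ne_zero hm)
      omega
  · refine Finset.sum_eq_zero fun j _ => Finset.sum_eq_zero fun p _ => if_neg ?_
    rintro rfl
    exact h (dvd_mul_left _ _)

variable {F : Type} [Field F] [Finite F]

/-- The number of matrices of given type, through the order of the automorphism group of the
corresponding module. -/
lemma card_hasType {D d : ℕ} {τ : irredLE F D → AnyPartition} (hτ : typeDeg τ = d) :
    (Nat.card {A : Matrix (Fin d) (Fin d) F // HasType A τ} : ℝ) =
      Nat.card (GL (Fin d) F) *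
        ∏ f, wt (τ f) (((Nat.card F : ℝ)⁻¹) ^ (f : F[X]).natDegree) := by
  have hfin := TypeMod.finite (irredLE_spec (F := F) (D := D)) τ
  have h1 := TypeMod.inv_card_aut irredLE_spec τ
  have h2 := card_matrices_mul_card_aut (F := F) (TypeMod τ) d
    (by rw [TypeMod.card irredLE_spec, hτ])
  have : Finite (TypeMod τ ≃ₗ[F[X]] TypeMod τ) :=
    Finite.of_injective (fun e => (e : TypeMod τ → TypeMod τ)) DFunLike.coe_injective
  have h3 : (Nat.card (TypeMod τ ≃ₗ[F[X]] TypeMod τ) : ℝ) ≠ 0 := by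
    have : Nonempty (TypeMod τ ≃ₗ[F[X]] TypeMod τ) := ⟨LinearEquiv.refl _ _⟩
    exact_mod_cast Nat.card_pos.ne'
  rw [← h1, ← h2, Nat.cast_mul, mul_assoc, mul_inv_cancel₀ h3, mul_one]
  rfl

/-- The cycle index of the algebra of square matrices: sorting matrices by their type, the
proportion of matrices with `f`-part in `S f` for all `f` has an Euler product. -/
theorem cycle_index {D d : ℕ} (hd : d ≤ D) (S : F[X] → Set AnyPartition) :
    (Nat.card {A : Matrix (Fin d) (Fin d) F //
        ∃ τ : irredLE F D → AnyPartition, HasType A τ ∧ ∀ f : irredLE F D, τ f ∈ S f} : ℝ) /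
      Nat.card (GL (Fin d) F) =
    PowerSeries.coeff d (∏ f ∈ irredLE F D,
      spread f.natDegree (eser (S f) (((Nat.card F : ℝ)⁻¹) ^ f.natDegree))) := by
  classical
  have hGL : (Nat.card (GL (Fin d) F) : ℝ) ≠ 0 := by exact_mod_cast Nat.card_pos.ne'
  set x := (Nat.card F : ℝ)⁻¹ with hx
  -- the types of the matrices to be counted; their partitions have size at most `D`
  let T : Finset (irredLE F D → AnyPartition) :=
    (Fintype.piFinset fun _ => partitionsLE D).filter fun τ =>
      typeDeg τ = d ∧ ∀ f : irredLE F D, τ f ∈ S f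
  have hdeg : ∀ f : irredLE F D, 0 < (f : F[X]).natDegree := fun f =>
    (irredLE_spec f.1 f.2).2.natDegree_pos
  have hT : ∀ τ : irredLE F D → AnyPartition,
      τ ∈ T ↔ typeDeg τ = d ∧ ∀ f : irredLE F D, τ f ∈ S f := by
    intro τ
    rw [Finset.mem_filter, and_iff_right_iff_imp, Fintype.mem_piFinset]
    rintro ⟨h, -⟩ f
    rw [mem_partitionsLE]
    refine le_trans ?_ hd
    rw [← h, typeDeg]
    calc (τ f).1 ≤ (τ f).1 * (f : F[X]).natDegree := Nat.le_mul_of_pos_right _ (hdeg f)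
      _ ≤ _ := Finset.single_le_sum (f := fun f : irredLE F D => (τ f).1 * (f : F[X]).natDegree)
        (fun _ _ => Nat.zero_le _) (Finset.mem_univ f)
  have e : {A : Matrix (Fin d) (Fin d) F //
        ∃ τ : irredLE F D → AnyPartition, HasType A τ ∧ ∀ f : irredLE F D, τ f ∈ S f} ≃
      Σ τ : T, {A : Matrix (Fin d) (Fin d) F // HasType A τ.1} :=
    { toFun := fun A => ⟨⟨A.2.choose, (hT _).2 ⟨A.2.choose_spec.1.typeDeg_eq,
        A.2.choose_spec.2⟩⟩, ⟨A.1, A.2.choose_spec.1⟩⟩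
      invFun := fun p => ⟨p.2.1, p.1.1, p.2.2, ((hT _).1 p.1.2).2⟩
      left_inv := fun A => rfl
      right_inv := fun p => by
        have hA : ∃ τ : irredLE F D → AnyPartition,
            HasType p.2.1 τ ∧ ∀ f : irredLE F D, τ f ∈ S f :=
          ⟨p.1.1, p.2.2, ((hT _).1 p.1.2).2⟩
        exact Sigma.subtype_ext (Subtype.ext (hA.choose_spec.1.unique p.2.2)) rfl }
  have h1 : (Nat.card {A : Matrix (Fin d) (Fin d) F //
        ∃ τ : irredLE F D → AnyPartition, HasType A τ ∧ ∀ f : irredLE F D, τ f ∈ S f} : ℝ) =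
      Nat.card (GL (Fin d) F) * ∑ τ ∈ T, ∏ f, wt (τ f) (x ^ (f : F[X]).natDegree) := by
    rw [Nat.card_congr e, Nat.card_sigma, Nat.cast_sum, Finset.mul_sum, ← Finset.sum_coe_sort T]
    exact Finset.sum_congr rfl fun τ _ => card_hasType ((hT _).1 τ.2).1
  rw [h1, mul_div_cancel_left₀ _ hGL, ← coeff_prod_congr (irredLE F D) D
    (fun f => ∑ p ∈ partitionsLE D, (PowerSeries.monomial (p.1 * f.natDegree))
      (if p ∈ S f then wt p (x ^ f.natDegree) else 0)) _
    (fun f hf n hn => coeff_truncated_eser _ _ (irredLE_spec f hf).2.natDegree_pos.ne' hn) d hd,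
    ← Finset.prod_coe_sort, Finset.prod_univ_sum, map_sum, Finset.sum_filter]
  refine Finset.sum_congr rfl fun τ _ => ?_
  have hmon : ∏ f : irredLE F D, (PowerSeries.monomial ((τ f).1 * (f : F[X]).natDegree))
      (if τ f ∈ S f then wt (τ f) (x ^ (f : F[X]).natDegree) else 0) =
      PowerSeries.monomial (typeDeg τ)
        (∏ f : irredLE F D, if τ f ∈ S f then wt (τ f) (x ^ (f : F[X]).natDegree) else 0) := by
    rw [typeDeg]
    induction (Finset.univ : Finset (irredLE F D)) using Finset.induction_on with
    | empty => simp
    | insert i s hi ih =>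
      rw [Finset.prod_insert hi, Finset.prod_insert hi, Finset.sum_insert hi, ih,
        PowerSeries.monomial_mul_monomial]
  rw [hmon, PowerSeries.coeff_monomial]
  by_cases h : typeDeg τ = d
  · by_cases h2 : ∀ f : irredLE F D, τ f ∈ S f
    · rw [if_pos ⟨h, h2⟩, if_pos h.symm]
      exact Finset.prod_congr rfl fun f _ => (if_pos (h2 f)).symm
    · rw [if_neg fun h3 => h2 h3.2, if_pos h.symm]
      push Not at h2
      obtain ⟨f, hf⟩ := h2
      exact (Finset.prod_eq_zero (Finset.mem_univ f) (if_neg hf)).symm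
  · rw [if_neg fun h3 => h h3.1, if_neg fun h3 => h h3.symm]

end CycleIndex

/-! ### Power series modulo a power of the variable -/

section Congruence

/-- Equality of power series modulo `u ^ (D + 1)`. -/
def EqUpTo (D : ℕ) (φ ψ : PowerSeries ℝ) : Prop :=
  ∀ n ≤ D, PowerSeries.coeff n φ = PowerSeries.coeff n ψ

lemma EqUpTo.refl (D : ℕ) (φ : PowerSeries ℝ) : EqUpTo D φ φ := fun _ _ => rfl

lemma EqUpTo.symm {D : ℕ} {φ ψ : PowerSeries ℝ} (h : EqUpTo D φ ψ) : EqUpTo D ψ φ :=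
  fun n hn => (h n hn).symm

lemma EqUpTo.trans {D : ℕ} {φ ψ χ : PowerSeries ℝ} (h : EqUpTo D φ ψ) (h' : EqUpTo D ψ χ) :
    EqUpTo D φ χ := fun n hn => (h n hn).trans (h' n hn)

lemma EqUpTo.mul {D : ℕ} {φ ψ φ' ψ' : PowerSeries ℝ} (h : EqUpTo D φ ψ) (h' : EqUpTo D φ' ψ') :
    EqUpTo D (φ * φ') (ψ * ψ') := by
  intro n hn
  rw [PowerSeries.coeff_mul, PowerSeries.coeff_mul]
  refine Finset.sum_congr rfl fun ab hab => ?_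
  have := Finset.HasAntidiagonal.mem_antidiagonal.1 hab
  rw [h _ (by omega), h' _ (by omega)]

/-- The power series `1 - y u`. -/
noncomputable def oneSub (y : ℝ) : PowerSeries ℝ := 1 - PowerSeries.C y * PowerSeries.X

lemma coeff_zero_oneSub_mul (y : ℝ) (φ : PowerSeries ℝ) :
    PowerSeries.coeff 0 (oneSub y * φ) = PowerSeries.coeff 0 φ := by
  simp [oneSub, sub_mul]

lemma coeff_succ_oneSub_mul (y : ℝ) (φ : PowerSeries ℝ) (n : ℕ) :
    PowerSeries.coeff (n + 1) (oneSub y * φ) =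
      PowerSeries.coeff (n + 1) φ - y * PowerSeries.coeff n φ := by
  rw [oneSub, sub_mul, one_mul, map_sub, mul_assoc, PowerSeries.coeff_C_mul,
    PowerSeries.coeff_succ_X_mul]

/-- The power series `1 / (1 - y u)`. -/
noncomputable def geoSeries (y : ℝ) : PowerSeries ℝ := PowerSeries.mk fun n => y ^ n

lemma oneSub_mul_geoSeries (y : ℝ) : oneSub y * geoSeries y = 1 := by
  ext n
  cases n with
  | zero => rw [coeff_zero_oneSub_mul]; simp [geoSeries]
  | succ n =>
    rw [coeff_succ_oneSub_mul]
    simp [geoSeries, PowerSeries.coeff_one, pow_succ']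

lemma coeff_geoSeries_one_mul (φ : PowerSeries ℝ) (n : ℕ) :
    PowerSeries.coeff n (geoSeries 1 * φ) =
      ∑ i ∈ Finset.range (n + 1), PowerSeries.coeff i φ := by
  rw [mul_comm, PowerSeries.coeff_mul, Finset.Nat.sum_antidiagonal_eq_sum_range_succ_mk]
  simp [geoSeries]

end Congruence

/-! ### The cycle index of the general linear group -/

section GLIndex

variable {F : Type} [Field F] [Finite F]

open Classical in
/-- The monic irreducible polynomials of degree at most `D` other than `X`. -/
noncomputable def irredGL (F : Type) [Field F] [Finite F] (D : ℕ) : Finset F[X] :=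
  (irredLE F D).erase Polynomial.X

lemma mem_irredGL {D : ℕ} {f : F[X]} : f ∈ irredGL F D ↔
    f ≠ Polynomial.X ∧ (f.Monic ∧ Irreducible f) ∧ f.natDegree ≤ D := by
  classical
  rw [irredGL, Finset.mem_erase, mem_irredLE]

lemma X_mem_irredLE {D : ℕ} (hD : 1 ≤ D) : (Polynomial.X : F[X]) ∈ irredLE F D :=
  mem_irredLE.2 ⟨⟨Polynomial.monic_X, Polynomial.irreducible_X⟩, by simpa using hD⟩

/-- The set `Λ` together with the empty partition. -/
def withEmpty (Λ : Set AnyPartition) : Set AnyPartition := {p | p.1 = 0 ∨ p ∈ Λ}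

lemma ecoef_zero {𝕜 : Type*} [Field 𝕜] {S : Set AnyPartition}
    (hS : ∀ p : AnyPartition, p.1 = 0 → p ∈ S) (y : 𝕜) : ecoef S y 0 = 1 := by
  rw [ecoef, Fintype.sum_unique, if_pos (hS _ rfl), wt_of_size_eq_zero rfl]

lemma eser_empty (y : ℝ) : eser {p | p.1 = 0} y = 1 := by
  ext n
  rw [eser, PowerSeries.coeff_mk, PowerSeries.coeff_one]
  split_ifs with h
  · subst h
    exact ecoef_zero (fun _ h => h) y
  · exact Finset.sum_eq_zero fun p _ => if_neg h

lemma spread_one {m : ℕ} (hm : m ≠ 0) : spread m 1 = 1 := by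
  rw [spread_eq_expand hm, map_one]

/-- The Euler product over the monic irreducible polynomials `f ≠ X`, with the factor attached
to the set `S`. -/
noncomputable def glProduct (S : Set AnyPartition) (F : Type) [Field F] [Finite F] (D : ℕ) :
    PowerSeries ℝ :=
  ∏ f ∈ irredGL F D, spread f.natDegree (eser S (((Nat.card F : ℝ)⁻¹) ^ f.natDegree))

/-- The cycle index of the general linear group: a matrix is invertible iff its partition at the
polynomial `X` is empty. -/
theorem glProb_eq_coeff (Λ : Set AnyPartition) {D d : ℕ} (hD : 1 ≤ D) (hd : d ≤ D) :
    glProb Λ d F = PowerSeries.coeff d (glProduct (withEmpty Λ) F D) := by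
  classical
  -- the factor at `X` is trivial
  let S : F[X] → Set AnyPartition := fun f =>
    if f = Polynomial.X then {p | p.1 = 0} else withEmpty Λ
  have h1 := cycle_index (F := F) hd S
  have h2 : Nat.card {g : GL (Fin d) F // IsOfType Λ (g : Matrix (Fin d) (Fin d) F)} =
      Nat.card {A : Matrix (Fin d) (Fin d) F //
        ∃ τ : irredLE F D → AnyPartition, HasType A τ ∧ ∀ f : irredLE F D, τ f ∈ S f} := by
    have key : ∀ A : Matrix (Fin d) (Fin d) F, (∃ τ : irredLE F D → AnyPartition,
        HasType A τ ∧ ∀ f : irredLE F D, τ f ∈ S f) ↔ IsUnit A ∧ IsOfType Λ A := by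
      intro A
      have hS : ∀ τ : irredLE F D → AnyPartition, HasType A τ →
          ((∀ f : irredLE F D, τ f ∈ S f) ↔ IsUnit A ∧ IsOfType Λ A) := by
        intro τ hτ
        rw [hτ.isUnit_iff hD, hτ.isOfType_iff, ← forall_and]
        refine forall_congr' fun f => ?_
        by_cases hf : (f : F[X]) = Polynomial.X
        · simp only [S, if_pos hf, Set.mem_ofPred_eq]
          exact ⟨fun h => ⟨fun _ => h, Or.inl h⟩, fun h => h.1 hf⟩
        · simp only [S, if_neg hf, withEmpty, Set.mem_ofPred_eq]
          exact ⟨fun h => ⟨fun h' => absurd h' hf, h⟩, fun h => h.2⟩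
      constructor
      · rintro ⟨τ, hτ, h⟩
        exact (hS τ hτ).1 h
      · intro h
        obtain ⟨τ, hτ⟩ := exists_hasType hd A
        exact ⟨τ, hτ, (hS τ hτ).2 h⟩
    refine Nat.card_eq_of_bijective (fun g => ⟨g.1, (key _).2 ⟨Units.isUnit g.1, g.2⟩⟩) ⟨?_, ?_⟩
    · intro g g' h
      exact Subtype.ext (Units.ext (congrArg Subtype.val h))
    · rintro ⟨A, hA⟩
      obtain ⟨⟨g, rfl⟩, h⟩ := (key A).1 hA
      exact ⟨⟨g, h⟩, rfl⟩
  rw [glProb, h2, h1, ← Finset.mul_prod_erase _ _ (X_mem_irredLE hD)]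
  simp only [S, if_true, eser_empty, Polynomial.natDegree_X, spread_one one_ne_zero, one_mul]
  rw [glProduct, irredGL]
  refine congrArg _ (Finset.prod_congr rfl fun f hf => ?_)
  rw [if_neg (Finset.ne_of_mem_erase hf)]

lemma withEmpty_univ : withEmpty Set.univ = Set.univ := by
  ext p; simp [withEmpty]

lemma glProb_univ (d : ℕ) : glProb Set.univ d F = 1 := by
  have h : ∀ g : GL (Fin d) F, IsOfType Set.univ (g : Matrix (Fin d) (Fin d) F) := by
    intro g
    obtain ⟨τ, hτ⟩ := exists_hasType le_rfl (g : Matrix (Fin d) (Fin d) F)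
    rw [hτ.isOfType_iff]
    exact fun f => Or.inr (Set.mem_univ _)
  have hGL : (Nat.card (GL (Fin d) F) : ℝ) ≠ 0 := by exact_mod_cast Nat.card_pos.ne'
  rw [glProb, Nat.card_congr (Equiv.subtypeUnivEquiv h), div_self hGL]

/-- Every invertible matrix is of type `Set.univ`, so the full Euler product is `1 / (1 - u)`. -/
lemma glProduct_univ {D : ℕ} (hD : 1 ≤ D) : EqUpTo D (glProduct Set.univ F D) (geoSeries 1) := by
  intro n hn
  rw [← withEmpty_univ, ← glProb_eq_coeff _ hD hn, glProb_univ]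
  simp [geoSeries]

/-- The product `(1 - y) (1 - y ^ 2) ⋯ (1 - y ^ n)`. -/
noncomputable def qpoch {𝕜 : Type*} [Field 𝕜] (y : 𝕜) (n : ℕ) : 𝕜 :=
  ∏ i ∈ Finset.range n, (1 - y ^ (i + 1))

lemma card_matrix_div_card_GL (n : ℕ) :
    (Nat.card (Matrix (Fin n) (Fin n) F) : ℝ) / Nat.card (GL (Fin n) F) =
      (qpoch ((Nat.card F : ℝ)⁻¹) n)⁻¹ := by
  have := Fintype.ofFinite F
  rw [Matrix.card_GL_field, ← Nat.card_eq_fintype_card]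
  set q := Nat.card F with hq
  have hq1 : 1 < q := Finite.one_lt_card
  have hq0 : (q : ℝ) ≠ 0 := by positivity
  have hcard : Nat.card (Matrix (Fin n) (Fin n) F) = ∏ i ∈ Finset.range n, q ^ n := by
    simp [Matrix, hq]
  rw [hcard, Finset.prod_range fun _ => q ^ n, qpoch, ← Finset.prod_range_reflect,
    Finset.prod_range (fun j => 1 - (q : ℝ)⁻¹ ^ (n - 1 - j + 1)), ← Finset.prod_inv_distrib,
    Nat.cast_prod, Nat.cast_prod, ← Finset.prod_div_distrib]
  refine Finset.prod_congr rfl fun i _ => ?_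
  have hi := i.2
  rw [Nat.cast_sub (Nat.pow_le_pow_right hq1.le hi.le)]
  push_cast
  have h2 : (q : ℝ) ^ n - (q : ℝ) ^ (i : ℕ) = q ^ n * (1 - (q : ℝ)⁻¹ ^ (n - 1 - i + 1)) := by
    rw [show n - 1 - (i : ℕ) + 1 = n - i by omega, mul_sub, mul_one, inv_pow, ← div_eq_mul_inv,
      eq_comm, sub_right_inj, div_eq_iff (by positivity), ← pow_add]
    congr 1; omega
  rw [h2, div_mul_eq_div_div, div_self (by positivity), one_div]

/-- Comparing the cycle indices for all matrices and for all invertible matrices gives the sum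
of the weights of all partitions of given size. -/
lemma sum_ecoef_univ (n : ℕ) :
    ∑ i ∈ Finset.range (n + 1), ecoef Set.univ ((Nat.card F : ℝ)⁻¹) i =
      (qpoch ((Nat.card F : ℝ)⁻¹) n)⁻¹ := by
  classical
  have hD : 1 ≤ n + 1 := by omega
  have h1 := cycle_index (F := F) (Nat.le_succ n) (fun _ => Set.univ)
  have h2 : Nat.card {A : Matrix (Fin n) (Fin n) F // ∃ τ : irredLE F (n + 1) → AnyPartition,
      HasType A τ ∧ ∀ f : irredLE F (n + 1), τ f ∈ Set.univ} =
      Nat.card (Matrix (Fin n) (Fin n) F) := by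
    refine Nat.card_congr (Equiv.subtypeUnivEquiv fun A => ?_)
    obtain ⟨τ, hτ⟩ := exists_hasType (Nat.le_succ n) A
    exact ⟨τ, hτ, fun _ => Set.mem_univ _⟩
  rw [h2, card_matrix_div_card_GL, ← Finset.prod_erase_mul _ _ (X_mem_irredLE hD)] at h1
  change _ = PowerSeries.coeff n (glProduct Set.univ F (n + 1) * _) at h1
  rw [((glProduct_univ (F := F) hD).mul (EqUpTo.refl _ _)) n (Nat.le_succ n),
    coeff_geoSeries_one_mul] at h1
  rw [h1]
  refine Finset.sum_congr rfl fun i _ => ?_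
  rw [Polynomial.natDegree_X, pow_one, coeff_spread, if_pos (one_dvd _), Nat.div_one, eser,
    PowerSeries.coeff_mk]

lemma qpoch_succ {𝕜 : Type*} [Field 𝕜] (y : 𝕜) (n : ℕ) :
    qpoch y (n + 1) = qpoch y n * (1 - y ^ (n + 1)) := Finset.prod_range_succ _ _

lemma one_sub_pow_ne_zero {y : ℂ} (hy : ‖y‖ < 1) {n : ℕ} (hn : n ≠ 0) : 1 - y ^ n ≠ 0 := by
  intro h
  have h1 : ‖y ^ n‖ = 1 := by rw [← sub_eq_zero.1 h, norm_one]
  rw [norm_pow] at h1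
  exact (pow_lt_one₀ (norm_nonneg _) hy hn).ne h1

lemma qpoch_ne_zero {y : ℂ} (hy : ‖y‖ < 1) (n : ℕ) : qpoch y n ≠ 0 :=
  Finset.prod_ne_zero_iff.2 fun i _ => one_sub_pow_ne_zero hy (Nat.succ_ne_zero i)

lemma ofReal_qpoch (y : ℝ) (n : ℕ) : ((qpoch y n : ℝ) : ℂ) = qpoch (y : ℂ) n := by
  simp [qpoch]

lemma ofReal_wt (p : AnyPartition) (y : ℝ) : ((wt p y : ℝ) : ℂ) = wt p (y : ℂ) := by
  simp [wt]

lemma ofReal_ecoef (S : Set AnyPartition) (y : ℝ) (n : ℕ) :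
    ((ecoef S y n : ℝ) : ℂ) = ecoef S (y : ℂ) n := by
  simp only [ecoef, Complex.ofReal_sum]
  refine Finset.sum_congr rfl fun p _ => ?_
  split_ifs
  · exact ofReal_wt _ _
  · rfl

/-- The identity of `ecoef_univ` at the reciprocal of a prime, as a difference of consecutive
instances of `sum_ecoef_univ`. -/
lemma ecoef_univ_prime (p : ℕ) (hp : p.Prime) (n : ℕ) :
    ecoef Set.univ ((p : ℝ)⁻¹) n = ((p : ℝ)⁻¹) ^ n / qpoch ((p : ℝ)⁻¹) n := by
  have : Fact p.Prime := ⟨hp⟩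
  have h := fun n => sum_ecoef_univ (F := ZMod p) n
  simp only [Nat.card_zmod] at h
  have hq : ∀ n, qpoch ((p : ℝ)⁻¹) n ≠ 0 := by
    intro n h0
    have h1 := ofReal_qpoch ((p : ℝ)⁻¹) n
    rw [h0] at h1
    refine qpoch_ne_zero (y := (((p : ℝ)⁻¹ : ℝ) : ℂ)) ?_ n h1.symm
    rw [Complex.norm_real, Real.norm_of_nonneg (by positivity)]
    exact inv_lt_one_of_one_lt₀ (by exact_mod_cast hp.one_lt)
  cases n with
  | zero =>
    have := h 0
    simpa [qpoch] using this
  | succ n =>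
    have h1 := h (n + 1)
    rw [Finset.sum_range_succ, h n] at h1
    have h2 := hq (n + 1)
    rw [qpoch_succ] at h1 h2 ⊢
    have h3 := left_ne_zero_of_mul h2
    have h4 := right_ne_zero_of_mul h2
    rw [eq_sub_of_add_eq' h1]
    generalize ((p : ℝ)⁻¹) ^ (n + 1) = z at h4 ⊢
    field_simp
    ring

lemma differentiableAt_wt (p : AnyPartition) {y : ℂ} (hy : ‖y‖ < 1) :
    DifferentiableAt ℂ (wt p) y := by
  unfold wt
  refine DifferentiableAt.div (by fun_prop) (by fun_prop) ?_
  exact Finset.prod_ne_zero_iff.2 fun j _ => one_sub_pow_ne_zero hy (resid_pos p j).ne'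

lemma differentiableAt_ecoef (S : Set AnyPartition) (n : ℕ) {y : ℂ} (hy : ‖y‖ < 1) :
    DifferentiableAt ℂ (fun y => ecoef S y n) y := by
  classical
  unfold ecoef
  refine DifferentiableAt.fun_sum fun p _ => ?_
  split_ifs
  · exact differentiableAt_wt _ hy
  · exact differentiableAt_const _

/-- The sum over all partitions of `n` of the reciprocal orders of the automorphism groups. The
identity is known at the reciprocals of the primes, hence holds throughout the unit disc. -/
theorem ecoef_univ (n : ℕ) {y : ℂ} (hy : ‖y‖ < 1) :
    ecoef Set.univ y n = y ^ n / qpoch y n := by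
  have hU : IsOpen (Metric.ball (0 : ℂ) 1) := Metric.isOpen_ball
  have hf : AnalyticOnNhd ℂ (fun y : ℂ => ecoef Set.univ y n) (Metric.ball 0 1) := by
    refine DifferentiableOn.analyticOnNhd (fun y hy => ?_) hU
    exact (differentiableAt_ecoef _ _ (mem_ball_zero_iff.1 hy)).differentiableWithinAt
  have hg : AnalyticOnNhd ℂ (fun y : ℂ => y ^ n / qpoch y n) (Metric.ball 0 1) := by
    refine DifferentiableOn.analyticOnNhd (fun y hy => ?_) hU
    refine DifferentiableAt.differentiableWithinAt ?_
    have h0 := qpoch_ne_zero (mem_ball_zero_iff.1 hy) n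
    unfold qpoch at h0 ⊢
    exact DifferentiableAt.div (by fun_prop) (by fun_prop) h0
  refine hf.eqOn_of_preconnected_of_frequently_eq hg (convex_ball _ _).isPreconnected
    (Metric.mem_ball_self one_pos) ?_ (mem_ball_zero_iff.2 hy)
  have ht : Filter.Tendsto (fun n : ℕ => ((n : ℂ))⁻¹) Filter.atTop (nhdsWithin 0 {0}ᶜ) := by
    rw [tendsto_nhdsWithin_iff]
    refine ⟨tendsto_inv_atTop_nhds_zero_nat, ?_⟩
    filter_upwards [Filter.eventually_gt_atTop 0] with n hn
    simp [hn.ne']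
  refine ht.frequently (Filter.frequently_atTop.2 fun N => ?_)
  obtain ⟨p, hpN, hp⟩ := Nat.exists_infinite_primes N
  refine ⟨p, hpN, ?_⟩
  have := congrArg (fun z : ℝ => (z : ℂ)) (ecoef_univ_prime p hp n)
  simp only [ofReal_ecoef, Complex.ofReal_div, Complex.ofReal_pow, ofReal_qpoch] at this
  simpa using this

theorem ecoef_univ_real (n : ℕ) {y : ℝ} (hy : |y| < 1) :
    ecoef Set.univ y n = y ^ n / qpoch y n := by
  have := ecoef_univ n (y := (y : ℂ)) (by simpa using hy)
  rw [← ofReal_ecoef, ← ofReal_qpoch] at this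
  exact_mod_cast this

lemma qpoch_real_ne_zero {y : ℝ} (hy : |y| < 1) (n : ℕ) : qpoch y n ≠ 0 := by
  intro h
  have := qpoch_ne_zero (y := (y : ℂ)) (by simpa using hy) n
  rw [← ofReal_qpoch, h] at this
  exact this rfl

/-- The functional equation of the series `∏ 1 / (1 - u y ^ i)` over `i ≥ 1`. -/
lemma rescale_eser_univ {y : ℝ} (hy : |y| < 1) :
    PowerSeries.rescale y (eser Set.univ y) = oneSub y * eser Set.univ y := by
  ext n
  rw [PowerSeries.coeff_rescale]
  cases n with
  | zero => rw [coeff_zero_oneSub_mul]; simp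
  | succ n =>
    rw [coeff_succ_oneSub_mul]
    simp only [eser, PowerSeries.coeff_mk]
    rw [ecoef_univ_real _ hy, ecoef_univ_real _ hy]
    have h2 := qpoch_real_ne_zero hy (n + 1)
    rw [qpoch_succ] at h2 ⊢
    have h3 := left_ne_zero_of_mul h2
    have h4 := right_ne_zero_of_mul h2
    field_simp
    ring

lemma rescale_spread (x : ℝ) (m : ℕ) (φ : PowerSeries ℝ) :
    PowerSeries.rescale x (spread m φ) = spread m (PowerSeries.rescale (x ^ m) φ) := by
  ext n
  rw [PowerSeries.coeff_rescale, coeff_spread, coeff_spread]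
  split_ifs with h
  · obtain ⟨k, rfl⟩ := h
    rcases Nat.eq_zero_or_pos m with rfl | hm
    · simp
    · rw [Nat.mul_div_cancel_left _ hm, PowerSeries.coeff_rescale, pow_mul]
  · rw [mul_zero]

lemma inv_card_pos : 0 < (Nat.card F : ℝ)⁻¹ := by
  have : 0 < Nat.card F := Nat.card_pos
  positivity

lemma inv_card_le_half : (Nat.card F : ℝ)⁻¹ ≤ 1 / 2 := by
  have h : (2 : ℝ) ≤ Nat.card F := by exact_mod_cast Finite.one_lt_card (α := F)
  rw [one_div]
  exact inv_anti₀ two_pos h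

lemma abs_inv_card_pow_lt_one {m : ℕ} (hm : m ≠ 0) : |((Nat.card F : ℝ)⁻¹) ^ m| < 1 := by
  rw [abs_of_nonneg (pow_nonneg inv_card_pos.le _)]
  refine pow_lt_one₀ inv_card_pos.le ?_ hm
  linarith [inv_card_le_half (F := F)]

/-- The Euler product for the zeta function of the affine line without the origin, obtained by
comparing the cycle index of the general linear group at `u` and at `u / q`. -/
lemma oneSub_mul_zeta {D : ℕ} (hD : 1 ≤ D) :
    EqUpTo D (oneSub ((Nat.card F : ℝ)⁻¹) * ∏ f ∈ irredGL F D,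
      spread f.natDegree (oneSub (((Nat.card F : ℝ)⁻¹) ^ f.natDegree))) (oneSub 1) := by
  set x := (Nat.card F : ℝ)⁻¹ with hx
  set Z := ∏ f ∈ irredGL F D, spread f.natDegree (oneSub (x ^ f.natDegree)) with hZ
  have h1 : PowerSeries.rescale x (glProduct Set.univ F D) = Z * glProduct Set.univ F D := by
    rw [glProduct, map_prod, hZ, ← Finset.prod_mul_distrib]
    refine Finset.prod_congr rfl fun f hf => ?_
    have hm : f.natDegree ≠ 0 := (mem_irredGL.1 hf).2.1.2.natDegree_pos.ne'
    rw [rescale_spread, rescale_eser_univ (abs_inv_card_pow_lt_one hm), spread_mul hm]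
  have h2 : EqUpTo D (PowerSeries.rescale x (glProduct Set.univ F D)) (geoSeries x) := by
    intro n hn
    rw [PowerSeries.coeff_rescale, glProduct_univ hD n hn]
    simp [geoSeries]
  have h3 : EqUpTo D (Z * geoSeries 1) (geoSeries x) :=
    ((EqUpTo.refl D Z).mul (glProduct_univ (F := F) hD).symm).trans (h1 ▸ h2)
  have h4 := ((EqUpTo.refl D (oneSub x)).mul h3).mul (EqUpTo.refl D (oneSub 1))
  rw [oneSub_mul_geoSeries, one_mul] at h4
  have h5 : oneSub x * (Z * geoSeries 1) * oneSub 1 = oneSub x * Z := by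
    rw [mul_assoc, mul_assoc, mul_comm (geoSeries 1), oneSub_mul_geoSeries, mul_one]
  rwa [h5] at h4

/-- The normalised local factor `(1 - y u) ∑ u ^ |p| w_p(y)`. -/
noncomputable def gser (S : Set AnyPartition) (y : ℝ) : PowerSeries ℝ := oneSub y * eser S y

/-- The generating function of the differences of consecutive proportions, as an Euler product
truncated at degree `D`. -/
noncomputable def wser (S : Set AnyPartition) (F : Type) [Field F] [Finite F] (D : ℕ) :
    PowerSeries ℝ :=
  oneSub ((Nat.card F : ℝ)⁻¹) * ∏ f ∈ irredGL F D,
    spread f.natDegree (gser S (((Nat.card F : ℝ)⁻¹) ^ f.natDegree))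

/-- Modulo `u ^ (D + 1)`, the generating function of the proportions is the series `wser` divided
by `1 - u`. -/
theorem glProb_eq_sum (Λ : Set AnyPartition) {D d : ℕ} (hD : 1 ≤ D) (hd : d ≤ D) :
    glProb Λ d F = ∑ n ∈ Finset.range (d + 1), PowerSeries.coeff n (wser (withEmpty Λ) F D) := by
  rw [glProb_eq_coeff Λ hD hd, ← coeff_geoSeries_one_mul]
  have h1 : wser (withEmpty Λ) F D = (oneSub ((Nat.card F : ℝ)⁻¹) * ∏ f ∈ irredGL F D,
      spread f.natDegree (oneSub (((Nat.card F : ℝ)⁻¹) ^ f.natDegree))) *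
      glProduct (withEmpty Λ) F D := by
    rw [wser, glProduct, mul_assoc, ← Finset.prod_mul_distrib]
    congr 1
    refine Finset.prod_congr rfl fun f hf => ?_
    rw [gser, spread_mul (mem_irredGL.1 hf).2.1.2.natDegree_pos.ne']
  have h2 : EqUpTo D (geoSeries 1 * wser (withEmpty Λ) F D) (glProduct (withEmpty Λ) F D) := by
    rw [h1]
    have := (EqUpTo.refl D (geoSeries 1)).mul
      ((oneSub_mul_zeta (F := F) hD).mul (EqUpTo.refl D (glProduct (withEmpty Λ) F D)))
    rwa [← mul_assoc _ (oneSub 1), mul_comm (geoSeries 1) (oneSub 1), oneSub_mul_geoSeries,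
      one_mul] at this
  exact (h2 d hd).symm

end GLIndex

/-! ### Estimates for the local factors -/

section Bounds

variable {y : ℝ}

lemma wt_nonneg (p : AnyPartition) (hy0 : 0 ≤ y) (hy1 : y ≤ 1) : 0 ≤ wt p y :=
  div_nonneg (pow_nonneg hy0 _) (Finset.prod_nonneg fun _ _ => sub_nonneg.2 (pow_le_one₀ hy0 hy1))

lemma ecoef_nonneg (S : Set AnyPartition) (hy0 : 0 ≤ y) (hy1 : y ≤ 1) (j : ℕ) :
    0 ≤ ecoef S y j := by
  refine Finset.sum_nonneg fun p _ => ?_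
  split_ifs
  exacts [wt_nonneg _ hy0 hy1, le_rfl]

lemma ecoef_le_univ (S : Set AnyPartition) (hy0 : 0 ≤ y) (hy1 : y ≤ 1) (j : ℕ) :
    ecoef S y j ≤ ecoef Set.univ y j := by
  refine Finset.sum_le_sum fun p _ => ?_
  rw [if_pos (Set.mem_univ _)]
  split_ifs
  exacts [le_rfl, wt_nonneg _ hy0 hy1]

lemma onePart_le_ecoef {S : Set AnyPartition} (hy0 : 0 ≤ y) (hy1 : y ≤ 1) {j : ℕ} (hj : 0 < j)
    (hS : onePart j ∈ S) : y ^ j / (1 - y) ≤ ecoef S y j := by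
  rw [← wt_onePart hj y, ecoef]
  refine le_trans (le_of_eq ?_) (Finset.single_le_sum (fun p _ => ?_)
    (Finset.mem_univ (Nat.Partition.indiscrete j)))
  · rw [if_pos hS]
  · split_ifs
    exacts [wt_nonneg _ hy0 hy1, le_rfl]

/-- The product `(1 - y ^ 2) ⋯ (1 - y ^ (n + 1))`. -/
noncomputable def tailProd (y : ℝ) (n : ℕ) : ℝ := ∏ i ∈ Finset.range n, (1 - y ^ (i + 2))

lemma qpoch_succ_eq (y : ℝ) (n : ℕ) : qpoch y (n + 1) = (1 - y) * tailProd y n := by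
  rw [qpoch, Finset.prod_range_succ', mul_comm]
  simp [tailProd]

lemma tailProd_le_one (hy0 : 0 ≤ y) (hy1 : y ≤ 1) (n : ℕ) : tailProd y n ≤ 1 :=
  Finset.prod_le_one (fun _ _ => sub_nonneg.2 (pow_le_one₀ hy0 hy1))
    fun _ _ => sub_le_self _ (pow_nonneg hy0 _)

lemma one_sub_le_tailProd (hy0 : 0 ≤ y) (hy : y ≤ 1 / 2) (n : ℕ) :
    1 - 2 * y ^ 2 ≤ tailProd y n := by
  -- the stronger bound comes from `∏ (1 - a i) ≥ 1 - ∑ a i` and passes through the induction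
  suffices h : 1 - 2 * y ^ 2 + 2 * y ^ (n + 2) ≤ tailProd y n by
    have := pow_nonneg hy0 (n + 2)
    linarith
  induction n with
  | zero => simp [tailProd]
  | succ n ih =>
    have h1 : tailProd y (n + 1) = tailProd y n * (1 - y ^ (n + 2)) := Finset.prod_range_succ _ _
    have h2 := tailProd_le_one hy0 (by linarith) n
    have h3 := pow_nonneg hy0 (n + 2)
    rw [h1, pow_succ y (n + 2)]
    nlinarith [mul_le_mul_of_nonneg_left hy h3, mul_le_mul_of_nonneg_right h2 h3]

lemma ecoef_univ_succ (hy0 : 0 ≤ y) (hy1 : y < 1) (n : ℕ) :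
    ecoef Set.univ y (n + 1) = y ^ (n + 1) / (1 - y) / tailProd y n := by
  rw [ecoef_univ_real _ (by rwa [abs_of_nonneg hy0]), qpoch_succ_eq, div_div]

/-- Up to a smaller term, the weights of all partitions of `n + 1` add up to the weight of the
one-part partition. -/
lemma ecoef_univ_succ_le (hy0 : 0 ≤ y) (hy : y ≤ 1 / 2) (n : ℕ) :
    ecoef Set.univ y (n + 1) ≤ y ^ (n + 1) / (1 - y) + 8 * y ^ (n + 3) := by
  rw [ecoef_univ_succ hy0 (by linarith)]
  have h1 := one_sub_le_tailProd hy0 hy n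
  have h2 : 1 / 2 ≤ tailProd y n := by nlinarith
  have h3 : 0 < tailProd y n := by linarith
  have h4 : 0 ≤ y ^ (n + 1) := pow_nonneg hy0 _
  have h5 : y ^ (n + 1) / (1 - y) ≤ 2 * y ^ (n + 1) := by
    rw [div_le_iff₀ (by linarith)]
    nlinarith
  have h6 : 0 ≤ y ^ (n + 1) / (1 - y) := div_nonneg h4 (by linarith)
  rw [div_le_iff₀ h3]
  have h7 : y ^ (n + 3) = y ^ (n + 1) * y ^ 2 := by ring
  rw [h7]
  set a := y ^ (n + 1)
  set b := a / (1 - y)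
  have h8 : b * (1 - tailProd y n) ≤ 2 * a * (2 * y ^ 2) :=
    mul_le_mul h5 (by linarith) (by linarith [tailProd_le_one hy0 (by linarith) n]) (by linarith)
  nlinarith [mul_nonneg h4 (sq_nonneg y)]

lemma ecoef_univ_succ_le' (hy0 : 0 ≤ y) (hy : y ≤ 1 / 2) (n : ℕ) :
    ecoef Set.univ y (n + 1) ≤ 4 * y ^ (n + 1) := by
  have h1 := ecoef_univ_succ_le hy0 hy n
  have h4 : 0 ≤ y ^ (n + 1) := pow_nonneg hy0 _
  have h5 : y ^ (n + 1) / (1 - y) ≤ 2 * y ^ (n + 1) := by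
    rw [div_le_iff₀ (by linarith)]
    nlinarith
  have h7 : y ^ (n + 3) = y ^ (n + 1) * y ^ 2 := by ring
  have h8 : y ^ 2 ≤ 1 / 4 := by nlinarith
  nlinarith [mul_le_mul_of_nonneg_left h8 h4]

lemma ecoef_univ_one (hy0 : 0 ≤ y) (hy1 : y < 1) : ecoef Set.univ y 1 = y / (1 - y) := by
  rw [ecoef_univ_succ hy0 hy1 0]
  simp [tailProd]

lemma coeff_zero_gser (S : Set AnyPartition) (hS : ∀ p : AnyPartition, p.1 = 0 → p ∈ S) (y : ℝ) :
    PowerSeries.coeff 0 (gser S y) = 1 := by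
  rw [gser, coeff_zero_oneSub_mul, eser, PowerSeries.coeff_mk, ecoef_zero hS]

lemma coeff_succ_gser (S : Set AnyPartition) (y : ℝ) (n : ℕ) :
    PowerSeries.coeff (n + 1) (gser S y) = ecoef S y (n + 1) - y * ecoef S y n := by
  rw [gser, coeff_succ_oneSub_mul]
  simp [eser]

/-- The coefficient of `u ^ j` in the normalised local factor is of order `y ^ j`. If the one-part
partitions of `j` and of `j - 1` both belong to `S`, their leading contributions cancel and the
order is `y ^ (j + 1)`. -/
lemma abs_coeff_gser_le {S : Set AnyPartition} (hS : ∀ p : AnyPartition, p.1 = 0 → p ∈ S) {k : ℕ}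
    (hk : ∀ i, 0 < i → i < k → onePart i ∈ S) (hy0 : 0 ≤ y) (hy : y ≤ 1 / 2) {j : ℕ} (hj : 0 < j) :
    |PowerSeries.coeff j (gser S y)| ≤ 4 * y ^ (j + if j < k then 1 else 0) := by
  have hy1 : y ≤ 1 := by linarith
  obtain ⟨n, rfl⟩ : ∃ n, j = n + 1 := ⟨j - 1, by omega⟩
  rw [coeff_succ_gser]
  have hn := pow_nonneg hy0 n
  have hn1 := pow_nonneg hy0 (n + 1)
  split_ifs with hjk
  · have hl := onePart_le_ecoef (j := n + 1) hy0 hy1 hj (hk _ hj hjk)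
    have hu := (ecoef_le_univ S hy0 hy1 (n + 1))
    cases n with
    | zero =>
      rw [ecoef_univ_one hy0 (by linarith)] at hu
      simp only [zero_add, pow_one] at hl hu ⊢
      rw [le_antisymm hu hl, ecoef_zero hS]
      have h1 : y / (1 - y) - y * 1 = y ^ 2 / (1 - y) := by
        have : 1 - y ≠ 0 := by linarith
        field_simp
        ring
      rw [h1, abs_of_nonneg (div_nonneg (sq_nonneg y) (by linarith)), div_le_iff₀ (by linarith)]
      change y ^ 2 ≤ 4 * y ^ 2 * (1 - y)
      nlinarith [sq_nonneg y]
    | succ n =>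
      have hu' := hu.trans (ecoef_univ_succ_le hy0 hy (n + 1))
      have hl2 := onePart_le_ecoef (j := n + 1) hy0 hy1 (by omega)
        (hk (n + 1) (by omega) (by omega))
      have hu2 := (ecoef_le_univ S hy0 hy1 (n + 1)).trans (ecoef_univ_succ_le hy0 hy n)
      have hyl := mul_le_mul_of_nonneg_left hl2 hy0
      have hyu := mul_le_mul_of_nonneg_left hu2 hy0
      have e1 : y * (y ^ (n + 1) / (1 - y)) = y ^ (n + 1 + 1) / (1 - y) := by ring
      have e2 : y * (y ^ (n + 1) / (1 - y) + 8 * y ^ (n + 3)) =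
          y ^ (n + 1 + 1) / (1 - y) + 8 * y ^ (n + 4) := by ring
      rw [e1] at hyl
      rw [e2] at hyu
      have e3 : y ^ (n + 4) = y ^ (n + 3) * y := by ring
      have e4 : y ^ (n + 1 + 3) = y ^ (n + 3) * y := by ring
      have e5 : y ^ (n + 1 + 1 + 1) = y ^ (n + 3) := by ring
      rw [e3] at hyu
      rw [e4] at hu'
      have h3 := pow_nonneg hy0 (n + 3)
      rw [abs_le, e5]
      constructor <;> nlinarith
  · rw [add_zero, abs_le]
    have h1 := ecoef_nonneg S hy0 hy1 (n + 1)
    have h2 := (ecoef_le_univ S hy0 hy1 (n + 1)).trans (ecoef_univ_succ_le' hy0 hy n)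
    have h3 := mul_nonneg hy0 (ecoef_nonneg S hy0 hy1 n)
    have h4 : y * ecoef S y n ≤ 4 * y ^ (n + 1) := by
      rw [pow_succ, mul_comm y, ← mul_assoc]
      refine mul_le_mul_of_nonneg_right ?_ hy0
      cases n with
      | zero => rw [ecoef_zero hS]; norm_num
      | succ n => exact (ecoef_le_univ S hy0 hy1 (n + 1)).trans (ecoef_univ_succ_le' hy0 hy n)
    constructor <;> linarith

end Bounds

/-! ### Weighted norms of power series -/

section Norms

/-- The weighted `ℓ¹` norm of the polynomial formed by the first `N` terms of a power series. It is
submultiplicative. -/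
noncomputable def pnorm (ρ : ℝ) (N : ℕ) (φ : PowerSeries ℝ) : ℝ :=
  ∑ n ∈ Finset.range N, |PowerSeries.coeff n φ| * ρ ^ n

lemma pnorm_nonneg {ρ : ℝ} (hρ : 0 ≤ ρ) (N : ℕ) (φ : PowerSeries ℝ) : 0 ≤ pnorm ρ N φ :=
  Finset.sum_nonneg fun _ _ => mul_nonneg (abs_nonneg _) (pow_nonneg hρ _)

lemma pnorm_mul_le {ρ : ℝ} (hρ : 0 ≤ ρ) (N : ℕ) (φ ψ : PowerSeries ℝ) :
    pnorm ρ N (φ * ψ) ≤ pnorm ρ N φ * pnorm ρ N ψ := by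
  have h1 : ∀ n, |PowerSeries.coeff n (φ * ψ)| * ρ ^ n ≤
      ∑ p ∈ Finset.HasAntidiagonal.antidiagonal n, (|PowerSeries.coeff p.1 φ| * ρ ^ p.1) *
        (|PowerSeries.coeff p.2 ψ| * ρ ^ p.2) := by
    intro n
    rw [PowerSeries.coeff_mul]
    refine (mul_le_mul_of_nonneg_right (Finset.abs_sum_le_sum_abs _ _) (pow_nonneg hρ _)).trans ?_
    rw [Finset.sum_mul]
    refine Finset.sum_le_sum fun p hp => le_of_eq ?_
    rw [← Finset.HasAntidiagonal.mem_antidiagonal.1 hp, abs_mul, pow_add]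
    ring
  refine (Finset.sum_le_sum fun n _ => h1 n).trans ?_
  rw [pnorm, pnorm, Finset.sum_mul_sum, ← Finset.sum_product', Finset.sum_sigma']
  have hinj : Set.InjOn (fun x : Σ _ : ℕ, ℕ × ℕ => x.2)
      ((Finset.range N).sigma fun n => Finset.HasAntidiagonal.antidiagonal n :
        Set (Σ _ : ℕ, ℕ × ℕ)) := by
    rintro ⟨a, p⟩ ha ⟨b, p'⟩ hb (rfl : p = p')
    have ha' := Finset.HasAntidiagonal.mem_antidiagonal.1 (Finset.mem_sigma.1 ha).2
    have hb' := Finset.HasAntidiagonal.mem_antidiagonal.1 (Finset.mem_sigma.1 hb).2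
    simp only at ha' hb'
    rw [← ha', ← hb']
  rw [← Finset.sum_image (f := fun p : ℕ × ℕ => (|PowerSeries.coeff p.1 φ| * ρ ^ p.1) *
        (|PowerSeries.coeff p.2 ψ| * ρ ^ p.2)) hinj]
  refine Finset.sum_le_sum_of_subset_of_nonneg ?_ fun p _ _ => mul_nonneg
    (mul_nonneg (abs_nonneg _) (pow_nonneg hρ _)) (mul_nonneg (abs_nonneg _) (pow_nonneg hρ _))
  intro p hp
  obtain ⟨⟨n, p⟩, hx, rfl⟩ := Finset.mem_image.1 hp
  obtain ⟨h1, h2⟩ := Finset.mem_sigma.1 hx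
  have h1 := Finset.mem_range.1 h1
  have h2 := Finset.HasAntidiagonal.mem_antidiagonal.1 h2
  simp only at h1 h2
  exact Finset.mem_product.2 ⟨Finset.mem_range.2 (by simp only; omega),
    Finset.mem_range.2 (by simp only; omega)⟩

lemma pnorm_one {ρ : ℝ} (N : ℕ) : pnorm ρ N 1 ≤ 1 := by
  rw [pnorm]
  simp only [PowerSeries.coeff_one]
  cases N with
  | zero => simp
  | succ N =>
    rw [Finset.sum_range_succ']
    simp

lemma pnorm_prod_le {ι : Type*} {ρ : ℝ} (hρ : 0 ≤ ρ) (N : ℕ) (s : Finset ι)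
    (φ : ι → PowerSeries ℝ) : pnorm ρ N (∏ i ∈ s, φ i) ≤ ∏ i ∈ s, pnorm ρ N (φ i) := by
  classical
  induction s using Finset.induction_on with
  | empty => simpa using pnorm_one N
  | insert i s hi ih =>
    rw [Finset.prod_insert hi, Finset.prod_insert hi]
    exact (pnorm_mul_le hρ N _ _).trans (mul_le_mul_of_nonneg_left ih (pnorm_nonneg hρ _ _))

lemma pnorm_spread_le {ρ : ℝ} (hρ : 0 ≤ ρ) (N m : ℕ) (φ : PowerSeries ℝ) :
    pnorm ρ N (spread m φ) ≤ pnorm (ρ ^ m) N φ := by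
  rw [pnorm, pnorm]
  have h1 : ∀ n ∈ Finset.range N, |PowerSeries.coeff n (spread m φ)| * ρ ^ n =
      if m ∣ n then |PowerSeries.coeff (n / m) φ| * (ρ ^ m) ^ (n / m) else 0 := by
    intro n _
    rw [coeff_spread]
    split_ifs with h
    · rw [← pow_mul, Nat.mul_div_cancel' h]
    · simp
  rw [Finset.sum_congr rfl h1, ← Finset.sum_filter]
  have hinj : Set.InjOn (fun n => n / m) ((Finset.range N).filter (m ∣ ·) : Set ℕ) := by
    intro a ha b hb hab
    have ha' := (Finset.mem_filter.1 ha).2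
    have hb' := (Finset.mem_filter.1 hb).2
    rw [← Nat.mul_div_cancel' ha', ← Nat.mul_div_cancel' hb']
    exact congrArg (m * ·) hab
  rw [← Finset.sum_image (f := fun j => |PowerSeries.coeff j φ| * (ρ ^ m) ^ j) hinj]
  refine Finset.sum_le_sum_of_subset_of_nonneg ?_ fun _ _ _ =>
    mul_nonneg (abs_nonneg _) (pow_nonneg (pow_nonneg hρ _) _)
  intro j hj
  obtain ⟨n, hn, rfl⟩ := Finset.mem_image.1 hj
  have := Finset.mem_range.1 (Finset.mem_filter.1 hn).1
  exact Finset.mem_range.2 (lt_of_le_of_lt (Nat.div_le_self _ _) this)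

end Norms

/-! ### The Euler product in a large disc, uniformly in the field -/

section Uniform

variable {F : Type} [Field F] [Finite F]

lemma card_irredGL_degree_le (D m : ℕ) :
    ((irredGL F D).filter fun f => f.natDegree = m).card ≤ Nat.card F ^ m := by
  classical
  have := Fintype.ofFinite F
  have h := Finset.card_le_card_of_injOn (s := (irredGL F D).filter fun f => f.natDegree = m)
    (t := (Finset.univ : Finset (Fin m → F))) (fun f i => f.coeff i) (fun _ _ => Finset.mem_univ _)
    (by
      intro f hf g hg hfg
      have hf' := Finset.mem_filter.1 hf
      have hg' := Finset.mem_filter.1 hg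
      have hfm := (mem_irredGL.1 hf'.1).2.1.1
      have hgm := (mem_irredGL.1 hg'.1).2.1.1
      ext n
      rcases lt_trichotomy n m with h | h | h
      · exact congrFun hfg ⟨n, h⟩
      · subst h
        have h1 := hfm.coeff_natDegree
        have h2 := hgm.coeff_natDegree
        rw [hf'.2] at h1
        rw [hg'.2] at h2
        rw [h1, h2]
      · rw [Polynomial.coeff_eq_zero_of_natDegree_lt (hf'.2 ▸ h),
          Polynomial.coeff_eq_zero_of_natDegree_lt (hg'.2 ▸ h)])
  simpa [Nat.card_eq_fintype_card] using h

/-- A sum over the monic irreducible polynomials of a sufficiently small function of the degree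
is bounded uniformly in the field. -/
lemma sum_irredGL_rpow_le {η : ℝ} (hη : 0 < η) (D : ℕ) :
    ∑ f ∈ irredGL F D, (((Nat.card F : ℝ)⁻¹) ^ f.natDegree) ^ (1 + η) ≤
      (1 - (1 / 2 : ℝ) ^ η)⁻¹ := by
  set x := (Nat.card F : ℝ)⁻¹ with hx
  have hx0 : 0 < x := inv_card_pos
  have hr1 : (1 / 2 : ℝ) ^ η < 1 := Real.rpow_lt_one (by norm_num) (by norm_num) hη
  have hr0 : 0 ≤ (1 / 2 : ℝ) ^ η := by positivity
  rw [← Finset.sum_fiberwise_of_maps_to (t := Finset.range (D + 1)) (g := Polynomial.natDegree)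
    fun f hf => Finset.mem_range.2 (Nat.lt_succ_of_le (mem_irredGL.1 hf).2.2)]
  calc _ ≤ ∑ m ∈ Finset.range (D + 1), ((1 / 2 : ℝ) ^ η) ^ m := by
        refine Finset.sum_le_sum fun m _ => ?_
        rw [Finset.sum_congr rfl (g := fun _ => (x ^ m) ^ (1 + η)) fun f hf => by
          rw [(Finset.mem_filter.1 hf).2], Finset.sum_const, nsmul_eq_mul]
        have h1 : (((irredGL F D).filter fun f => f.natDegree = m).card : ℝ) ≤ x⁻¹ ^ m := by
          rw [hx, inv_inv]; exact_mod_cast card_irredGL_degree_le D m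
        have h2 : (x ^ m) ^ (1 + η) = x ^ m * (x ^ η) ^ m := by
          rw [Real.rpow_add (pow_pos hx0 m), Real.rpow_one, ← Real.rpow_natCast x m,
            ← Real.rpow_mul hx0.le, mul_comm (m : ℝ) η, Real.rpow_mul hx0.le,
            Real.rpow_natCast, Real.rpow_natCast]
        rw [h2]
        calc _ ≤ x⁻¹ ^ m * (x ^ m * (x ^ η) ^ m) := by gcongr
          _ = (x ^ η) ^ m := by
            rw [← mul_assoc, ← mul_pow, inv_mul_cancel₀ hx0.ne', one_pow, one_mul]
          _ ≤ _ := by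
            gcongr
            exact inv_card_le_half
    _ ≤ _ := by
        have := (summable_geometric_of_lt_one hr0 hr1).sum_le_tsum (Finset.range (D + 1))
          (fun _ _ => pow_nonneg hr0 _)
        rwa [tsum_geometric_of_lt_one hr0 hr1] at this

/-- The local factors at `u = y ^ (-s)`. The terms of index less than `k` have order at least
`y ^ (2 - s)` by the cancellation in `abs_coeff_gser_le`, the others have order at least
`y ^ (k (1 - s))`; both exponents exceed `1`. -/
lemma exists_pnorm_gser_le {S : Set AnyPartition} (hS : ∀ p : AnyPartition, p.1 = 0 → p ∈ S)
    {k : ℕ} (hk : ∀ i, 0 < i → i < k → onePart i ∈ S) {s : ℝ} (hs : 1 < k * (1 - s)) :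
    ∃ C η : ℝ, 0 ≤ C ∧ 0 < η ∧ ∀ y : ℝ, 0 < y → y ≤ 1 / 2 → ∀ N,
      pnorm (y ^ (-s)) N (gser S y) ≤ 1 + C * y ^ (1 + η) := by
  set θ := 1 - s with hθ
  have hk0 : (0 : ℝ) ≤ k := Nat.cast_nonneg k
  have hθ0 : 0 < θ := by
    by_contra h
    push Not at h
    nlinarith
  -- the excess over `1` of the two exponents `1 + θ` and `k * θ`
  set η := min θ (k * θ - 1) with hη
  have hη0 : 0 < η := lt_min hθ0 (by linarith)
  set r := (1 / 2 : ℝ) ^ θ with hr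
  have hr1 : r < 1 := Real.rpow_lt_one (by norm_num) (by norm_num) hθ0
  have hr0 : 0 < r := by positivity
  refine ⟨4 * (r ^ k)⁻¹ * (1 - r)⁻¹, η, by
    have : 0 < 1 - r := by linarith
    positivity, hη0, fun y hy0 hy N => ?_⟩
  have hy1 : y ≤ 1 := by linarith
  have hterm : ∀ j, 0 < j → |PowerSeries.coeff j (gser S y)| * (y ^ (-s)) ^ j ≤
      4 * (r ^ k)⁻¹ * y ^ (1 + η) * r ^ j := by
    intro j hj
    have h1 := abs_coeff_gser_le hS hk hy0.le hy hj
    have h2 : y ^ (j + if j < k then 1 else 0) * (y ^ (-s)) ^ j =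
        y ^ (θ * j + if j < k then 1 else 0) := by
      rw [← Real.rpow_natCast y, ← Real.rpow_natCast (y ^ (-s)), ← Real.rpow_mul hy0.le,
        ← Real.rpow_add hy0]
      congr 1
      push_cast
      rw [hθ]
      ring
    have h3 : y ^ (θ * j + if j < k then (1 : ℝ) else 0) ≤ y ^ (1 + η) * ((r ^ k)⁻¹ * r ^ j) := by
      split_ifs with hjk
      · have h4 : y ^ (θ * j + 1) ≤ y ^ (1 + η) := by
          refine Real.rpow_le_rpow_of_exponent_ge hy0 hy1 ?_
          have : (1 : ℝ) ≤ j := by exact_mod_cast hj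
          have : η ≤ θ := min_le_left _ _
          nlinarith
        have h5 : 1 ≤ (r ^ k)⁻¹ * r ^ j := by
          rw [inv_mul_eq_div, one_le_div (by positivity)]
          exact pow_le_pow_of_le_one hr0.le hr1.le hjk.le
        calc _ ≤ y ^ (1 + η) * 1 := by rwa [mul_one]
          _ ≤ _ := by gcongr
      · have hjk' : k ≤ j := not_lt.1 hjk
        have h4 : y ^ (θ * j + 0) = y ^ (θ * k) * (y ^ θ) ^ (j - k) := by
          rw [← Real.rpow_natCast (y ^ θ), ← Real.rpow_mul hy0.le, ← Real.rpow_add hy0,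
            Nat.cast_sub hjk']
          congr 1
          ring
        have h5 : (r ^ k)⁻¹ * r ^ j = r ^ (j - k) := by
          rw [inv_mul_eq_iff_eq_mul₀ (by positivity), ← pow_add, Nat.add_sub_cancel' hjk']
        rw [h4, h5]
        have h6 : y ^ (θ * k) ≤ y ^ (1 + η) := by
          refine Real.rpow_le_rpow_of_exponent_ge hy0 hy1 ?_
          have : η ≤ k * θ - 1 := min_le_right _ _
          linarith
        have h7 : y ^ θ ≤ r := Real.rpow_le_rpow hy0.le hy hθ0.le
        gcongr
    calc _ ≤ 4 * y ^ (j + if j < k then 1 else 0) * (y ^ (-s)) ^ j := by gcongr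
      _ = 4 * (y ^ (j + if j < k then 1 else 0) * (y ^ (-s)) ^ j) := by ring
      _ ≤ 4 * (y ^ (1 + η) * ((r ^ k)⁻¹ * r ^ j)) := by rw [h2]; gcongr
      _ = _ := by ring
  have hrhs : 0 ≤ 4 * (r ^ k)⁻¹ * (1 - r)⁻¹ * y ^ (1 + η) := by
    have : 0 < 1 - r := by linarith
    positivity
  cases N with
  | zero => simp only [pnorm, Finset.range_zero, Finset.sum_empty]; linarith
  | succ N =>
    rw [pnorm, Finset.sum_range_succ', coeff_zero_gser S hS, add_comm]
    simp only [abs_one, pow_zero, mul_one]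
    gcongr
    calc _ ≤ ∑ j ∈ Finset.range N, 4 * (r ^ k)⁻¹ * y ^ (1 + η) * r ^ j := by
          refine Finset.sum_le_sum fun j _ => (hterm (j + 1) j.succ_pos).trans ?_
          have := pow_le_pow_of_le_one hr0.le hr1.le (Nat.le_succ j)
          gcongr
      _ = 4 * (r ^ k)⁻¹ * y ^ (1 + η) * ∑ j ∈ Finset.range N, r ^ j := by rw [Finset.mul_sum]
      _ ≤ 4 * (r ^ k)⁻¹ * y ^ (1 + η) * (1 - r)⁻¹ := by
          gcongr
          have := (summable_geometric_of_lt_one hr0.le hr1).sum_le_tsum (Finset.range N)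
            (fun _ _ => pow_nonneg hr0.le _)
          rwa [tsum_geometric_of_lt_one hr0.le hr1] at this
      _ = _ := by ring

/-- The Euler product converges absolutely for `|u| ≤ q ^ s`, uniformly in the field, provided
that `s < 1 - 1 / k`. -/
theorem exists_pnorm_wser_le {S : Set AnyPartition} (hS : ∀ p : AnyPartition, p.1 = 0 → p ∈ S)
    {k : ℕ} (hk : ∀ i, 0 < i → i < k → onePart i ∈ S) {s : ℝ} (hs : 1 < k * (1 - s)) :
    ∃ C : ℝ, ∀ (F : Type) [Field F] [Finite F] (D N : ℕ),
      pnorm ((Nat.card F : ℝ) ^ s) N (wser S F D) ≤ C := by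
  obtain ⟨C, η, hC, hη, h⟩ := exists_pnorm_gser_le hS hk hs
  refine ⟨2 * Real.exp (C * (1 - (1 / 2 : ℝ) ^ η)⁻¹), fun F _ _ D N => ?_⟩
  set q := (Nat.card F : ℝ) with hq
  have hq0 : 0 < q := by rw [hq]; exact_mod_cast Nat.card_pos
  have hq1 : 1 ≤ q := by rw [hq]; exact_mod_cast Nat.card_pos
  have hs1 : s ≤ 1 := by
    by_contra hs'
    push Not at hs'
    have : (0 : ℝ) ≤ k := Nat.cast_nonneg k
    nlinarith
  have hρ : 0 ≤ q ^ s := by positivity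
  have h1 : pnorm (q ^ s) N (oneSub q⁻¹) ≤ 2 := by
    have hc : ∀ n, PowerSeries.coeff (n + 2) (oneSub q⁻¹) = 0 := by
      intro n
      simp [oneSub, PowerSeries.coeff_one]
    have hle : pnorm (q ^ s) N (oneSub q⁻¹) ≤ pnorm (q ^ s) (N + 2) (oneSub q⁻¹) :=
      Finset.sum_le_sum_of_subset_of_nonneg (Finset.range_subset_range.2 (by omega)) fun _ _ _ =>
        mul_nonneg (abs_nonneg _) (pow_nonneg hρ _)
    refine hle.trans ?_
    rw [pnorm, Finset.sum_range_succ', Finset.sum_range_succ']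
    simp only [add_assoc, Nat.reduceAdd, hc]
    have h0 : PowerSeries.coeff 0 (oneSub q⁻¹) = 1 := by simp [oneSub]
    have h1 : PowerSeries.coeff 1 (oneSub q⁻¹) = -q⁻¹ := by
      simp [oneSub, PowerSeries.coeff_one]
    simp only [zero_add, h0, h1, abs_zero, zero_mul, Finset.sum_const_zero, abs_neg, pow_one,
      abs_one, pow_zero, mul_one]
    rw [abs_of_pos (inv_pos.2 hq0)]
    have : q⁻¹ * q ^ s ≤ 1 := by
      rw [inv_mul_le_iff₀ hq0, mul_one]
      calc q ^ s ≤ q ^ (1 : ℝ) := Real.rpow_le_rpow_of_exponent_le hq1 hs1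
        _ = q := Real.rpow_one q
    linarith
  have h2 : ∏ f ∈ irredGL F D, pnorm (q ^ s) N (spread f.natDegree (gser S (q⁻¹ ^ f.natDegree))) ≤
      Real.exp (C * (1 - (1 / 2 : ℝ) ^ η)⁻¹) := by
    calc _ ≤ ∏ f ∈ irredGL F D, Real.exp (C * (q⁻¹ ^ f.natDegree) ^ (1 + η)) := by
          refine Finset.prod_le_prod (fun _ _ => pnorm_nonneg hρ _ _) fun f hf => ?_
          have hm : f.natDegree ≠ 0 := (mem_irredGL.1 hf).2.1.2.natDegree_pos.ne'
          have hy0 : 0 < q⁻¹ ^ f.natDegree := pow_pos (inv_pos.2 hq0) _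
          have hy : q⁻¹ ^ f.natDegree ≤ 1 / 2 := by
            have hx := inv_card_le_half (F := F)
            calc q⁻¹ ^ f.natDegree ≤ q⁻¹ ^ 1 := pow_le_pow_of_le_one (inv_pos.2 hq0).le
                  (by rw [← hq] at hx; linarith) (Nat.one_le_iff_ne_zero.2 hm)
              _ ≤ 1 / 2 := by rw [pow_one]; exact hx
          refine (pnorm_spread_le hρ N _ _).trans ?_
          have he : (q ^ s) ^ f.natDegree = (q⁻¹ ^ f.natDegree) ^ (-s) := by
            rw [inv_pow, Real.inv_rpow (pow_pos hq0 _).le, Real.rpow_neg (pow_pos hq0 _).le,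
              inv_inv, ← Real.rpow_natCast q, ← Real.rpow_natCast (q ^ s), ← Real.rpow_mul hq0.le,
              ← Real.rpow_mul hq0.le, mul_comm]
          rw [he]
          refine (h _ hy0 hy N).trans ?_
          rw [add_comm]
          exact Real.add_one_le_exp _
      _ = Real.exp (C * ∑ f ∈ irredGL F D, (q⁻¹ ^ f.natDegree) ^ (1 + η)) := by
          rw [← Real.exp_sum, Finset.mul_sum]
      _ ≤ _ := by
          gcongr
          exact sum_irredGL_rpow_le hη D
  calc _ ≤ pnorm (q ^ s) N (oneSub q⁻¹) * pnorm (q ^ s) N (∏ f ∈ irredGL F D,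
        spread f.natDegree (gser S (q⁻¹ ^ f.natDegree))) := pnorm_mul_le hρ N _ _
    _ ≤ 2 * Real.exp (C * (1 - (1 / 2 : ℝ) ^ η)⁻¹) := by
        refine mul_le_mul h1 ((pnorm_prod_le hρ N _ _).trans h2) (pnorm_nonneg hρ _ _) (by norm_num)

end Uniform

/-! ### Evaluating power series -/

section Evaluation

lemma hasSum_coeff_mul {a b : PowerSeries ℝ} {x A B : ℝ}
    (ha : HasSum (fun j => PowerSeries.coeff j a * x ^ j) A)
    (hb : HasSum (fun j => PowerSeries.coeff j b * x ^ j) B) :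
    HasSum (fun j => PowerSeries.coeff j (a * b) * x ^ j) (A * B) := by
  have ha' := ha.summable.norm
  have hb' := hb.summable.norm
  have h := tsum_mul_tsum_eq_tsum_sum_antidiagonal_of_summable_norm ha' hb'
  have h' := (summable_norm_sum_mul_antidiagonal_of_summable_norm ha' hb').of_norm
  rw [ha.tsum_eq, hb.tsum_eq] at h
  have h2 := h'.hasSum
  rw [← h] at h2
  refine h2.congr_fun fun n => ?_
  rw [PowerSeries.coeff_mul, Finset.sum_mul]
  refine Finset.sum_congr rfl fun p hp => ?_
  rw [← Finset.HasAntidiagonal.mem_antidiagonal.1 hp, pow_add]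
  ring

lemma hasSum_coeff_C (c x : ℝ) :
    HasSum (fun j => PowerSeries.coeff j (PowerSeries.C c) * x ^ j) c := by
  have := hasSum_single (f := fun j => PowerSeries.coeff j (PowerSeries.C c) * x ^ j) 0
    (fun j hj => by simp [PowerSeries.coeff_C, hj])
  simpa using this

lemma hasSum_coeff_X (x : ℝ) :
    HasSum (fun j => PowerSeries.coeff j (PowerSeries.X : PowerSeries ℝ) * x ^ j) x := by
  have := hasSum_single
    (f := fun j => PowerSeries.coeff j (PowerSeries.X : PowerSeries ℝ) * x ^ j) 1
    (fun j hj => by simp [PowerSeries.coeff_X, hj])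
  simpa using this

lemma hasSum_coeff_add {a b : PowerSeries ℝ} {x A B : ℝ}
    (ha : HasSum (fun j => PowerSeries.coeff j a * x ^ j) A)
    (hb : HasSum (fun j => PowerSeries.coeff j b * x ^ j) B) :
    HasSum (fun j => PowerSeries.coeff j (a + b) * x ^ j) (A + B) := by
  simpa [add_mul] using ha.add hb

lemma hasSum_coeff_sub {a b : PowerSeries ℝ} {x A B : ℝ}
    (ha : HasSum (fun j => PowerSeries.coeff j a * x ^ j) A)
    (hb : HasSum (fun j => PowerSeries.coeff j b * x ^ j) B) :
    HasSum (fun j => PowerSeries.coeff j (a - b) * x ^ j) (A - B) := by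
  simpa [sub_mul] using ha.sub hb

lemma hasSum_coeff_prod {ι : Type*} (s : Finset ι) {a : ι → PowerSeries ℝ} {x : ℝ} {A : ι → ℝ}
    (h : ∀ i ∈ s, HasSum (fun j => PowerSeries.coeff j (a i) * x ^ j) (A i)) :
    HasSum (fun j => PowerSeries.coeff j (∏ i ∈ s, a i) * x ^ j) (∏ i ∈ s, A i) := by
  classical
  induction s using Finset.induction_on with
  | empty => simpa using hasSum_coeff_C 1 x
  | insert i s hi ih =>
    rw [Finset.prod_insert hi, Finset.prod_insert hi]
    exact hasSum_coeff_mul (h i (Finset.mem_insert_self _ _))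
      (ih fun j hj => h j (Finset.mem_insert_of_mem hj))

lemma hasSum_coeff_spread {m : ℕ} (hm : m ≠ 0) {φ : PowerSeries ℝ} {x A : ℝ}
    (h : HasSum (fun j => PowerSeries.coeff j φ * (x ^ m) ^ j) A) :
    HasSum (fun n => PowerSeries.coeff n (spread m φ) * x ^ n) A := by
  have hinj : Function.Injective fun j => m * j := fun a b h =>
    Nat.eq_of_mul_eq_mul_left (Nat.pos_of_ne_zero hm) h
  rw [← hinj.hasSum_iff]
  · refine h.congr_fun fun j => ?_
    simp only [Function.comp_apply]
    rw [coeff_spread, if_pos (dvd_mul_right _ _), Nat.mul_div_cancel_left _ (Nat.pos_of_ne_zero hm),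
      pow_mul]
  · intro n hn
    rw [coeff_spread, if_neg, zero_mul]
    rintro ⟨k, rfl⟩
    exact hn ⟨k, rfl⟩

lemma hasSum_coeff_geoSeries_one {x : ℝ} (hx : |x| < 1) :
    HasSum (fun j => PowerSeries.coeff j (geoSeries 1) * x ^ j) (1 - x)⁻¹ := by
  simpa [geoSeries] using hasSum_geometric_of_abs_lt_one hx

end Evaluation

/-! ### Expansions of quantities of small order -/

section Order

/-- A quantity of order `q ^ (-t)` has an expansion starting at exponent `t` or later: otherwise
the leading term would dominate for large primes `q`. -/
theorem coeff_eq_zero_of_bound {P : (F : Type) → [Field F] → [Finite F] → ℝ} {a : PowerSeries ℝ}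
    (ha : IsExpansion P a) {C t : ℝ}
    (hb : ∀ (F : Type) [Field F] [Finite F], |P F| ≤ C * ((Nat.card F : ℝ)) ^ (-t)) :
    ∀ j : ℕ, (j : ℝ) < t → PowerSeries.coeff j a = 0 := by
  intro j
  induction j using Nat.strong_induction_on with
  | _ j ih =>
    intro hj
    have h2 : Summable fun i => |PowerSeries.coeff (i + (j + 1)) a| * (1 / 2 : ℝ) ^ i := by
      have h := (ha (ZMod 2)).summable.norm
      rw [← summable_nat_add_iff (j + 1)] at h
      refine (h.mul_left ((2 : ℝ) ^ (j + 1))).congr fun i => ?_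
      rw [Nat.card_zmod, norm_mul, Real.norm_eq_abs, norm_pow, pow_add]
      simp only [Nat.cast_ofNat, norm_inv, Real.norm_ofNat, one_div]
      have : (2 : ℝ) ^ (j + 1) * (2⁻¹ : ℝ) ^ (j + 1) = 1 := by
        rw [← mul_pow]; norm_num
      linear_combination |PowerSeries.coeff (i + (j + 1)) a| * (2⁻¹ : ℝ) ^ i * this
    set M := ∑' i, |PowerSeries.coeff (i + (j + 1)) a| * (1 / 2 : ℝ) ^ i with hM
    -- the tail of the series at `1 / p` is controlled by its absolute convergence at `1 / 2`
    have hbound : ∀ p : ℕ, p.Prime →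
        |PowerSeries.coeff j a| ≤ C * ((p : ℝ)⁻¹) ^ (t - j) + M * (p : ℝ)⁻¹ := by
      intro p hp
      have : Fact p.Prime := ⟨hp⟩
      have h := ha (ZMod p)
      have hPb := hb (ZMod p)
      rw [Nat.card_zmod] at h hPb
      set x := (p : ℝ)⁻¹ with hx
      have hp2 : (2 : ℝ) ≤ p := by exact_mod_cast hp.two_le
      have hx0 : 0 < x := by positivity
      have hx2 : x ≤ 1 / 2 := by rw [hx, one_div]; exact inv_anti₀ two_pos hp2
      have h3 := (hasSum_nat_add_iff' (j + 1)).2 h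
      rw [Finset.sum_range_succ, Finset.sum_eq_zero (fun i hi => by
        rw [ih i (Finset.mem_range.1 hi) (lt_trans (by exact_mod_cast Finset.mem_range.1 hi) hj),
          zero_mul]), zero_add] at h3
      have hle : ∀ i, ‖PowerSeries.coeff (i + (j + 1)) a * x ^ (i + (j + 1))‖ ≤
          x ^ (j + 1) * (|PowerSeries.coeff (i + (j + 1)) a| * (1 / 2 : ℝ) ^ i) := by
        intro i
        rw [norm_mul, Real.norm_eq_abs, norm_pow, Real.norm_of_nonneg hx0.le, pow_add]
        calc _ = x ^ (j + 1) * (|PowerSeries.coeff (i + (j + 1)) a| * x ^ i) := by ring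
          _ ≤ _ := by gcongr
      have h4 := tsum_of_norm_bounded (h2.mul_left (x ^ (j + 1))).hasSum hle
      rw [h3.tsum_eq, tsum_mul_left, ← hM, Real.norm_eq_abs] at h4
      have h5 : |PowerSeries.coeff j a| * x ^ j ≤ C * x ^ t + x ^ (j + 1) * M := by
        have e1 : (p : ℝ) ^ (-t) = x ^ t := by
          rw [hx, Real.inv_rpow (by positivity), Real.rpow_neg (by positivity)]
        rw [e1] at hPb
        have h6 : |PowerSeries.coeff j a * x ^ j| ≤ |P (ZMod p)| +
            |P (ZMod p) - PowerSeries.coeff j a * x ^ j| := by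
          have := abs_sub (P (ZMod p)) (P (ZMod p) - PowerSeries.coeff j a * x ^ j)
          simpa using this
        rw [abs_mul, abs_of_pos (pow_pos hx0 j)] at h6
        linarith
      have hxj := pow_pos hx0 j
      rw [← mul_le_mul_iff_left₀ hxj]
      refine h5.trans (le_of_eq ?_)
      rw [Real.rpow_sub hx0, Real.rpow_natCast]
      field_simp
      ring
    have hlim : Filter.Tendsto (fun n : ℕ => C * ((n : ℝ)⁻¹) ^ (t - j) + M * (n : ℝ)⁻¹)
        Filter.atTop (nhds 0) := by
      have h0 : Filter.Tendsto (fun n : ℕ => (n : ℝ)⁻¹) Filter.atTop (nhds 0) :=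
        tendsto_inv_atTop_nhds_zero_nat
      have h1 := h0.rpow_const (p := t - j) (Or.inr (by linarith))
      rw [Real.zero_rpow (by linarith)] at h1
      simpa using (h1.const_mul C).add (h0.const_mul M)
    have h0 : |PowerSeries.coeff j a| ≤ 0 := by
      refine ge_of_tendsto_of_frequently hlim (Filter.frequently_atTop.2 fun N => ?_)
      obtain ⟨p, hpN, hp⟩ := Nat.exists_infinite_primes N
      exact ⟨p, hpN, hbound p hp⟩
    exact abs_eq_zero.1 (le_antisymm h0 (abs_nonneg _))

lemma IsExpansion.unique {P : (F : Type) → [Field F] → [Finite F] → ℝ} {a b : PowerSeries ℝ}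
    (ha : IsExpansion P a) (hb : IsExpansion P b) : a = b := by
  have h : IsExpansion (fun _ _ _ => 0) (a - b) := by
    intro F _ _
    simpa using hasSum_coeff_sub (ha F) (hb F)
  ext j
  have := coeff_eq_zero_of_bound h (C := 0) (t := j + 1) (fun F _ _ => by simp) j (by simp)
  rwa [map_sub, sub_eq_zero] at this

end Order

/-! ### Quantities with a Laurent expansion -/

section Laurent

/-- The quantity `P` has a Laurent expansion in `1 / q`: after multiplication by a power of `1 / q`
it has an expansion in the sense of `IsExpansion`. -/
def IsLaurent (P : (F : Type) → [Field F] → [Finite F] → ℝ) : Prop :=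
  ∃ (r : ℕ) (a : PowerSeries ℝ), IsExpansion (fun F _ _ => ((Nat.card F : ℝ)⁻¹) ^ r * P F) a

variable {P Q : (F : Type) → [Field F] → [Finite F] → ℝ}

lemma IsExpansion.isLaurent {a : PowerSeries ℝ} (h : IsExpansion P a) : IsLaurent P :=
  ⟨0, a, fun F _ _ => by simpa using h F⟩

lemma IsExpansion.mul {a b : PowerSeries ℝ} (ha : IsExpansion P a) (hb : IsExpansion Q b) :
    IsExpansion (fun F _ _ => P F * Q F) (a * b) := fun F _ _ => hasSum_coeff_mul (ha F) (hb F)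

lemma isExpansion_pow (n : ℕ) :
    IsExpansion (fun F _ _ => ((Nat.card F : ℝ)⁻¹) ^ n) (PowerSeries.X ^ n) := by
  intro F _ _
  have := hasSum_coeff_prod (Finset.range n) (a := fun _ => PowerSeries.X) (A := fun _ =>
    (Nat.card F : ℝ)⁻¹) (fun _ _ => hasSum_coeff_X ((Nat.card F : ℝ)⁻¹))
  simpa using this

lemma isLaurent_const (c : ℝ) : IsLaurent fun _ _ _ => c :=
  IsExpansion.isLaurent (a := PowerSeries.C c) fun _ _ _ => hasSum_coeff_C _ _

lemma isLaurent_card : IsLaurent fun F _ _ => (Nat.card F : ℝ) := by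
  refine ⟨1, PowerSeries.C 1, fun F _ _ => ?_⟩
  have h : (Nat.card F : ℝ) ≠ 0 := by exact_mod_cast Nat.card_pos.ne'
  simpa [h] using hasSum_coeff_C 1 ((Nat.card F : ℝ)⁻¹)

lemma isLaurent_inv_card_pow (n : ℕ) : IsLaurent fun F _ _ => ((Nat.card F : ℝ)⁻¹) ^ n :=
  (isExpansion_pow n).isLaurent

lemma IsLaurent.mul (hP : IsLaurent P) (hQ : IsLaurent Q) :
    IsLaurent fun F _ _ => P F * Q F := by
  obtain ⟨r, a, ha⟩ := hP
  obtain ⟨s, b, hb⟩ := hQ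
  refine ⟨r + s, a * b, fun F _ _ => ?_⟩
  have := (ha.mul hb) F
  convert this using 1
  ring

lemma IsLaurent.add (hP : IsLaurent P) (hQ : IsLaurent Q) :
    IsLaurent fun F _ _ => P F + Q F := by
  obtain ⟨r, a, ha⟩ := hP
  obtain ⟨s, b, hb⟩ := hQ
  refine ⟨r + s, PowerSeries.X ^ s * a + PowerSeries.X ^ r * b, fun F _ _ => ?_⟩
  have := hasSum_coeff_add (((isExpansion_pow s).mul ha) F) (((isExpansion_pow r).mul hb) F)
  convert this using 1
  ring

lemma IsLaurent.sum {ι : Type*} (s : Finset ι) {P : ι → (F : Type) → [Field F] → [Finite F] → ℝ}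
    (h : ∀ i ∈ s, IsLaurent (P i)) : IsLaurent fun F _ _ => ∑ i ∈ s, P i F := by
  classical
  induction s using Finset.induction_on with
  | empty => simpa using isLaurent_const 0
  | insert i s hi ih =>
    simp only [Finset.sum_insert hi]
    exact (h i (Finset.mem_insert_self _ _)).add (ih fun j hj => h j (Finset.mem_insert_of_mem hj))

lemma IsLaurent.prod {ι : Type*} (s : Finset ι) {P : ι → (F : Type) → [Field F] → [Finite F] → ℝ}
    (h : ∀ i ∈ s, IsLaurent (P i)) : IsLaurent fun F _ _ => ∏ i ∈ s, P i F := by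
  classical
  induction s using Finset.induction_on with
  | empty => simpa using isLaurent_const 1
  | insert i s hi ih =>
    simp only [Finset.prod_insert hi]
    exact (h i (Finset.mem_insert_self _ _)).mul (ih fun j hj => h j (Finset.mem_insert_of_mem hj))

lemma IsLaurent.pow (hP : IsLaurent P) (n : ℕ) : IsLaurent fun F _ _ => P F ^ n := by
  simpa using IsLaurent.prod (Finset.range n) (P := fun _ => P) fun _ _ => hP

lemma IsLaurent.eval (hP : IsLaurent P) (f : ℝ[X]) : IsLaurent fun F _ _ => f.eval (P F) := by
  simp only [Polynomial.eval_eq_sum_range]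
  exact IsLaurent.sum _ fun i _ => (isLaurent_const _).mul (hP.pow i)

lemma isLaurent_inv_one_sub {m : ℕ} (hm : m ≠ 0) :
    IsLaurent fun F _ _ => (1 - ((Nat.card F : ℝ)⁻¹) ^ m)⁻¹ :=
  IsExpansion.isLaurent (a := spread m (geoSeries 1)) fun _ _ _ =>
    hasSum_coeff_spread hm (hasSum_coeff_geoSeries_one (abs_inv_card_pow_lt_one hm))

lemma isLaurent_wt (p : AnyPartition) {m : ℕ} (hm : m ≠ 0) :
    IsLaurent fun F _ _ => wt p (((Nat.card F : ℝ)⁻¹) ^ m) := by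
  simp only [wt, div_eq_mul_inv, ← Finset.prod_inv_distrib, ← pow_mul]
  exact (isLaurent_inv_card_pow _).mul (IsLaurent.prod _ fun j _ =>
    isLaurent_inv_one_sub (mul_ne_zero hm (resid_pos p j).ne'))

lemma isLaurent_ecoef (S : Set AnyPartition) (j : ℕ) {m : ℕ} (hm : m ≠ 0) :
    IsLaurent fun F _ _ => ecoef S (((Nat.card F : ℝ)⁻¹) ^ m) j := by
  classical
  unfold ecoef
  refine IsLaurent.sum _ fun p _ => ?_
  by_cases h : (⟨j, p⟩ : AnyPartition) ∈ S
  · simpa only [if_pos h] using isLaurent_wt _ hm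
  · simpa only [if_neg h] using isLaurent_const 0

/-- A bounded function of Laurent type has an expansion without polar part, by
`coeff_eq_zero_of_bound`. -/
lemma IsLaurent.exists_isExpansion (hP : IsLaurent P) {C : ℝ}
    (hC : ∀ (F : Type) [Field F] [Finite F], |P F| ≤ C) : ∃ a, IsExpansion P a := by
  obtain ⟨r, a, ha⟩ := hP
  have h0 := coeff_eq_zero_of_bound ha (C := C) (t := r) (fun F _ _ => by
    have hx := inv_card_pos (F := F)
    rw [abs_mul, abs_of_pos (pow_pos hx r), mul_comm, Real.rpow_neg (by positivity),
      Real.rpow_natCast, ← inv_pow]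
    have := hC F
    gcongr)
  refine ⟨PowerSeries.mk fun j => PowerSeries.coeff (j + r) a, fun F _ _ => ?_⟩
  have hx := inv_card_pos (F := F)
  have h := ha F
  set x := (Nat.card F : ℝ)⁻¹
  have h1 := (hasSum_nat_add_iff' r).2 h
  rw [Finset.sum_eq_zero (fun i hi => by
    rw [h0 i (by exact_mod_cast Finset.mem_range.1 hi), zero_mul]), sub_zero] at h1
  have h2 := h1.mul_left (x ^ r)⁻¹
  rw [inv_mul_cancel_left₀ (pow_pos hx r).ne'] at h2
  refine h2.congr_fun fun j => ?_
  rw [PowerSeries.coeff_mk, pow_add]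
  field_simp

variable {H : (F : Type) → [Field F] → [Finite F] → PowerSeries ℝ}

lemma isLaurent_coeff_prod {ι : Type*} (s : Finset ι)
    {H : ι → (F : Type) → [Field F] → [Finite F] → PowerSeries ℝ}
    (h : ∀ i ∈ s, ∀ n, IsLaurent fun F _ _ => PowerSeries.coeff n (H i F)) (n : ℕ) :
    IsLaurent fun F _ _ => PowerSeries.coeff n (∏ i ∈ s, H i F) := by
  classical
  simp only [PowerSeries.coeff_prod]
  exact IsLaurent.sum _ fun l _ => IsLaurent.prod _ fun i hi => h i hi _

lemma isLaurent_choose {N : (F : Type) → [Field F] → [Finite F] → ℕ}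
    (hN : IsLaurent fun F _ _ => (N F : ℝ)) (r : ℕ) :
    IsLaurent fun F _ _ => ((N F).choose r : ℝ) := by
  have h : ∀ n : ℕ,
      (n.choose r : ℝ) = (descPochhammer ℝ r).eval (n : ℝ) * (r.factorial : ℝ)⁻¹ := by
    intro n
    rw [descPochhammer_eval_eq_descFactorial, Nat.descFactorial_eq_factorial_mul_choose]
    push_cast
    field_simp
  simp only [h]
  exact (hN.eval _).mul (isLaurent_const _)

/-- The coefficients of a power with varying exponent are polynomials in the exponent, by the
binomial expansion of `(1 + (H - 1)) ^ N`. -/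
lemma isLaurent_coeff_pow (hH : ∀ n, IsLaurent fun F _ _ => PowerSeries.coeff n (H F))
    (h0 : ∀ (F : Type) [Field F] [Finite F], PowerSeries.coeff 0 (H F) = 1)
    {N : (F : Type) → [Field F] → [Finite F] → ℕ} (hN : IsLaurent fun F _ _ => (N F : ℝ)) (n : ℕ) :
    IsLaurent fun F _ _ => PowerSeries.coeff n (H F ^ N F) := by
  have key : ∀ (φ : PowerSeries ℝ), PowerSeries.coeff 0 φ = 1 → ∀ M : ℕ,
      PowerSeries.coeff n (φ ^ M) =
        ∑ r ∈ Finset.range (n + 1), (M.choose r : ℝ) * PowerSeries.coeff n ((φ - 1) ^ r) := by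
    intro φ hφ M
    have hX : PowerSeries.X ∣ φ - 1 := by
      rw [PowerSeries.X_dvd_iff, map_sub, ← PowerSeries.coeff_zero_eq_constantCoeff_apply, hφ]
      simp
    have hz : ∀ r, n < r → PowerSeries.coeff n ((φ - 1) ^ r) = 0 := fun r hr =>
      PowerSeries.X_pow_dvd_iff.1 (pow_dvd_pow_of_dvd hX r) n hr
    have h1 : φ ^ M = ∑ r ∈ Finset.range (M + 1), (φ - 1) ^ r * (M.choose r : PowerSeries ℝ) := by
      conv_lhs => rw [show φ = (φ - 1) + 1 by ring, add_pow]
      simp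
    have h2 : PowerSeries.coeff n (φ ^ M) = ∑ r ∈ Finset.range (M + 1),
        (M.choose r : ℝ) * PowerSeries.coeff n ((φ - 1) ^ r) := by
      rw [h1, map_sum]
      refine Finset.sum_congr rfl fun r _ => ?_
      rw [← nsmul_eq_mul', map_nsmul, nsmul_eq_mul]
    rw [h2]
    have h3 : ∀ L, ∑ r ∈ Finset.range (L + 1),
        (M.choose r : ℝ) * PowerSeries.coeff n ((φ - 1) ^ r) =
        ∑ r ∈ (Finset.range (L + 1)).filter (fun r => r ≤ n ∧ r ≤ M),
          (M.choose r : ℝ) * PowerSeries.coeff n ((φ - 1) ^ r) := by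
      intro L
      refine (Finset.sum_filter_of_ne fun r _ hr => ?_).symm
      constructor
      · by_contra h
        exact hr (by rw [hz r (not_le.1 h), mul_zero])
      · by_contra h
        exact hr (by rw [Nat.choose_eq_zero_of_lt (not_le.1 h), Nat.cast_zero, zero_mul])
    rw [h3, h3 n]
    refine Finset.sum_congr ?_ fun _ _ => rfl
    ext r
    simp only [Finset.mem_filter, Finset.mem_range]
    omega
  have hsub : ∀ n, IsLaurent fun F _ _ => PowerSeries.coeff n (H F - 1) := by
    intro n
    simp only [sub_eq_add_neg, map_add]
    exact (hH n).add (isLaurent_const _)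
  simp only [fun (F : Type) [Field F] [Finite F] => key (H F) (h0 F) (N F)]
  refine IsLaurent.sum _ fun r _ => (isLaurent_choose hN r).mul ?_
  have := isLaurent_coeff_prod (Finset.range r) (H := fun _ F _ _ => H F - 1) (fun _ _ => hsub) n
  simpa using this

end Laurent

/-! ### Counting irreducible polynomials -/

section Counting

variable {F : Type} [Field F] [Finite F]

/-- The number of monic irreducible polynomials of degree `m`. -/
noncomputable def numIrred (F : Type) [Field F] [Finite F] (m : ℕ) : ℕ :=
  ((irredLE F m).filter fun f => f.natDegree = m).card

/-- The number of monic irreducible polynomials of degree `m` other than `X`. -/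
noncomputable def numGL (F : Type) [Field F] [Finite F] (m : ℕ) : ℕ :=
  ((irredGL F m).filter fun f => f.natDegree = m).card

/-- The polynomial `X ^ (q ^ m) - X` is the product of the monic irreducible polynomials of degree
dividing `m`. -/
theorem sum_divisors_mul_numIrred {m : ℕ} (hm : m ≠ 0) :
    ∑ d ∈ m.divisors, d * numIrred F d = Nat.card F ^ m := by
  classical
  have := Fintype.ofFinite F
  obtain ⟨p, _⟩ := CharP.exists F
  obtain ⟨k, hp, hk⟩ := FiniteField.card F p
  have hq : 1 < Nat.card F := Finite.one_lt_card
  set g : F[X] := Polynomial.X ^ Nat.card F ^ m - Polynomial.X with hg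
  have hdeg : g.natDegree = Nat.card F ^ m := FiniteField.X_pow_card_pow_sub_X_natDegree_eq F hm hq
  have hg0 : g ≠ 0 := FiniteField.X_pow_card_pow_sub_X_ne_zero F hm hq
  have hsep : g.Separable := by
    refine galois_poly_separable p _ (dvd_pow ?_ hm)
    rw [Nat.card_eq_fintype_card, hk]
    exact dvd_pow_self p k.ne_zero
  set T := (UniqueFactorizationMonoid.normalizedFactors g).toFinset with hT
  have hnd := (UniqueFactorizationMonoid.squarefree_iff_nodup_normalizedFactors hg0).1
    hsep.squarefree
  have hmem : ∀ f, f ∈ T ↔ (f.Monic ∧ Irreducible f) ∧ f.natDegree ∣ m := by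
    intro f
    rw [hT, Multiset.mem_toFinset, UniqueFactorizationMonoid.mem_normalizedFactors_iff' hg0]
    constructor
    · rintro ⟨h1, h2, h3⟩
      refine ⟨⟨?_, h1⟩, h1.natDegree_dvd_iff_dvd_X_pow_card_pow_sub_X.2 h3⟩
      rw [← h2]
      exact Polynomial.monic_normalize h1.ne_zero
    · rintro ⟨⟨h1, h2⟩, h3⟩
      exact ⟨h2, h1.normalize_eq_self, h2.natDegree_dvd_iff_dvd_X_pow_card_pow_sub_X.1 h3⟩
  have hsum : ∑ f ∈ T, f.natDegree = Nat.card F ^ m := by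
    rw [← hdeg, ← Polynomial.natDegree_eq_of_degree_eq (Polynomial.degree_eq_degree_of_associated
      (UniqueFactorizationMonoid.prod_normalizedFactors hg0)),
      Polynomial.natDegree_multiset_prod _
        (UniqueFactorizationMonoid.zero_notMem_normalizedFactors g), Finset.sum, hT,
      Multiset.toFinset_val, hnd.dedup]
  rw [← hsum, ← Finset.sum_fiberwise_of_maps_to (t := m.divisors) (g := Polynomial.natDegree)
    fun f hf => Nat.mem_divisors.2 ⟨((hmem f).1 hf).2, hm⟩]
  refine Finset.sum_congr rfl fun d hd => ?_
  rw [Finset.sum_congr rfl (g := fun _ => d) fun f hf => (Finset.mem_filter.1 hf).2,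
    Finset.sum_const, smul_eq_mul, mul_comm, numIrred]
  congr 2
  ext f
  simp only [Finset.mem_filter, mem_irredLE, hmem]
  constructor
  · rintro ⟨⟨h1, _⟩, rfl⟩
    exact ⟨⟨h1, (Nat.mem_divisors.1 hd).1⟩, rfl⟩
  · rintro ⟨⟨h1, _⟩, rfl⟩
    exact ⟨⟨h1, le_rfl⟩, rfl⟩

lemma mul_numIrred {m : ℕ} (hm : m ≠ 0) :
    (m : ℝ) * numIrred F m = ∑ x ∈ m.divisorsAntidiagonal,
      (ArithmeticFunction.moebius x.1 : ℝ) * (Nat.card F : ℝ) ^ x.2 := by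
  refine ((ArithmeticFunction.sum_eq_iff_sum_mul_moebius_eq (R := ℝ)
    (f := fun m => (m : ℝ) * numIrred F m) (g := fun m => (Nat.card F : ℝ) ^ m)).1 ?_ m
    (Nat.pos_of_ne_zero hm)).symm
  intro n hn
  exact_mod_cast sum_divisors_mul_numIrred (F := F) hn.ne'

lemma numGL_eq (m : ℕ) : (numGL F m : ℝ) = numIrred F m - if m = 1 then 1 else 0 := by
  classical
  rw [numGL, numIrred, irredGL, Finset.filter_erase]
  split_ifs with h
  · subst h
    have hX : (Polynomial.X : F[X]) ∈ (irredLE F 1).filter fun f => f.natDegree = 1 :=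
      Finset.mem_filter.2 ⟨X_mem_irredLE le_rfl, Polynomial.natDegree_X⟩
    rw [Finset.card_erase_of_mem hX, Nat.cast_pred (Finset.card_pos.2 ⟨_, hX⟩)]
  · rw [Finset.erase_eq_of_notMem, sub_zero]
    intro hX
    have := (Finset.mem_filter.1 hX).2
    rw [Polynomial.natDegree_X] at this
    exact h this.symm

/-- The number of monic irreducible polynomials of degree `m` other than `X`, divided by `q ^ m`,
as a polynomial in `x = 1 / q`. -/
noncomputable def normCount {𝕜 : Type*} [Field 𝕜] (m : ℕ) (x : 𝕜) : 𝕜 :=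
  (m : 𝕜)⁻¹ * ∑ p ∈ m.divisorsAntidiagonal, (ArithmeticFunction.moebius p.1 : 𝕜) * x ^ (m - p.2) -
    if m = 1 then x else 0

lemma numGL_mul_pow {m : ℕ} (hm : m ≠ 0) :
    (numGL F m : ℝ) * ((Nat.card F : ℝ)⁻¹) ^ m = normCount m (Nat.card F : ℝ)⁻¹ := by
  set x := (Nat.card F : ℝ)⁻¹ with hx
  have hx0 : x ≠ 0 := inv_card_pos.ne'
  have h1 : (numIrred F m : ℝ) = (m : ℝ)⁻¹ * ∑ p ∈ m.divisorsAntidiagonal,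
      (ArithmeticFunction.moebius p.1 : ℝ) * x⁻¹ ^ p.2 := by
    have hm' : (m : ℝ) ≠ 0 := by exact_mod_cast hm
    rw [eq_inv_mul_iff_mul_eq₀ hm', mul_numIrred hm, hx, inv_inv]
  rw [numGL_eq, h1, normCount, sub_mul, mul_assoc, Finset.sum_mul]
  congr 1
  · congr 1
    refine Finset.sum_congr rfl fun p hp => ?_
    have hle : p.2 ≤ m := Nat.divisor_le (Nat.snd_mem_divisors_of_mem_antidiagonal hp)
    rw [mul_assoc]
    congr 1
    rw [inv_pow, inv_mul_eq_iff_eq_mul₀ (pow_ne_zero _ hx0), ← pow_add, Nat.add_sub_cancel' hle]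
  · split_ifs with h
    · rw [h, pow_one, one_mul]
    · rw [zero_mul]

lemma norm_normCount_le (m : ℕ) {x : ℂ} (hx : ‖x‖ ≤ 1) : ‖normCount m x‖ ≤ 2 := by
  have h1 : ‖∑ p ∈ m.divisorsAntidiagonal,
      (ArithmeticFunction.moebius p.1 : ℂ) * x ^ (m - p.2)‖ ≤ m := by
    have h2 : ∀ p ∈ m.divisorsAntidiagonal,
        ‖(ArithmeticFunction.moebius p.1 : ℂ) * x ^ (m - p.2)‖ ≤ 1 := by
      intro p _
      rw [norm_mul, norm_pow, Complex.norm_intCast]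
      refine mul_le_one₀ ?_ (pow_nonneg (norm_nonneg _) _) (pow_le_one₀ (norm_nonneg _) hx)
      exact_mod_cast ArithmeticFunction.abs_moebius_le_one
    refine (norm_sum_le_of_le _ h2).trans ?_
    rw [Finset.sum_const, nsmul_eq_mul, mul_one, ← Nat.map_div_right_divisors, Finset.card_map]
    exact_mod_cast Nat.card_divisors_le_self m
  have h3 : ‖(m : ℂ)⁻¹ * ∑ p ∈ m.divisorsAntidiagonal,
      (ArithmeticFunction.moebius p.1 : ℂ) * x ^ (m - p.2)‖ ≤ 1 := by
    rw [norm_mul, norm_inv, Complex.norm_natCast]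
    refine inv_mul_le_of_le_mul₀ (Nat.cast_nonneg m) zero_le_one ?_
    rwa [mul_one]
  have h4 : ‖(if m = 1 then x else 0 : ℂ)‖ ≤ 1 := by
    split_ifs
    · exact hx
    · simp
  calc ‖normCount m x‖ ≤ _ := norm_sub_le _ _
    _ ≤ 2 := by linarith

lemma isLaurent_numGL {m : ℕ} (hm : m ≠ 0) : IsLaurent fun F _ _ => (numGL F m : ℝ) := by
  have h : ∀ (F : Type) [Field F] [Finite F], (numGL F m : ℝ) =
      normCount m (Nat.card F : ℝ)⁻¹ * (Nat.card F : ℝ) ^ m := by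
    intro F _ _
    have hq : (Nat.card F : ℝ) ≠ 0 := by exact_mod_cast Nat.card_pos.ne'
    rw [← numGL_mul_pow hm, inv_pow, inv_mul_cancel_right₀ (pow_ne_zero _ hq)]
  simp only [h, normCount, sub_eq_add_neg]
  refine IsLaurent.mul (IsLaurent.add ((isLaurent_const _).mul (IsLaurent.sum _ fun p _ =>
    (isLaurent_const _).mul (isLaurent_inv_card_pow _))) ?_) (isLaurent_card.pow m)
  by_cases h1 : m = 1
  · simpa [if_pos h1] using (isLaurent_const (-1)).mul (isLaurent_inv_card_pow 1)
  · simpa [if_neg h1] using isLaurent_const 0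

lemma prod_irredGL {M : Type*} [CommMonoid M] (D : ℕ) (h : ℕ → M) :
    ∏ f ∈ irredGL F D, h f.natDegree = ∏ m ∈ Finset.Icc 1 D, h m ^ numGL F m := by
  classical
  rw [← Finset.prod_fiberwise_of_maps_to (t := Finset.Icc 1 D) (g := Polynomial.natDegree)
    fun f hf => Finset.mem_Icc.2 ⟨(mem_irredGL.1 hf).2.1.2.natDegree_pos, (mem_irredGL.1 hf).2.2⟩]
  refine Finset.prod_congr rfl fun m hm => ?_
  rw [Finset.prod_congr rfl (g := fun _ => h m) fun f hf => by rw [(Finset.mem_filter.1 hf).2],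
    Finset.prod_const, numGL]
  congr 2
  ext f
  simp only [Finset.mem_filter, mem_irredGL]
  constructor
  · rintro ⟨⟨h0, h1, _⟩, rfl⟩
    exact ⟨⟨h0, h1, le_rfl⟩, rfl⟩
  · rintro ⟨⟨h0, h1, _⟩, rfl⟩
    exact ⟨⟨h0, h1, (Finset.mem_Icc.1 hm).2⟩, rfl⟩

lemma glProb_nonneg (Λ : Set AnyPartition) (d : ℕ) : 0 ≤ glProb Λ d F :=
  div_nonneg (Nat.cast_nonneg _) (Nat.cast_nonneg _)

lemma glProb_le_one (Λ : Set AnyPartition) (d : ℕ) : glProb Λ d F ≤ 1 := by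
  refine div_le_one_of_le₀ ?_ (Nat.cast_nonneg _)
  exact_mod_cast Nat.card_le_card_of_injective _ Subtype.val_injective

/-- For fixed `d` the proportion is a finite combination of powers with Laurent exponents `numGL`
of series with Laurent coefficients, and it lies between `0` and `1`. -/
theorem exists_isExpansion_glProb (Λ : Set AnyPartition) (d : ℕ) :
    ∃ a, IsExpansion (fun F _ _ => glProb Λ d F) a := by
  refine IsLaurent.exists_isExpansion (C := 1) ?_ fun F _ _ => by
    rw [abs_of_nonneg (glProb_nonneg Λ d)]
    exact glProb_le_one Λ d
  simp only [fun (F : Type) [Field F] [Finite F] => glProb_eq_coeff (F := F) Λ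
    (le_max_right d 1) (le_max_left d 1), glProduct, fun (F : Type) [Field F] [Finite F] =>
    prod_irredGL (F := F) (max d 1) (fun m => spread m (eser (withEmpty Λ)
      (((Nat.card F : ℝ)⁻¹) ^ m)))]
  refine isLaurent_coeff_prod _ (fun m hm => ?_) d
  have hm0 : m ≠ 0 := (Nat.lt_of_succ_le (Finset.mem_Icc.1 hm).1).ne'
  refine isLaurent_coeff_pow (H := fun F _ _ => spread m (eser (withEmpty Λ)
      (((Nat.card F : ℝ)⁻¹) ^ m))) (fun n => ?_) (fun F _ _ => ?_) (isLaurent_numGL hm0)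
  · simp only [coeff_spread]
    by_cases h : m ∣ n
    · simpa only [if_pos h, eser, PowerSeries.coeff_mk] using isLaurent_ecoef _ _ hm0
    · simpa only [if_neg h] using isLaurent_const 0
  · rw [coeff_spread, if_pos (dvd_zero m), Nat.zero_div, eser, PowerSeries.coeff_mk,
      ecoef_zero (S := withEmpty Λ) fun p hp => Or.inl hp]

end Counting

/-! ### Convergence and agreement in the stable range -/

section Convergence

lemma abs_sum_Ico_coeff_le {ρ C : ℝ} (hρ : 1 ≤ ρ) {φ : PowerSeries ℝ} {N : ℕ}
    (h : pnorm ρ N φ ≤ C) (a : ℕ) :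
    |∑ n ∈ Finset.Ico a N, PowerSeries.coeff n φ| ≤ C * (ρ ^ a)⁻¹ := by
  have hρ0 : 0 < ρ ^ a := by positivity
  rw [← div_eq_mul_inv, le_div_iff₀ hρ0]
  calc _ ≤ (∑ n ∈ Finset.Ico a N, |PowerSeries.coeff n φ|) * ρ ^ a := by
        gcongr
        exact Finset.abs_sum_le_sum_abs _ _
    _ ≤ ∑ n ∈ Finset.Ico a N, |PowerSeries.coeff n φ| * ρ ^ n := by
        rw [Finset.sum_mul]
        refine Finset.sum_le_sum fun n hn => ?_
        have := (Finset.mem_Ico.1 hn).1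
        gcongr
    _ ≤ pnorm ρ N φ := by
        refine Finset.sum_le_sum_of_subset_of_nonneg (fun n hn => ?_) fun _ _ _ => by positivity
        exact Finset.mem_range.2 (Finset.mem_Ico.1 hn).2
    _ ≤ C := h

/-- Proportions in large dimension differ by a small power of `q`, uniformly in `q`. -/
theorem exists_abs_glProb_sub_le {Λ : Set AnyPartition} {k : ℕ}
    (hk : ∀ i, 0 < i → i < k → onePart i ∈ Λ) {s : ℝ} (hs0 : 0 ≤ s) (hs : 1 < k * (1 - s)) :
    ∃ C : ℝ, ∀ (F : Type) [Field F] [Finite F] (d d' : ℕ), d ≤ d' →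
      |glProb Λ d' F - glProb Λ d F| ≤ C * (((Nat.card F : ℝ) ^ s) ^ (d + 1))⁻¹ := by
  obtain ⟨C, hC⟩ := exists_pnorm_wser_le (S := withEmpty Λ) (fun p hp => Or.inl hp)
    (fun i h0 h1 => Or.inr (hk i h0 h1)) hs
  refine ⟨C, fun F _ _ d d' hd => ?_⟩
  have hq : (1 : ℝ) ≤ Nat.card F := by exact_mod_cast Nat.card_pos
  have h := abs_sum_Ico_coeff_le (Real.one_le_rpow hq hs0) (hC F (max d' 1) (d' + 1)) (d + 1)
  rwa [Finset.sum_Ico_eq_sub _ (by omega), ← glProb_eq_sum Λ (le_max_right _ _) (le_max_left _ _),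
    ← glProb_eq_sum Λ (le_max_right _ _) (hd.trans (le_max_left _ _))] at h

lemma onePart_mem_of_lt_two {Λ : Set AnyPartition} (h1 : onePart 1 ∈ Λ) :
    ∀ i, 0 < i → i < 2 → onePart i ∈ Λ := by
  intro i h h'
  obtain rfl : i = 1 := by omega
  exact h1

lemma one_lt_card_rpow (F : Type) [Field F] [Finite F] {s : ℝ} (hs : 0 < s) :
    1 < (Nat.card F : ℝ) ^ s :=
  Real.one_lt_rpow (by exact_mod_cast Finite.one_lt_card) hs

lemma tendsto_const_mul_inv_pow_succ {ρ : ℝ} (hρ : 1 < ρ) (C : ℝ) :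
    Filter.Tendsto (fun d : ℕ => C * (ρ ^ (d + 1))⁻¹) Filter.atTop (nhds 0) := by
  have := (tendsto_pow_atTop_nhds_zero_of_lt_one (by positivity) (inv_lt_one_of_one_lt₀ hρ)).comp
    (Filter.tendsto_add_atTop_nat 1)
  simpa using this.const_mul C

theorem tendsto_glProb {Λ : Set AnyPartition} (h1 : onePart 1 ∈ Λ) (F : Type) [Field F] [Finite F] :
    Filter.Tendsto (fun d : ℕ => glProb Λ d F) Filter.atTop (nhds (glProbLim Λ F)) := by
  -- `k = 2` is always available, and any `s` strictly between `0` and `1 / 2` would do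
  obtain ⟨C, hC⟩ := exists_abs_glProb_sub_le (onePart_mem_of_lt_two h1) (s := 1 / 4)
    (by norm_num) (by norm_num)
  have hρ := one_lt_card_rpow F (s := 1 / 4) (by norm_num)
  have hcauchy : CauchySeq fun d : ℕ => glProb Λ d F :=
    cauchySeq_of_le_tendsto_0' _ (fun d d' hd => by
      rw [dist_comm, Real.dist_eq]; exact hC F d d' hd) (tendsto_const_mul_inv_pow_succ hρ C)
  obtain ⟨l, hl⟩ := cauchySeq_tendsto_of_complete hcauchy
  rw [glProbLim, hl.limUnder_eq]
  exact hl

theorem exists_abs_glProb_sub_lim_le {Λ : Set AnyPartition} (h1 : onePart 1 ∈ Λ) {k : ℕ}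
    (hk : ∀ i, 0 < i → i < k → onePart i ∈ Λ) {s : ℝ} (hs0 : 0 ≤ s) (hs : 1 < k * (1 - s)) :
    ∃ C : ℝ, ∀ (F : Type) [Field F] [Finite F] (d : ℕ),
      |glProb Λ d F - glProbLim Λ F| ≤ C * (Nat.card F : ℝ) ^ (-(s * (d + 1))) := by
  obtain ⟨C, hC⟩ := exists_abs_glProb_sub_le hk hs0 hs
  refine ⟨C, fun F _ _ d => ?_⟩
  have h := le_of_tendsto ((tendsto_glProb h1 F).sub_const (glProb Λ d F)).abs
    (Filter.eventually_atTop.2 ⟨d, fun d' hd => hC F d d' hd⟩)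
  have hq : (0 : ℝ) ≤ Nat.card F := Nat.cast_nonneg _
  rw [abs_sub_comm, Real.rpow_neg hq, Real.rpow_mul hq]
  refine h.trans (le_of_eq ?_)
  rw [← Real.rpow_natCast]
  push_cast
  rfl

/-- Below the stable range there is room for an exponent `s < 1 - 1 / k` with `j < s (d + 1)`, where
all one-part partitions of size less than `k` belong to `Λ`. -/
lemma exists_rate {Λ : Set AnyPartition} {d j : ℕ}
    (hj : (j : ℝ) < ((d : ℝ) + 1) * stabRate Λ) :
    ∃ (k : ℕ) (s : ℝ), (∀ i, 0 < i → i < k → onePart i ∈ Λ) ∧ 0 ≤ s ∧ 1 < k * (1 - s) ∧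
      (j : ℝ) < s * (d + 1) := by
  classical
  have hd : (0 : ℝ) < d + 1 := by positivity
  have key : ∀ k : ℕ, 0 < k → (∀ i, 0 < i → i < k → onePart i ∈ Λ) →
      (j : ℝ) < (d + 1) * (1 - 1 / (k : ℝ)) → ∃ (k : ℕ) (s : ℝ),
      (∀ i, 0 < i → i < k → onePart i ∈ Λ) ∧ 0 ≤ s ∧ 1 < k * (1 - s) ∧
      (j : ℝ) < s * (d + 1) := by
    intro k hk hΛ hjk
    have hk' : (0 : ℝ) < k := by exact_mod_cast hk
    obtain ⟨s, hs1, hs2⟩ := exists_between ((div_lt_iff₀' hd).2 hjk)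
    refine ⟨k, s, hΛ, ?_, ?_, (div_lt_iff₀ hd).1 hs1⟩
    · exact le_trans (by positivity) hs1.le
    · have := mul_lt_mul_of_pos_left (lt_sub_comm.1 hs2) hk'
      rwa [mul_one_div_cancel hk'.ne'] at this
  by_cases h : ∃ k : ℕ, 0 < k ∧ onePart k ∉ Λ
  · rw [stabRate, dif_pos h] at hj
    refine key (Nat.find h) (Nat.find_spec h).1 (fun i hi0 hi => ?_) (by convert hj)
    by_contra hc
    exact Nat.find_min h hi ⟨hi0, hc⟩
  · rw [stabRate, dif_neg h] at hj
    push Not at h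
    have hlim : Filter.Tendsto (fun k : ℕ => ((d : ℝ) + 1) * (1 - 1 / (k : ℝ))) Filter.atTop
        (nhds (((d : ℝ) + 1) * 1)) := by
      have := (tendsto_one_div_atTop_nhds_zero_nat (𝕜 := ℝ)).const_sub 1
      rw [sub_zero] at this
      exact this.const_mul _
    obtain ⟨k, hk1, hk2⟩ :=
      ((hlim.eventually_const_lt hj).and (Filter.eventually_gt_atTop 0)).exists
    exact key k hk2 (fun i hi _ => h i hi) hk1

/-- Agreement of the coefficients in the stable range: the difference of the two expansions is an
expansion of a quantity of order `q ^ (-s (d + 1))`. -/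
theorem coeff_eq_of_lt_stabRate {Λ : Set AnyPartition} (h1 : onePart 1 ∈ Λ) {d : ℕ}
    {a b : PowerSeries ℝ} (ha : IsExpansion (fun F _ _ => glProb Λ d F) a)
    (hb : IsExpansion (fun F _ _ => glProbLim Λ F) b) {j : ℕ}
    (hj : (j : ℝ) < ((d : ℝ) + 1) * stabRate Λ) :
    PowerSeries.coeff j a = PowerSeries.coeff j b := by
  obtain ⟨k, s, hk, hs0, hs, hjs⟩ := exists_rate hj
  obtain ⟨C, hC⟩ := exists_abs_glProb_sub_lim_le h1 hk hs0 hs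
  have h : IsExpansion (fun F _ _ => glProb Λ d F - glProbLim Λ F) (a - b) :=
    fun F _ _ => hasSum_coeff_sub (ha F) (hb F)
  have := coeff_eq_zero_of_bound h (fun F _ _ => hC F d) j hjs
  rwa [map_sub, sub_eq_zero] at this

end Convergence

/-! ### The local factors as functions of a complex variable -/

section LocalFactor

/-- A radius slightly larger than `1 / 2`, the largest value of `1 / q`, and small enough for the
bound in `sum_range_tail_le`. -/
noncomputable def locRadius : ℝ := 51 / 100

/-- The factor `1 - y` cancels against the denominator of the weight, and what is left is dominated
by its value at the radius, as `expo p ≥ 2`. -/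
lemma norm_one_sub_mul_wt_le {p : AnyPartition} (hp : 2 ≤ p.1) {r : ℝ} (hr0 : 0 < r) (hr1 : r < 1)
    {y : ℂ} (hy : ‖y‖ ≤ r) : ‖(1 - y) * wt p y‖ ≤ (‖y‖ / r) ^ 2 * ((1 - r) * wt p r) := by
  obtain ⟨j, hj⟩ := exists_resid_eq_one (p := p) (by omega)
  have hy1 : ‖y‖ < 1 := hy.trans_lt hr1
  have h1 : (1 - y) * wt p y = y ^ expo p / ∏ i ∈ Finset.univ.erase j, (1 - y ^ resid p i) := by
    have h0 := one_sub_pow_ne_zero hy1 one_ne_zero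
    rw [pow_one] at h0
    rw [wt, ← Finset.mul_prod_erase _ _ (Finset.mem_univ j), hj, pow_one, ← div_div,
      ← mul_div_assoc, mul_div_cancel₀ _ h0]
  have h2 : (1 - r) * wt p r = r ^ expo p / ∏ i ∈ Finset.univ.erase j, (1 - r ^ resid p i) := by
    have h0 : 1 - r ≠ 0 := by linarith
    rw [wt, ← Finset.mul_prod_erase _ _ (Finset.mem_univ j), hj, pow_one, ← div_div,
      ← mul_div_assoc, mul_div_cancel₀ _ h0]
  have hprod : ∏ i ∈ Finset.univ.erase j, (1 - r ^ resid p i) ≤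
      ‖∏ i ∈ Finset.univ.erase j, (1 - y ^ resid p i)‖ := by
    rw [norm_prod]
    refine Finset.prod_le_prod (fun i _ => sub_nonneg.2 (pow_le_one₀ hr0.le hr1.le)) fun i _ => ?_
    have := norm_sub_norm_le (1 : ℂ) (y ^ resid p i)
    rw [norm_one, norm_pow] at this
    have h3 := pow_le_pow_left₀ (norm_nonneg y) hy (resid p i)
    linarith
  have hpos : 0 < ∏ i ∈ Finset.univ.erase j, (1 - r ^ resid p i) :=
    Finset.prod_pos fun i _ => sub_pos.2 (pow_lt_one₀ hr0.le hr1 (resid_pos p i).ne')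
  have hexp : ‖y‖ ^ expo p ≤ (‖y‖ / r) ^ 2 * r ^ expo p := by
    have h2e : 2 ≤ expo p := hp.trans (size_le_expo p)
    obtain ⟨e, he⟩ := Nat.exists_eq_add_of_le h2e
    rw [he, pow_add, pow_add, div_pow, ← mul_assoc, div_mul_cancel₀ _ (pow_pos hr0 2).ne']
    gcongr
  rw [h1, h2, norm_div, norm_pow, ← mul_div_assoc]
  gcongr

lemma norm_one_sub_mul_ecoef_le (S : Set AnyPartition) (j : ℕ) {r : ℝ} (hr0 : 0 < r) (hr1 : r < 1)
    {y : ℂ} (hy : ‖y‖ ≤ r) :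
    ‖(1 - y) * ecoef S y (j + 2)‖ ≤ (‖y‖ / r) ^ 2 * ((1 - r) * ecoef Set.univ r (j + 2)) := by
  simp only [ecoef, Finset.mul_sum]
  refine norm_sum_le_of_le _ fun p _ => ?_
  rw [if_pos (Set.mem_univ _)]
  have h := norm_one_sub_mul_wt_le (p := ⟨j + 2, p⟩) (by simp) hr0 hr1 hy
  split_ifs
  · exact h
  · rw [mul_zero, norm_zero]
    exact (norm_nonneg _).trans h

lemma sum_range_ecoef_univ {y : ℝ} (hy : |y| < 1) (n : ℕ) :
    ∑ j ∈ Finset.range (n + 1), ecoef Set.univ y j = (qpoch y n)⁻¹ := by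
  induction n with
  | zero => simp [qpoch, ecoef_univ_real 0 hy]
  | succ n ih =>
    have h2 := qpoch_real_ne_zero hy (n + 1)
    rw [Finset.sum_range_succ, ih, ecoef_univ_real _ hy]
    rw [qpoch_succ] at h2 ⊢
    have h3 := left_ne_zero_of_mul h2
    have h4 := right_ne_zero_of_mul h2
    field_simp
    ring

lemma ecoef_one {𝕜 : Type*} [Field 𝕜] {S : Set AnyPartition} (h1 : onePart 1 ∈ S) (y : 𝕜) :
    ecoef S y 1 = y / (1 - y) := by
  have := wt_onePart one_pos y
  rw [pow_one] at this
  rw [ecoef, Fintype.sum_eq_single (Nat.Partition.indiscrete 1)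
    fun p hp => absurd (Subsingleton.elim _ _) hp, if_pos h1, ← this]

lemma le_tailProd_locRadius (n : ℕ) : 53 / 100 ≤ tailProd locRadius n := by
  have hr : locRadius = 51 / 100 := rfl
  cases n with
  | zero => norm_num [tailProd]
  | succ n =>
    have hr0 : 0 ≤ locRadius := by rw [hr]; norm_num
    have hr1 : locRadius ≤ 1 := by rw [hr]; norm_num
    -- `∏ (1 - r ^ i) ≥ 1 - ∑ r ^ i` over `i ≥ 3`, with a separate factor for `i = 2`
    suffices h : (1 - locRadius ^ 2) *
        (1 - (locRadius ^ 3 - locRadius ^ (n + 3)) / (1 - locRadius)) ≤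
          tailProd locRadius (n + 1) by
      have h3 := pow_nonneg hr0 (n + 3)
      refine le_trans ?_ h
      generalize locRadius ^ (n + 3) = z at h3
      rw [hr]
      norm_num
      linarith
    induction n with
    | zero => simp [tailProd]
    | succ n ih =>
      have h1 : tailProd locRadius (n + 1 + 1) =
        tailProd locRadius (n + 1) * (1 - locRadius ^ (n + 3)) := Finset.prod_range_succ _ _
      have h2 : tailProd locRadius (n + 1) ≤ 1 - locRadius ^ 2 := by
        have e : tailProd locRadius (n + 1) =
            (∏ i ∈ Finset.range n, (1 - locRadius ^ (i + 1 + 2))) * (1 - locRadius ^ 2) :=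
          Finset.prod_range_succ' _ _
        rw [e]
        refine mul_le_of_le_one_left (sub_nonneg.2 (pow_le_one₀ hr0 hr1)) ?_
        exact Finset.prod_le_one (fun _ _ => sub_nonneg.2 (pow_le_one₀ hr0 hr1))
          fun _ _ => sub_le_self _ (pow_nonneg hr0 _)
      have h3 := pow_nonneg hr0 (n + 3)
      rw [h1]
      have e : locRadius ^ (n + 1 + 3) = locRadius ^ (n + 3) * locRadius := by ring
      rw [e]
      generalize locRadius ^ (n + 3) = z at *
      generalize tailProd locRadius (n + 1) = t at *
      rw [hr] at *
      norm_num at *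
      nlinarith [mul_le_mul_of_nonneg_right h2 h3]

/-- The sum telescopes to the reciprocal of `tailProd` minus `1`. The point is that the bound is
smaller than `1`. -/
lemma sum_range_tail_le (n : ℕ) :
    ∑ j ∈ Finset.range n, (1 - locRadius) * ecoef Set.univ locRadius (j + 2) ≤ 9 / 10 := by
  have hr : locRadius = 51 / 100 := rfl
  have hr1 : |locRadius| < 1 := by rw [hr]; norm_num [abs_lt]
  have h := sum_range_ecoef_univ hr1 (n + 1)
  rw [Finset.sum_range_succ', Finset.sum_range_succ', ecoef_zero (fun _ _ => Set.mem_univ _),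
    zero_add, ecoef_one (Set.mem_univ _), qpoch_succ_eq] at h
  have ht := le_tailProd_locRadius n
  have ht' : (tailProd locRadius n)⁻¹ ≤ 19 / 10 := by
    refine (inv_anti₀ (by norm_num) ht).trans (by norm_num)
  have h0 : 1 - locRadius ≠ 0 := by rw [hr]; norm_num
  rw [← Finset.mul_sum]
  simp only [add_assoc, Nat.reduceAdd] at h
  rw [eq_sub_of_add_eq h, mul_sub, mul_inv, mul_inv_cancel_left₀ h0, mul_add, mul_div_cancel₀ _ h0]
  linarith

lemma summable_tail : Summable fun j =>
    (1 - locRadius) * ecoef Set.univ locRadius (j + 2) := by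
  refine summable_of_sum_range_le (c := 9 / 10) (fun j => ?_) sum_range_tail_le
  have h0 : (0 : ℝ) ≤ locRadius := by norm_num [locRadius]
  have h1 : locRadius ≤ 1 := by norm_num [locRadius]
  exact mul_nonneg (sub_nonneg.2 h1) (ecoef_nonneg _ h0 h1 _)

lemma tsum_tail_le : ∑' j, (1 - locRadius) * ecoef Set.univ locRadius (j + 2) ≤ 9 / 10 :=
  summable_tail.tsum_le_of_sum_range_le sum_range_tail_le

/-- The terms of index at least two of the normalised local factor at `u = 1`. The first two terms
add up to `1` when the one-part partition of `1` is admitted, see `hasSum_locRem`. -/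
noncomputable def locRem (S : Set AnyPartition) (y : ℂ) : ℂ := ∑' j, (1 - y) * ecoef S y (j + 2)

lemma locRadius_pos : 0 < locRadius := by norm_num [locRadius]

lemma locRadius_lt_one : locRadius < 1 := by norm_num [locRadius]

lemma norm_locRem_le (S : Set AnyPartition) {y : ℂ} (hy : ‖y‖ ≤ locRadius) :
    ‖locRem S y‖ ≤ (‖y‖ / locRadius) ^ 2 * (9 / 10) := by
  refine (tsum_of_norm_bounded (summable_tail.mul_left ((‖y‖ / locRadius) ^ 2)).hasSum fun j =>
    norm_one_sub_mul_ecoef_le S j locRadius_pos locRadius_lt_one hy).trans ?_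
  rw [tsum_mul_left]
  gcongr
  exact tsum_tail_le

lemma norm_locRem_le' (S : Set AnyPartition) {y : ℂ} (hy : ‖y‖ ≤ locRadius) :
    ‖locRem S y‖ ≤ 9 / 10 := by
  refine (norm_locRem_le S hy).trans (mul_le_of_le_one_left (by norm_num) ?_)
  exact pow_le_one₀ (div_nonneg (norm_nonneg _) locRadius_pos.le)
    ((div_le_one locRadius_pos).2 hy)

lemma hasSum_locRem {S : Set AnyPartition} (hS : ∀ p : AnyPartition, p.1 = 0 → p ∈ S)
    (h1 : onePart 1 ∈ S) {y : ℂ} (hy : ‖y‖ ≤ locRadius) :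
    HasSum (fun j => (1 - y) * ecoef S y j) (1 + locRem S y) := by
  have hs : Summable fun j => (1 - y) * ecoef S y (j + 2) :=
    Summable.of_norm_bounded (summable_tail.mul_left ((‖y‖ / locRadius) ^ 2)) fun j =>
      norm_one_sub_mul_ecoef_le S j locRadius_pos locRadius_lt_one hy
  have h0 := one_sub_pow_ne_zero (hy.trans_lt locRadius_lt_one) one_ne_zero
  rw [pow_one] at h0
  have h2 : ∑ j ∈ Finset.range 2, (1 - y) * ecoef S y j = 1 := by
    rw [Finset.sum_range_succ, Finset.sum_range_one, ecoef_zero hS, ecoef_one h1,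
      mul_div_cancel₀ _ h0]
    ring
  have := hs.hasSum
  rw [← locRem, hasSum_nat_add_iff (f := fun j => (1 - y) * ecoef S y j), h2, add_comm] at this
  exact this

lemma differentiableOn_locRem (S : Set AnyPartition) :
    DifferentiableOn ℂ (locRem S) (Metric.ball 0 locRadius) := by
  refine Complex.differentiableOn_tsum_of_summable_norm summable_tail (fun j y hy => ?_)
    Metric.isOpen_ball fun j y hy => ?_
  · have hy1 := (mem_ball_zero_iff.1 hy).trans locRadius_lt_one
    have := differentiableAt_ecoef S (j + 2) hy1
    exact ((differentiableAt_const _).sub differentiableAt_id).mul this |>.differentiableWithinAt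
  · have hy1 := (mem_ball_zero_iff.1 hy).le
    refine (norm_one_sub_mul_ecoef_le S j locRadius_pos locRadius_lt_one hy1).trans
      (mul_le_of_le_one_left ?_ ?_)
    · exact mul_nonneg (sub_nonneg.2 locRadius_lt_one.le)
        (ecoef_nonneg _ locRadius_pos.le locRadius_lt_one.le _)
    · exact pow_le_one₀ (div_nonneg (norm_nonneg _) locRadius_pos.le)
        ((div_le_one locRadius_pos).2 hy1)

/-- The logarithm of the local factor `1 + locRem S y`, divided by `y`. The division absorbs the
pole at `x = 0` of the number of irreducible polynomials. -/
noncomputable def locLog (S : Set AnyPartition) : ℂ → ℂ :=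
  dslope (fun y => Complex.log (1 + locRem S y)) 0

lemma locRem_zero (S : Set AnyPartition) : locRem S 0 = 0 := by
  have := norm_locRem_le S (y := 0) (by simpa using locRadius_pos.le)
  simpa using this

lemma mul_locLog (S : Set AnyPartition) (y : ℂ) :
    y * locLog S y = Complex.log (1 + locRem S y) := by
  have := sub_smul_dslope (fun y => Complex.log (1 + locRem S y)) 0 y
  simpa [locRem_zero, locLog] using this

lemma exp_mul_locLog (S : Set AnyPartition) {y : ℂ} (hy : ‖y‖ ≤ locRadius) :
    Complex.exp (y * locLog S y) = 1 + locRem S y := by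
  rw [mul_locLog, Complex.exp_log]
  refine Complex.slitPlane_ne_zero (Complex.mem_slitPlane_of_norm_lt_one ?_)
  exact (norm_locRem_le' S hy).trans_lt (by norm_num)

lemma differentiableOn_locLog (S : Set AnyPartition) :
    DifferentiableOn ℂ (locLog S) (Metric.ball 0 locRadius) := by
  rw [locLog, Complex.differentiableOn_dslope (Metric.ball_mem_nhds 0 locRadius_pos)]
  refine DifferentiableOn.clog ((differentiableOn_const 1).add (differentiableOn_locRem S))
    fun y hy => Complex.mem_slitPlane_of_norm_lt_one ?_
  exact (norm_locRem_le' S (mem_ball_zero_iff.1 hy).le).trans_lt (by norm_num)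

lemma norm_locLog_le_of_ne_zero (S : Set AnyPartition) {y : ℂ} (hy0 : y ≠ 0)
    (hy : ‖y‖ ≤ locRadius) : ‖locLog S y‖ ≤ 20 * ‖y‖ := by
  have hT := norm_locRem_le S hy
  have hT' := norm_locRem_le' S hy
  have h1 := Complex.norm_log_one_add_le (z := locRem S y) (by linarith)
  rw [← mul_locLog, norm_mul] at h1
  have h2 : (1 - ‖locRem S y‖)⁻¹ ≤ 10 := by
    rw [inv_le_comm₀ (by linarith) (by norm_num)]
    linarith
  have h3 : ‖y‖ * ‖locLog S y‖ ≤ 11 / 2 * ‖locRem S y‖ := by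
    refine h1.trans ?_
    have h4 : ‖locRem S y‖ ^ 2 * (1 - ‖locRem S y‖)⁻¹ ≤ (9 / 10 * ‖locRem S y‖) * 10 := by
      rw [sq]
      refine mul_le_mul (mul_le_mul_of_nonneg_right hT' (norm_nonneg _)) h2
        (inv_nonneg.2 (by linarith)) (by positivity)
    linarith
  have h5 : (‖y‖ / locRadius) ^ 2 ≤ 4 * ‖y‖ ^ 2 := by
    rw [div_pow, div_le_iff₀ (pow_pos locRadius_pos 2)]
    have : (1 : ℝ) ≤ 4 * locRadius ^ 2 := by norm_num [locRadius]
    nlinarith [sq_nonneg ‖y‖]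
  have hy' : 0 < ‖y‖ := norm_pos_iff.2 hy0
  rw [← mul_le_mul_iff_right₀ hy']
  nlinarith

/-- By continuity from `norm_locLog_le_of_ne_zero`. -/
lemma locLog_zero (S : Set AnyPartition) : locLog S 0 = 0 := by
  have hc : ContinuousAt (locLog S) 0 := ((differentiableOn_locLog S).differentiableAt
    (Metric.ball_mem_nhds 0 locRadius_pos)).continuousAt
  have h1 : Filter.Tendsto (locLog S) (nhdsWithin 0 {0}ᶜ) (nhds (locLog S 0)) :=
    hc.tendsto.mono_left nhdsWithin_le_nhds
  refine tendsto_nhds_unique h1 (squeeze_zero_norm' (a := fun y : ℂ => 20 * ‖y‖) ?_ ?_)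
  · filter_upwards [self_mem_nhdsWithin,
      mem_nhdsWithin_of_mem_nhds (Metric.ball_mem_nhds (0 : ℂ) locRadius_pos)] with y hy0 hy
    exact norm_locLog_le_of_ne_zero S hy0 (mem_ball_zero_iff.1 hy).le
  · have : Filter.Tendsto (fun y : ℂ => 20 * ‖y‖) (nhds 0) (nhds (20 * ‖(0 : ℂ)‖)) :=
      (continuous_const.mul continuous_norm).tendsto 0
    rw [norm_zero, mul_zero] at this
    exact this.mono_left nhdsWithin_le_nhds

lemma norm_locLog_le (S : Set AnyPartition) {y : ℂ} (hy : ‖y‖ ≤ locRadius) :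
    ‖locLog S y‖ ≤ 20 * ‖y‖ := by
  rcases eq_or_ne y 0 with rfl | hy0
  · simp [locLog_zero]
  · exact norm_locLog_le_of_ne_zero S hy0 hy

end LocalFactor

/-! ### The limiting proportion as a holomorphic function -/

section Limit

lemma norm_pow_succ_le {x : ℂ} {r : ℝ} (hr : r ≤ 1) (hx : ‖x‖ ≤ r) (m : ℕ) : ‖x ^ (m + 1)‖ ≤ r := by
  rw [norm_pow]
  exact (pow_le_of_le_one (norm_nonneg _) (hx.trans hr) m.succ_ne_zero).trans hx

lemma norm_normCount_mul_locLog_le (S : Set AnyPartition) (m : ℕ) {x : ℂ} (hx : ‖x‖ ≤ locRadius) :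
    ‖normCount (m + 1) x * locLog S (x ^ (m + 1))‖ ≤ 40 * locRadius ^ (m + 1) := by
  have h1 := norm_normCount_le (m + 1) (hx.trans locRadius_lt_one.le)
  have h2 := norm_locLog_le S (norm_pow_succ_le locRadius_lt_one.le hx m)
  rw [norm_pow] at h2
  have h3 := pow_le_pow_left₀ (norm_nonneg x) hx (m + 1)
  rw [norm_mul]
  calc _ ≤ 2 * (20 * ‖x‖ ^ (m + 1)) := mul_le_mul h1 h2 (norm_nonneg _) (by norm_num)
    _ ≤ _ := by linarith

lemma summable_locRadius : Summable fun m : ℕ => 40 * locRadius ^ (m + 1) :=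
  ((summable_nat_add_iff 1).2
    (summable_geometric_of_lt_one locRadius_pos.le locRadius_lt_one)).mul_left 40

/-- The Euler product at `u = 1` as a function of `x = 1 / q`. Since the number of irreducible
polynomials of degree `m` is `x ^ (-m)` times a polynomial in `x`, it makes sense for all complex
`x` in a disc. -/
noncomputable def limFun (S : Set AnyPartition) (x : ℂ) : ℂ :=
  (1 - x) * Complex.exp (∑' m : ℕ, normCount (m + 1) x * locLog S (x ^ (m + 1)))

lemma differentiableOn_limFun (S : Set AnyPartition) :
    DifferentiableOn ℂ (limFun S) (Metric.ball 0 locRadius) := by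
  refine DifferentiableOn.mul (by fun_prop) (DifferentiableOn.cexp ?_)
  refine Complex.differentiableOn_tsum_of_summable_norm summable_locRadius (fun m => ?_)
    Metric.isOpen_ball fun m y hy => norm_normCount_mul_locLog_le S m (mem_ball_zero_iff.1 hy).le
  refine DifferentiableOn.mul ?_ ((differentiableOn_locLog S).comp (by fun_prop) fun y hy => ?_)
  · unfold normCount
    split_ifs <;> fun_prop
  · rw [mem_ball_zero_iff] at hy ⊢
    rw [norm_pow]
    exact (pow_le_of_le_one (norm_nonneg _) (hy.le.trans locRadius_lt_one.le)
      m.succ_ne_zero).trans_lt hy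

/-- The value at `u = 1` of the normalised local factor, for real `y`. -/
lemma hasSum_gser {S : Set AnyPartition} (hS : ∀ p : AnyPartition, p.1 = 0 → p ∈ S)
    (h1 : onePart 1 ∈ S) {y : ℝ} (hy0 : 0 ≤ y) (hy : y ≤ 1 / 2) :
    HasSum (fun j => PowerSeries.coeff j (gser S y) * 1 ^ j) (1 + locRem S y).re := by
  have hyr : ‖(y : ℂ)‖ ≤ locRadius := by
    rw [Complex.norm_real, Real.norm_of_nonneg hy0]
    exact hy.trans (by norm_num [locRadius])
  have h := Complex.reCLM.hasSum (hasSum_locRem hS h1 hyr)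
  have he : ∀ j, Complex.reCLM ((1 - (y : ℂ)) * ecoef S (y : ℂ) j) = (1 - y) * ecoef S y j := by
    intro j
    rw [← ofReal_ecoef, ← Complex.ofReal_one, ← Complex.ofReal_sub, ← Complex.ofReal_mul]
    rfl
  simp only [he, Complex.reCLM_apply] at h
  have hy1 : 1 - y ≠ 0 := by linarith
  have h2 := h.mul_left (1 - y)⁻¹
  simp only [inv_mul_cancel_left₀ hy1] at h2
  have h3 : HasSum (fun j => PowerSeries.coeff j (eser S y) * 1 ^ j)
      ((1 - y)⁻¹ * (1 + locRem S y).re) := by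
    simpa [eser] using h2
  have h4 := hasSum_coeff_mul (hasSum_coeff_sub (hasSum_coeff_C 1 1)
    (hasSum_coeff_mul (hasSum_coeff_C y 1) (hasSum_coeff_X 1))) h3
  rw [mul_one, mul_inv_cancel_left₀ hy1] at h4
  simpa [gser, oneSub] using h4

/-- The remainder is real at real arguments. -/
lemma ofReal_re_locRem (S : Set AnyPartition) {y : ℝ} :
    (((1 + locRem S y).re : ℝ) : ℂ) = 1 + locRem S y := by
  have h : locRem S y = ((∑' j, (1 - y) * ecoef S y (j + 2) : ℝ) : ℂ) := by
    rw [locRem, Complex.ofReal_tsum]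
    refine tsum_congr fun j => ?_
    rw [← ofReal_ecoef]
    push_cast
    rfl
  rw [h, ← Complex.ofReal_one, ← Complex.ofReal_add, Complex.ofReal_re]

variable {F : Type} [Field F] [Finite F]

lemma inv_card_pow_le_half {m : ℕ} (hm : m ≠ 0) : ((Nat.card F : ℝ)⁻¹) ^ m ≤ 1 / 2 :=
  (pow_le_of_le_one inv_card_pos.le (by linarith [inv_card_le_half (F := F)]) hm).trans
    inv_card_le_half

/-- The truncated Euler product at `u = 1`. -/
noncomputable def eulerProd (S : Set AnyPartition) (F : Type) [Field F] [Finite F] (D : ℕ) : ℝ :=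
  (1 - (Nat.card F : ℝ)⁻¹) * ∏ f ∈ irredGL F D,
    (1 + locRem S ((((Nat.card F : ℝ)⁻¹) ^ f.natDegree : ℝ) : ℂ)).re

/-- The value of the truncated Euler product `wser` at `u = 1`. -/
lemma hasSum_wser {S : Set AnyPartition} (hS : ∀ p : AnyPartition, p.1 = 0 → p ∈ S)
    (h1 : onePart 1 ∈ S) (D : ℕ) :
    HasSum (fun n => PowerSeries.coeff n (wser S F D)) (eulerProd S F D) := by
  have h2 := hasSum_coeff_mul (hasSum_coeff_sub (hasSum_coeff_C 1 1)
    (hasSum_coeff_mul (hasSum_coeff_C (Nat.card F : ℝ)⁻¹ 1) (hasSum_coeff_X 1)))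
    (hasSum_coeff_prod (irredGL F D) fun f hf => by
      have hm : f.natDegree ≠ 0 := (mem_irredGL.1 hf).2.1.2.natDegree_pos.ne'
      have h := hasSum_gser hS h1 (pow_nonneg inv_card_pos.le f.natDegree)
        (inv_card_pow_le_half (F := F) hm)
      exact hasSum_coeff_spread (x := 1) hm (by simpa using h))
  simpa [wser, oneSub, eulerProd] using h2

lemma tendsto_eulerProd (S : Set AnyPartition) :
    Filter.Tendsto (fun D => (eulerProd S F D : ℂ)) Filter.atTop
      (nhds (limFun S ((Nat.card F : ℝ)⁻¹ : ℝ))) := by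
  set x := (Nat.card F : ℝ)⁻¹ with hx
  have hx0 : 0 ≤ x := inv_card_pos.le
  have hxr : ‖(x : ℂ)‖ ≤ locRadius := by
    rw [Complex.norm_real, Real.norm_of_nonneg hx0]
    exact (inv_card_le_half (F := F)).trans (by norm_num [locRadius])
  have hD : ∀ D, (eulerProd S F D : ℂ) = (1 - (x : ℂ)) * Complex.exp (∑ m ∈ Finset.range D,
      normCount (m + 1) (x : ℂ) * locLog S ((x : ℂ) ^ (m + 1))) := by
    intro D
    rw [eulerProd, prod_irredGL (F := F) D (fun m => (1 + locRem S ((x ^ m : ℝ) : ℂ)).re),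
      Complex.ofReal_mul, Complex.ofReal_prod, Complex.exp_sum, Finset.range_eq_Ico,
      Finset.prod_Ico_add'
        (fun m => Complex.exp (normCount m (x : ℂ) * locLog S ((x : ℂ) ^ m))) 0 D 1,
      zero_add, show Finset.Ico 1 (D + 1) = Finset.Icc 1 D by
        ext; simp only [Finset.mem_Ico, Finset.mem_Icc]; omega]
    congr 1
    · rw [← hx]; simp
    · refine Finset.prod_congr rfl fun m hm => ?_
      have hm0 : m ≠ 0 := (Nat.lt_of_succ_le (Finset.mem_Icc.1 hm).1).ne'
      have hy : ‖((x ^ m : ℝ) : ℂ)‖ ≤ locRadius := by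
        obtain ⟨k, rfl⟩ := Nat.exists_eq_succ_of_ne_zero hm0
        rw [Complex.ofReal_pow]
        exact norm_pow_succ_le locRadius_lt_one.le hxr k
      rw [Complex.ofReal_pow, ofReal_re_locRem, ← exp_mul_locLog S hy, ← Complex.exp_nat_mul,
        ← mul_assoc, Complex.ofReal_pow]
      congr 2
      have hn := congrArg (fun z : ℝ => (z : ℂ)) (numGL_mul_pow (F := F) hm0)
      simp only [← hx, Complex.ofReal_mul, Complex.ofReal_natCast, Complex.ofReal_pow] at hn
      rw [hn]
      unfold normCount
      split_ifs <;> simp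
  simp only [hD]
  have hs : Summable fun m : ℕ => normCount (m + 1) (x : ℂ) * locLog S ((x : ℂ) ^ (m + 1)) :=
    Summable.of_norm_bounded summable_locRadius fun m => norm_normCount_mul_locLog_le S m hxr
  exact ((Complex.continuous_exp.tendsto _).comp hs.hasSum.tendsto_sum_nat).const_mul _

/-- The proportion in dimension `d` is the partial sum up to index `d` of the series `wser` at
`u = 1`, whose tail is small because the series is bounded in a larger disc. -/
theorem limFun_eq_glProbLim {Λ : Set AnyPartition} (h1 : onePart 1 ∈ Λ) :
    limFun (withEmpty Λ) ((Nat.card F : ℝ)⁻¹ : ℝ) = glProbLim Λ F := by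
  have hS : ∀ p : AnyPartition, p.1 = 0 → p ∈ withEmpty Λ := fun p hp => Or.inl hp
  have hS1 : onePart 1 ∈ withEmpty Λ := Or.inr h1
  obtain ⟨C, hC⟩ := exists_pnorm_wser_le hS (k := 2)
    (fun i h0 h2 => Or.inr (onePart_mem_of_lt_two h1 i h0 h2)) (s := 1 / 4) (by norm_num)
  have hρ := one_lt_card_rpow F (s := 1 / 4) (by norm_num)
  set ρ := (Nat.card F : ℝ) ^ (1 / 4 : ℝ) with hρdef
  have hbound : ∀ d, 1 ≤ d →
      ‖eulerProd (withEmpty Λ) F d - glProb Λ d F‖ ≤ C * (ρ ^ (d + 1))⁻¹ := by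
    intro d hd
    have h := (hasSum_wser (F := F) hS hS1 d).tendsto_sum_nat
    refine le_of_tendsto (h.sub_const (glProb Λ d F)).norm
      (Filter.eventually_atTop.2 ⟨d + 1, fun N hN => ?_⟩)
    rw [glProb_eq_sum Λ hd le_rfl, ← Finset.sum_Ico_eq_sub _ hN, Real.norm_eq_abs]
    exact abs_sum_Ico_coeff_le hρ.le (hC F d N) _
  have h2 : Filter.Tendsto (fun d => eulerProd (withEmpty Λ) F d - glProb Λ d F) Filter.atTop
      (nhds 0) := squeeze_zero_norm' (Filter.eventually_atTop.2 ⟨1, hbound⟩)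
        (tendsto_const_mul_inv_pow_succ hρ C)
  have h3 : Filter.Tendsto (fun d => eulerProd (withEmpty Λ) F d) Filter.atTop
      (nhds (glProbLim Λ F)) := by
    simpa using h2.add (tendsto_glProb h1 F)
  exact tendsto_nhds_unique (tendsto_eulerProd (F := F) (withEmpty Λ))
    ((Complex.continuous_ofReal.tendsto _).comp h3)

/-- The expansion is given by the real parts of the Taylor coefficients of `limFun`. -/
theorem exists_isExpansion_glProbLim {Λ : Set AnyPartition} (h1 : onePart 1 ∈ Λ) :
    ∃ b, IsExpansion (fun F _ _ => glProbLim Λ F) b := by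
  set c : ℕ → ℂ := fun n => (n.factorial : ℂ)⁻¹ * iteratedDeriv n (limFun (withEmpty Λ)) 0
  refine ⟨PowerSeries.mk fun n => (c n).re, fun F _ _ => ?_⟩
  have hx : (((Nat.card F : ℝ)⁻¹ : ℝ) : ℂ) ∈ Metric.ball (0 : ℂ) locRadius := by
    rw [mem_ball_zero_iff, Complex.norm_real, Real.norm_of_nonneg inv_card_pos.le]
    exact inv_card_le_half.trans_lt (by norm_num [locRadius])
  have h := Complex.hasSum_taylorSeries_on_ball (differentiableOn_limFun (withEmpty Λ)) hx
  rw [limFun_eq_glProbLim h1] at h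
  have h2 := Complex.reCLM.hasSum h
  simp only [Complex.reCLM_apply, Complex.ofReal_re] at h2
  refine h2.congr_fun fun n => ?_
  have e : (n.factorial : ℂ)⁻¹ • ((((Nat.card F : ℝ)⁻¹ : ℝ) : ℂ) - 0) ^ n •
      iteratedDeriv n (limFun (withEmpty Λ)) 0 = c n * ((((Nat.card F : ℝ)⁻¹) ^ n : ℝ) : ℂ) := by
    simp only [c, smul_eq_mul, sub_zero, Complex.ofReal_pow]
    ring
  rw [e, Complex.re_mul_ofReal, PowerSeries.coeff_mk]

end Limit

theorem mainTheorem5 (Λ : Set AnyPartition) (h1 : onePart 1 ∈ Λ) :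
    (∀ (F : Type) [Field F] [Finite F],
      Filter.Tendsto (fun d : ℕ => glProb Λ d F) Filter.atTop (nhds (glProbLim Λ F))) ∧
    (∀ d : ℕ, ∃! a : PowerSeries ℝ, IsExpansion (fun F _ _ => glProb Λ d F) a) ∧
    (∃! b : PowerSeries ℝ, IsExpansion (fun F _ _ => glProbLim Λ F) b) ∧
    (∀ (d : ℕ) (a b : PowerSeries ℝ),
      IsExpansion (fun F _ _ => glProb Λ d F) a →
      IsExpansion (fun F _ _ => glProbLim Λ F) b →
      ∀ j : ℕ, (j : ℝ) < ((d : ℝ) + 1) * stabRate Λ →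
        PowerSeries.coeff j a = PowerSeries.coeff j b) := by
  refine ⟨fun F _ _ => tendsto_glProb h1 F, fun d => ?_, ?_,
    fun d a b ha hb j hj => coeff_eq_of_lt_stabRate h1 ha hb hj⟩
  · obtain ⟨a, ha⟩ := exists_isExpansion_glProb Λ d
    exact ⟨a, ha, fun a' ha' => ha'.unique ha⟩
  · obtain ⟨b, hb⟩ := exists_isExpansion_glProbLim h1
    exact ⟨b, hb, fun b' hb' => hb'.unique hb⟩
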